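/- A planar tree $T$ is given by finite ordered sets $D_0(T), D_1(T), D_2(T),\dots$ (the vertices at height $0,1,2,\dots$), where $D_0(T)$ (the root) and $D_1(T)$ have exactly one element, together with order preserving parent maps $D_r(T)\to D_{r-1}(T)$, $r\ge 1$; trees are identified if they are isomorphic by order preserving bijections compatible with the parent maps. The edges of $T$ join each vertex other than the root to its parent, the size $|T|\in\{1,2,\dots\}\cup\{\infty\}$ is the number of edges, the height $h(T)$ is the maximal height of a vertex, and $B_r(T)$, $r\ge 1$, is the subtree spanned by the vertices of height at most $r$. The set $\mathcal T$ of all planar trees is a metric space with $\mathrm{dist}(T,T')=\inf\{\frac1r : r\in\{1,2,\dots\},\ B_r(T)=B_r(T')\}$ and carries its Borel $\sigma$-algebra. For $\mu\in\mathbb R$ and $N\ge1$ let $\nu^{(\mu)}_N$ be the probability measure on $\mathcal T$ supported on the finite set of trees of size $N$ with $\nu_N^{(\mu)}(\{T\})=e^{-\mu h(T)}/Z_N^{(\mu)}$ for $|T|=N$, where $Z_N^{(\mu)}=\sum_{|T|=N}e^{-\mu h(T)}$. **Theorem.** Let $\mu>0$. The measures $\nu_N^{(\mu)}$ converge weakly,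 as $N\to\infty$, to a Borel probability measure $\nu^{(\mu)}$ on $\mathcal T$ (the local limit), and there exist constants $C_1'',C_2''>0$ (depending only on $\mu$) such that for $\nu^{(\mu)}$-almost every $T\in\mathcal T$ there is a number $r_0(T)\in\mathbb N$ with $$C_1''\, r^3\;\le\; |B_r(T)|\;\le\; C_2''\, r^3\log r\qquad\text{for all integers } r\ge r_0(T).$$ In particular, for $\nu^{(\mu)}$-almost every $T$ the Hausdorff dimension (volume growth exponent) $d_h=\lim_{r\to\infty}\frac{\log|B_r(T)|}{\log r}$ exists and equals $3$. -/

import Mathlib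

open Filter Topology MeasureTheory
open scoped ENNReal BoundedContinuousFunction

/-- A (locally finite, rooted) planar tree. The vertices at height `r` form the finite ordered set
`D_r = Fin (width r)`, and `parent r : D_{r+1} → D_r` is the order preserving parent map. The sets
`D_0` (the root) and `D_1` are one-point sets. Since order preserving bijections between the sets
`Fin n` are identities, two such trees are isomorphic as planar trees if and only if they are
equal. -/
structure PlanarTree where
  width : ℕ → ℕ
  parent : ∀ r : ℕ, Fin (width (r + 1)) → Fin (width r)
  parent_mono : ∀ r : ℕ, Monotone (parent r)
  width_zero : width 0 = 1
  width_one : width 1 = 1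

namespace PlanarTree

/-- The vertex set `V(T)`, the disjoint union of the sets `D_r`. -/
abbrev Vertex (T : PlanarTree) : Type := Σ r : ℕ, Fin (T.width r)

/-- The edge set `E(T)`, consisting of the pairs `{i, φ_r(i)}`. -/
def edges (T : PlanarTree) : Set (Sym2 T.Vertex) :=
  {e | ∃ (r : ℕ) (i : Fin (T.width (r + 1))),
    e = s((⟨r + 1, i⟩ : T.Vertex), (⟨r, T.parent r i⟩ : T.Vertex))}

/-- The size `|T|`, i.e. the number of edges, possibly infinite. -/
noncomputable def size (T : PlanarTree) : ℕ∞ := T.edges.encard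

/-- The height `h(T)`, the maximal height of a vertex (`⊤` if there is no bound). -/
noncomputable def height (T : PlanarTree) : ℕ∞ :=
  ⨆ r : {r : ℕ // T.width r ≠ 0}, ((r : ℕ) : ℕ∞)

theorem le_of_lt_ite {P : Prop} [Decidable P] {i n : ℕ} (h : i < if P then n else 0) : P := by
  by_contra hP
  simp [hP] at h

/-- The ball `B_r(T)` around the root: the subtree spanned by the vertices of height at most `r`.
It is meant for `r ≥ 1`; for `r = 0` it is, by convention, the same as for `r = 1`. -/
def ball (r : ℕ) (T : PlanarTree) : PlanarTree where
  width s := if s ≤ max r 1 then T.width s else 0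
  parent s i :=
    ⟨T.parent s ⟨i, i.2.trans_eq (if_pos (le_of_lt_ite i.2))⟩, by
      rw [if_pos ((Nat.le_succ s).trans (le_of_lt_ite i.2))]
      exact Fin.is_lt _⟩
  parent_mono s := by
    intro i j hij
    exact T.parent_mono s (show (⟨i, _⟩ : Fin (T.width (s + 1))) ≤ ⟨j, _⟩ from hij)
  width_zero := by simp [T.width_zero]
  width_one := by simp [T.width_one]

theorem eq_of_val {T T' : PlanarTree} (hw : ∀ s, T.width s = T'.width s)
    (hp : ∀ s i (h : i < T.width (s + 1)) (h' : i < T'.width (s + 1)),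
      (T.parent s ⟨i, h⟩ : ℕ) = T'.parent s ⟨i, h'⟩) : T = T' := by
  obtain ⟨w, p, _, _, _⟩ := T
  obtain ⟨w', p', _, _, _⟩ := T'
  obtain rfl : w = w' := funext hw
  obtain rfl : p = p' := by
    funext s i
    exact Fin.ext (hp s i i.2 i.2)
  rfl

theorem val_congr {T T' : PlanarTree} (h : T = T') (s i : ℕ) (h1 : i < T.width (s + 1))
    (h2 : i < T'.width (s + 1)) : (T.parent s ⟨i, h1⟩ : ℕ) = T'.parent s ⟨i, h2⟩ := by
  subst h
  rfl

theorem ball_ball {s r : ℕ} (hsr : s ≤ r) (T : PlanarTree) : ball s (ball r T) = ball s T := by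
  refine eq_of_val (fun k => ?_) (fun k i h h' => rfl)
  by_cases hk : k ≤ max s 1
  · have : k ≤ max r 1 := hk.trans (max_le_max hsr le_rfl)
    simp only [ball, if_pos hk, if_pos this]
  · simp only [ball, if_neg hk]

theorem ball_eq_mono {s r : ℕ} (hsr : s ≤ r) {T T' : PlanarTree} (h : ball r T = ball r T') :
    ball s T = ball s T' := by
  rw [← ball_ball hsr T, ← ball_ball hsr T', h]

theorem eq_of_forall_ball {T T' : PlanarTree} (h : ∀ r, ball r T = ball r T') : T = T' := by
  have hw : ∀ s, T.width s = T'.width s := by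
    intro s
    have := congrArg (fun U => U.width s) (h s)
    simpa [ball] using this
  refine eq_of_val hw (fun s i h1 h2 => ?_)
  exact val_congr (h (s + 1)) s i (by simpa [ball] using h1) (by simpa [ball] using h2)

/-- The set of values `1 / r`, `r = 1, 2, …`, for which `T` and `T'` share the ball of radius `r`
around the root. -/
def sharedRadii (T T' : PlanarTree) : Set ℝ :=
  {x | ∃ r : ℕ, 1 ≤ r ∧ ball r T = ball r T' ∧ x = 1 / (r : ℝ)}

/-- The distance of two trees: the infimum of all `1 / r` with `B_r(T) = B_r(T')`. -/
noncomputable instance : Dist PlanarTree := ⟨fun T T' => sInf (sharedRadii T T')⟩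

theorem dist_def (T T' : PlanarTree) : dist T T' = sInf (sharedRadii T T') := rfl

theorem sharedRadii_nonempty (T T' : PlanarTree) : (sharedRadii T T').Nonempty := by
  refine ⟨1 / ((1 : ℕ) : ℝ), 1, le_rfl, ?_, rfl⟩
  refine eq_of_val (fun s => ?_) (fun s i h h' => ?_)
  · by_cases hs : s ≤ 1
    · interval_cases s <;> simp [ball, width_zero, width_one]
    · simp [ball, hs]
  · have hs : s + 1 ≤ max 1 1 := le_of_lt_ite h
    obtain rfl : s = 0 := by simpa using hs
    have h1 := ((ball 1 T).parent 0 ⟨i, h⟩).2.trans_eq (width_zero _)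
    have h2 := ((ball 1 T').parent 0 ⟨i, h'⟩).2.trans_eq (width_zero _)
    omega

theorem sharedRadii_pos {T T' : PlanarTree} {x : ℝ} (hx : x ∈ sharedRadii T T') : 0 < x := by
  obtain ⟨r, hr, -, rfl⟩ := hx
  have : (0 : ℝ) < r := by exact_mod_cast hr
  positivity

theorem sharedRadii_bddBelow (T T' : PlanarTree) : BddBelow (sharedRadii T T') :=
  ⟨0, fun _ hx => (sharedRadii_pos hx).le⟩

theorem dist_lt_iff {T T' : PlanarTree} {a : ℝ} :
    dist T T' < a ↔ ∃ r : ℕ, 1 ≤ r ∧ ball r T = ball r T' ∧ 1 / (r : ℝ) < a := by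
  rw [dist_def, csInf_lt_iff (sharedRadii_bddBelow T T') (sharedRadii_nonempty T T')]
  constructor
  · rintro ⟨_, ⟨r, hr, h, rfl⟩, ha⟩
    exact ⟨r, hr, h, ha⟩
  · rintro ⟨r, hr, h, ha⟩
    exact ⟨_, ⟨r, hr, h, rfl⟩, ha⟩

theorem planarDist_nonneg (T T' : PlanarTree) : 0 ≤ dist T T' :=
  le_csInf (sharedRadii_nonempty T T') fun _ hx => (sharedRadii_pos hx).le

theorem planarDist_le_max (T T' T'' : PlanarTree) :
    dist T T'' ≤ max (dist T T') (dist T' T'') := by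
  refine le_of_forall_gt fun a ha => ?_
  obtain ⟨h1, h2⟩ := max_lt_iff.1 ha
  obtain ⟨r, hr, hrT, hra⟩ := dist_lt_iff.1 h1
  obtain ⟨s, hs, hsT, hsa⟩ := dist_lt_iff.1 h2
  refine dist_lt_iff.2 ⟨min r s, le_min hr hs,
    (ball_eq_mono (min_le_left r s) hrT).trans (ball_eq_mono (min_le_right r s) hsT), ?_⟩
  rcases min_choice r s with h | h <;> rw [h] <;> assumption

/-- The metric space of planar trees. -/
noncomputable instance : MetricSpace PlanarTree where
  dist_self T := by
    refine le_antisymm (le_of_forall_gt fun a ha => dist_lt_iff.2 ?_) (planarDist_nonneg T T)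
    obtain ⟨n, hn⟩ := exists_nat_one_div_lt ha
    exact ⟨n + 1, by omega, rfl, by exact_mod_cast hn⟩
  dist_comm T T' := by
    have : sharedRadii T T' = sharedRadii T' T := by
      ext x
      simp only [sharedRadii, Set.mem_ofPred_eq, eq_comm]
    rw [dist_def, dist_def, this]
  dist_triangle T T' T'' := (planarDist_le_max T T' T'').trans
    (max_le_add_of_nonneg (planarDist_nonneg _ _) (planarDist_nonneg _ _))
  eq_of_dist_eq_zero := by
    intro T T' h
    refine eq_of_forall_ball fun n => ?_
    have hn : dist T T' < 1 / ((n : ℝ) + 1) := by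
      rw [h]
      positivity
    obtain ⟨r, hr, hb, hlt⟩ := dist_lt_iff.1 hn
    refine ball_eq_mono ?_ hb
    have hr0 : (0 : ℝ) < r := by exact_mod_cast hr
    have := (one_div_lt_one_div hr0 (by positivity)).1 hlt
    have h3 : (n : ℝ) < r := by linarith
    exact_mod_cast h3.le

/-- Measures on the space of trees are Borel measures. -/
noncomputable instance : MeasurableSpace PlanarTree := borel PlanarTree

instance : BorelSpace PlanarTree := ⟨rfl⟩

/-- The weight `exp (-μ h(T))` (only used for finite trees). -/
noncomputable def weight (μ : ℝ) (T : PlanarTree) : ℝ≥0∞ :=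
  ENNReal.ofReal (Real.exp (-μ * (T.height.toNat : ℝ)))

/-- The finite size partition function `Z_N`, the sum of `exp (-μ h(T))` over all trees of
size `N`. -/
noncomputable def partitionFunction (μ : ℝ) (N : ℕ) : ℝ≥0∞ :=
  ∑' T : {T : PlanarTree // T.size = (N : ℕ∞)}, weight μ T

/-- The measure `ν_N` giving mass `exp (-μ h(T)) / Z_N` to each tree `T` of size `N` and no mass to
other trees; a probability measure for `N ≥ 1`. -/
noncomputable def finiteSizeMeasure (μ : ℝ) (N : ℕ) : Measure PlanarTree :=
  Measure.sum fun T : {T : PlanarTree // T.size = (N : ℕ∞)} =>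
    (weight μ T / partitionFunction μ N) • Measure.dirac (T : PlanarTree)

/-- `ν` is the local limit `ν^{(μ)}`: a Borel probability measure that is the weak limit of the
measures `ν_N` as `N → ∞` (such a measure is unique, the space of trees being metric). -/
def IsLocalLimit (μ : ℝ) (ν : Measure PlanarTree) : Prop :=
  IsProbabilityMeasure ν ∧
    ∀ F : PlanarTree →ᵇ ℝ,
      Tendsto (fun N : ℕ => ∫ T, F T ∂(finiteSizeMeasure μ N)) atTop (𝓝 (∫ T, F T ∂ν))

/-- The volume `|B_r(T)|` of the ball of radius `r` around the root, i.e. its number of edges. -/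
noncomputable def ballVolume (r : ℕ) (T : PlanarTree) : ℕ := (ball r T).size.toNat

/-- `T` has Hausdorff dimension (volume growth exponent) `d`: the limit
`lim_{r → ∞} log |B_r(T)| / log r` exists and equals `d`. -/
def HasHausdorffDim (T : PlanarTree) (d : ℝ) : Prop :=
  Tendsto (fun r : ℕ => Real.log (ballVolume r T : ℝ) / Real.log (r : ℝ)) atTop (𝓝 d)

end PlanarTree

/-!
Weighting by `exp (-μ h)` turns the counting of trees with a prescribed ball of radius `r` into
asymptotics, for large `n`, of `∑ m, exp (-μ m) [xⁿ] f_m(x) ^ K`, where `f_m` is the generating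
function of trees of height at most `m` and `K` is the number of vertices at height `r`. As a
finite continued fraction `f_m` has an explicit spectral decomposition, with largest eigenvalue
`4 cos² (π / (m + 2))`, so for `K = 1` the sum is governed by the minimum of `μ m + π² n / m²`,
attained at `m ≈ (2 π² n / μ) ^ (1/3)`. There the eigenvector weight of the largest eigenvalue is
approximately `2 μ / n`, and taking the `K`-th power changes the sum by an explicit factor.

Up to `exp (-μ r)` this factor is a harmonic function of the critical geometric Galton–Watson
process. The limit is therefore the tree grown level by level from the corresponding harmonic
transform of that process, in which the width at height `n + 1` has mean `μ n² + (μ + 2) n + 1` and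
variance `O(n³)`. By Cauchy–Schwarz the second moment of `|B_r| - μ r³ / 3` is `O(r⁵)`, so that
`|B_r| / r³` tends to `μ / 3` almost surely along the squares, and by monotonicity along all `r`.
-/

theorem natCard_orderHom_fin_eq_multichoose (α : Type*) [LinearOrder α] (n : ℕ) :
    Nat.card (Fin n →o α) = Nat.multichoose (Nat.card α) n := by
  rw [← Sym.natCard_sym_eq_multichoose]
  refine Nat.card_congr (Equiv.ofBijective
    (fun f => (⟨(List.ofFn f : Multiset α), by simp⟩ : Sym α n)) ⟨fun f g h => ?_, ?_⟩)
  · have hperm : (List.ofFn f).Perm (List.ofFn g) := Multiset.coe_eq_coe.1 (congrArg Subtype.val h)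
    exact OrderHom.ext _ _ (List.ofFn_injective
      (hperm.eq_of_sortedLE f.monotone.sortedLE_ofFn g.monotone.sortedLE_ofFn))
  · rintro ⟨s, rfl⟩
    have hofFn : List.ofFn (fun i : Fin s.card =>
        (s.sort (· ≤ ·)).get (i.cast (Multiset.length_sort ..).symm)) = s.sort (· ≤ ·) :=
      List.ext_get (by simp) (by simp)
    refine ⟨⟨_, List.sortedLE_ofFn_iff.1 (hofFn ▸ (Multiset.pairwise_sort s _).sortedLE)⟩, ?_⟩
    exact Subtype.ext ((congrArg _ hofFn).trans (Multiset.sort_eq s _))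

theorem pow_eq_one_sub_mul_tsum_ite {x : ℝ≥0∞} (hx : x < 1) {r h : ℕ} (hrh : r ≤ h) :
    x ^ h = (1 - x) * ∑' m : ℕ, if h ≤ r + m then x ^ (r + m) else 0 := by
  have hshift (m : ℕ) :
      (if h ≤ r + (m + (h - r)) then x ^ (r + (m + (h - r))) else 0) = x ^ h * x ^ m := by
    rw [if_pos (by omega), ← pow_add]
    congr 1
    omega
  rw [← Summable.sum_add_tsum_nat_add' (k := h - r) ENNReal.summable,
    Finset.sum_eq_zero fun m hm => if_neg (by have := Finset.mem_range.1 hm; omega), zero_add]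
  simp_rw [hshift]
  rw [ENNReal.tsum_mul_left, ENNReal.tsum_geometric, mul_left_comm,
    ENNReal.mul_inv_cancel (tsub_pos_of_lt hx).ne' (ENNReal.sub_ne_top ENNReal.one_ne_top), mul_one]

theorem tsum_tsum_eq_tsum_sum_antidiagonal {A : Type*} [AddMonoid A]
    [Finset.HasAntidiagonal A] (f : A → A → ℝ≥0∞) :
    ∑' i, ∑' j, f i j = ∑' n, ∑ p ∈ Finset.HasAntidiagonal.antidiagonal n, f p.1 p.2 := by
  rw [← ENNReal.tsum_prod, ← Finset.HasAntidiagonal.sigmaAntidiagonalEquivProd.tsum_eq,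
    ENNReal.tsum_sigma']
  exact tsum_congr fun n => by
    rw [tsum_fintype]
    exact Finset.sum_coe_sort (Finset.HasAntidiagonal.antidiagonal n) fun p => f p.1 p.2

namespace PlanarTree

/-! ### Heights, volumes and cylinder sets -/

theorem width_ball (r : ℕ) (T : PlanarTree) (s : ℕ) :
    (ball r T).width s = if s ≤ max r 1 then T.width s else 0 := rfl

theorem width_ball_of_le {r s : ℕ} (T : PlanarTree) (h : s ≤ r) :
    (ball r T).width s = T.width s := by
  rw [width_ball, if_pos (h.trans (le_max_left _ _))]

theorem width_succ_eq_zero {T : PlanarTree} {r : ℕ} (h : T.width r = 0) :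
    T.width (r + 1) = 0 := by
  by_contra hne
  exact (h ▸ T.parent r ⟨0, Nat.pos_of_ne_zero hne⟩ : Fin 0).elim0

theorem width_eq_zero_of_le {T : PlanarTree} {r s : ℕ} (h : T.width r = 0) (hrs : r ≤ s) :
    T.width s = 0 := by
  induction s, hrs using Nat.le_induction with
  | base => exact h
  | succ s _ ih => exact width_succ_eq_zero ih

theorem ball_eq_self_iff {r : ℕ} (hr : 1 ≤ r) {T : PlanarTree} :
    ball r T = T ↔ T.width (r + 1) = 0 := by
  constructor
  · intro h
    rw [← h, width_ball, if_neg (by omega)]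
  · intro h
    refine eq_of_val (fun s => ?_) (fun _ _ _ _ => rfl)
    rw [width_ball]
    split_ifs with hs
    · rfl
    · exact (width_eq_zero_of_le h (by omega)).symm

theorem width_eq_zero_of_ball_eq_self {r s : ℕ} (hr : 1 ≤ r) {T : PlanarTree} (hT : ball r T = T)
    (hrs : r < s) : T.width s = 0 :=
  width_eq_zero_of_le ((ball_eq_self_iff hr).1 hT) hrs

theorem height_le_iff {m : ℕ} (hm : 1 ≤ m) {T : PlanarTree} :
    T.height ≤ m ↔ ball m T = T := by
  rw [ball_eq_self_iff hm, height, iSup_le_iff]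
  constructor
  · intro h
    by_contra hne
    have := Nat.cast_le.1 (h ⟨m + 1, hne⟩)
    dsimp only at this
    omega
  · rintro h ⟨r, hr⟩
    by_contra hlt
    exact hr (width_eq_zero_of_le h (by simpa using hlt))

theorem le_height {T : PlanarTree} {r : ℕ} (h : T.width r ≠ 0) : (r : ℕ∞) ≤ T.height :=
  le_iSup (fun r : {r : ℕ // T.width r ≠ 0} => ((r : ℕ) : ℕ∞)) ⟨r, h⟩

theorem size_eq_card (T : PlanarTree) : T.size = ENat.card (Σ s, Fin (T.width (s + 1))) := by
  let f : (Σ s, Fin (T.width (s + 1))) → Sym2 T.Vertex := fun p =>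
    s((⟨p.1 + 1, p.2⟩ : T.Vertex), (⟨p.1, T.parent p.1 p.2⟩ : T.Vertex))
  have hf : Function.Injective f := by
    rintro ⟨s, i⟩ ⟨t, j⟩ h
    rcases Sym2.eq_iff.1 h with ⟨hchild, -⟩ | ⟨hst, hts⟩
    · have hst : s + 1 = t + 1 := congrArg Sigma.fst hchild
      obtain rfl : s = t := Nat.succ.inj hst
      simpa using hchild
    · have hst : s + 1 = t := congrArg Sigma.fst hst
      have hts : s = t + 1 := congrArg Sigma.fst hts
      omega
  have hedges : T.edges = Set.range f := by
    ext e
    simp only [edges, Set.mem_ofPred_eq, Set.mem_range, Sigma.exists, f, eq_comm]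
  rw [size, hedges, ← Set.image_univ, hf.encard_image, Set.encard_univ]

/-- The number of edges of `B_r(T)`, written as a sum of widths (see `ballVolume_eq`); unlike
`ballVolume` it vanishes at `r = 0`. -/
def volume (r : ℕ) (T : PlanarTree) : ℕ := ∑ s ∈ Finset.range r, T.width (s + 1)

theorem volume_succ (r : ℕ) (T : PlanarTree) :
    T.volume (r + 1) = T.volume r + T.width (r + 1) := Finset.sum_range_succ _ _

theorem volume_mono (T : PlanarTree) : Monotone fun r => T.volume r :=
  monotone_nat_of_le_succ fun r => (volume_succ r T).symm ▸ Nat.le_add_right _ _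

theorem one_le_volume {r : ℕ} (hr : 1 ≤ r) (T : PlanarTree) : 1 ≤ T.volume r :=
  calc 1 = T.volume 1 := by simp [volume, T.width_one]
    _ ≤ T.volume r := volume_mono T hr

theorem volume_ball {r s : ℕ} (h : s ≤ r) (T : PlanarTree) : (ball r T).volume s = T.volume s :=
  Finset.sum_congr rfl fun t ht => width_ball_of_le T (by
    have := Finset.mem_range.1 ht
    omega)

theorem size_of_ball_eq_self {r : ℕ} (hr : 1 ≤ r) {T : PlanarTree} (hT : ball r T = T) :
    T.size = (T.volume r : ℕ∞) := by
  let e : (Σ s : Fin r, Fin (T.width (s + 1))) → (Σ s, Fin (T.width (s + 1))) :=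
    fun p => ⟨p.1, p.2⟩
  have he : Function.Bijective e := by
    constructor
    · rintro ⟨s, i⟩ ⟨t, j⟩ h
      obtain ⟨hst, hij⟩ := Sigma.mk.inj h
      obtain rfl : s = t := Fin.ext hst
      simpa using hij
    · rintro ⟨s, i⟩
      have hs : s < r := by
        by_contra hs
        have hw := width_eq_zero_of_ball_eq_self hr hT (show r < s + 1 by omega)
        exact (hw ▸ i : Fin 0).elim0
      exact ⟨⟨⟨s, hs⟩, i⟩, rfl⟩
  rw [size_eq_card, ← ENat.card_congr (Equiv.ofBijective e he), ENat.card_eq_coe_fintype_card,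
    Fintype.card_sigma, volume]
  simp [Finset.sum_range]

theorem ballVolume_eq {r : ℕ} (hr : 1 ≤ r) (T : PlanarTree) : ballVolume r T = T.volume r := by
  rw [ballVolume, size_of_ball_eq_self hr (ball_ball le_rfl T), volume_ball le_rfl,
    ENat.toNat_natCast]

theorem exists_ball_eq_self {T : PlanarTree} (h : T.size ≠ ⊤) :
    ∃ m, 1 ≤ m ∧ ball m T = T := by
  by_contra! hne
  have hw (s : ℕ) : T.width (s + 1) ≠ 0 := fun hs =>
    hne (s + 1) (by omega) ((ball_eq_self_iff (by omega)).2 (width_succ_eq_zero hs))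
  apply h
  rw [size_eq_card, ENat.card_eq_top]
  exact Infinite.of_injective
    (fun s : ℕ => (⟨s, ⟨0, Nat.pos_of_ne_zero (hw s)⟩⟩ : Σ s, Fin (T.width (s + 1))))
    (fun s t hst => congrArg Sigma.fst hst)

theorem height_ne_top {T : PlanarTree} (h : T.size ≠ ⊤) : T.height ≠ ⊤ := by
  obtain ⟨m, hm, hb⟩ := exists_ball_eq_self h
  exact ne_top_of_le_ne_top (ENat.natCast_ne_top m) ((height_le_iff hm).2 hb)

theorem isOpen_cylinder (r : ℕ) (T : PlanarTree) : IsOpen {U : PlanarTree | ball r U = T} := by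
  rw [Metric.isOpen_iff]
  intro U hU
  refine ⟨1 / ((r : ℝ) + 1), by positivity, fun V hV => ?_⟩
  obtain ⟨s, hs, hball, hlt⟩ := dist_lt_iff.1 (Metric.mem_ball.1 hV)
  have hs0 : (0 : ℝ) < s := by exact_mod_cast hs
  have hrs : (r : ℝ) + 1 < s := (one_div_lt_one_div hs0 (by positivity)).1 hlt
  have hrs' : r + 1 < s := by exact_mod_cast hrs
  exact (ball_eq_mono (by omega) hball).trans hU

theorem measurableSet_cylinder (r : ℕ) (T : PlanarTree) :
    MeasurableSet {U : PlanarTree | ball r U = T} := (isOpen_cylinder r T).measurableSet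

end PlanarTree

namespace PlanarTree

/-! ### Extending a tree level by level -/

/-- The trees of height at most `r + m` whose ball of radius `r` is `T`. -/
abbrev Extension (r m : ℕ) (T : PlanarTree) : Type :=
  {U : PlanarTree // ball (r + m) U = U ∧ ball r U = T}

/-- The tree obtained from the ball of radius `r` of `T` by adding a level of `b` vertices at
height `r + 1`, with parents given by `f`. -/
def extend (r : ℕ) (hr : 1 ≤ r) (T : PlanarTree) (b : ℕ) (f : Fin b →o Fin (T.width r)) :
    PlanarTree where
  width s := if s ≤ r then T.width s else if s = r + 1 then b else 0
  parent s i :=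
    if h : s + 1 ≤ r then
      ⟨T.parent s ⟨i, i.2.trans_eq (if_pos h)⟩, (Fin.is_lt _).trans_eq (if_pos (by omega)).symm⟩
    else
      have hs : s + 1 = r + 1 := le_of_lt_ite (i.2.trans_eq (if_neg h))
      ⟨f ⟨i, i.2.trans_eq (by rw [if_neg h, if_pos hs])⟩, by
        obtain rfl : s = r := by omega
        exact (Fin.is_lt _).trans_eq (if_pos le_rfl).symm⟩
  parent_mono s := by
    intro i j hij
    by_cases h : s + 1 ≤ r
    · simp only [dif_pos h]
      exact T.parent_mono s (show (⟨i, _⟩ : Fin (T.width (s + 1))) ≤ ⟨j, _⟩ from hij)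
    · simp only [dif_neg h]
      exact f.monotone (show (⟨i, _⟩ : Fin b) ≤ ⟨j, _⟩ from hij)
  width_zero := by simp [T.width_zero]
  width_one := by simp [T.width_one, hr]

section extend

variable {r : ℕ} (hr : 1 ≤ r) {T : PlanarTree} {b : ℕ}

theorem width_extend_succ (f : Fin b →o Fin (T.width r)) :
    (extend r hr T b f).width (r + 1) = b := by
  simp [extend]

theorem ball_succ_extend (f : Fin b →o Fin (T.width r)) :
    ball (r + 1) (extend r hr T b f) = extend r hr T b f := by
  rw [ball_eq_self_iff (by omega)]
  simp [extend]

theorem ball_extend (hT : ball r T = T) (f : Fin b →o Fin (T.width r)) :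
    ball r (extend r hr T b f) = T := by
  refine eq_of_val (fun s => ?_) (fun s i h1 h2 => ?_)
  · rw [width_ball]
    split_ifs with hs
    · simp [extend, show s ≤ r by omega]
    · exact (width_eq_zero_of_ball_eq_self hr hT (by omega)).symm
  · have hs : s + 1 ≤ r := by
      have := le_of_lt_ite h1
      omega
    simp [ball, extend, hs]

theorem extend_injective {c : ℕ} {f : Fin b →o Fin (T.width r)} {g : Fin c →o Fin (T.width r)}
    (h : extend r hr T b f = extend r hr T c g) :
    (⟨b, f⟩ : Σ b, Fin b →o Fin (T.width r)) = ⟨c, g⟩ := by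
  obtain rfl : b = c := by rw [← width_extend_succ hr f, ← width_extend_succ hr g, h]
  congr 1
  refine OrderHom.ext _ _ (funext fun i => Fin.ext ?_)
  simpa [extend] using val_congr h r i (by rw [width_extend_succ]; exact i.2)
    (by rw [width_extend_succ]; exact i.2)

theorem exists_extend_eq {U : PlanarTree} (hU : ball (r + 1) U = U) :
    ∃ f : Fin (U.width (r + 1)) →o Fin ((ball r U).width r),
      extend r hr (ball r U) (U.width (r + 1)) f = U := by
  have hw : U.width r = (ball r U).width r := (width_ball_of_le U le_rfl).symm
  have hzero {s : ℕ} (hs : r + 1 < s) : U.width s = 0 :=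
    width_eq_zero_of_ball_eq_self (by omega) hU hs
  refine ⟨⟨fun i => (U.parent r i).cast hw, fun i j hij => U.parent_mono r hij⟩,
    eq_of_val (fun s => ?_) (fun s i h1 h2 => ?_)⟩
  · change (if s ≤ r then (ball r U).width s else if s = r + 1 then U.width (r + 1) else 0) = _
    split_ifs with h h'
    · exact width_ball_of_le U h
    · rw [h']
    · exact (hzero (by omega)).symm
  · by_cases h : s + 1 ≤ r
    · simp [extend, h, ball]
    · obtain rfl : s = r := by
        by_contra hne
        rw [hzero (by omega)] at h2
        omega
      simp only [extend, h, dite_false]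
      rfl

theorem bijective_extend (hT : ball r T = T) :
    Function.Bijective (fun p : (Σ b, Fin b →o Fin (T.width r)) =>
      (⟨extend r hr T p.1 p.2, ball_succ_extend hr p.2, ball_extend hr hT p.2⟩ :
        Extension r 1 T)) := by
  refine ⟨fun p q h => extend_injective hr (congrArg Subtype.val h), ?_⟩
  rintro ⟨U, hU, rfl⟩
  obtain ⟨f, hf⟩ := exists_extend_eq hr hU
  exact ⟨⟨_, f⟩, Subtype.ext hf⟩

instance finite_orderHom_fin (b k : ℕ) : Finite (Fin b →o Fin k) :=
  Finite.of_injective (fun f => (f : Fin b → Fin k)) DFunLike.coe_injective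

include hr

theorem countable_extension_one (hT : ball r T = T) : Countable (Extension r 1 T) :=
  (bijective_extend hr hT).2.countable

theorem tsum_extension_one (hT : ball r T = T) (F : ℕ → ℝ≥0∞) :
    ∑' U : Extension r 1 T, F (U.1.width (r + 1)) =
      ∑' b, (Nat.multichoose (T.width r) b : ℝ≥0∞) * F b := by
  rw [← (Equiv.ofBijective _ (bijective_extend hr hT)).tsum_eq, ENNReal.tsum_sigma']
  refine tsum_congr fun b => ?_
  simp only [Equiv.ofBijective_apply, width_extend_succ]
  rw [ENNReal.tsum_const, ENat.card_eq_coe_natCard, natCard_orderHom_fin_eq_multichoose,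
    Nat.card_fin, ENat.toENNReal_coe]

end extend

/-- The trees of height at most `r`. -/
abbrev BoundedTree (r : ℕ) : Type := {T : PlanarTree // ball r T = T}

/-- A tree of height at most `r + 1` amounts to its ball of radius `r` and a one-level extension. -/
def boundedTreeSuccEquiv (r : ℕ) : (Σ T : BoundedTree r, Extension r 1 T.1) ≃ BoundedTree (r + 1)
    where
  toFun p := ⟨p.2.1, p.2.2.1⟩
  invFun U := ⟨⟨ball r U.1, ball_ball le_rfl _⟩, ⟨U.1, U.2, rfl⟩⟩
  left_inv := by
    rintro ⟨⟨T, hT⟩, ⟨U, hU, hUT⟩⟩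
    dsimp only at hUT
    subst hUT
    rfl
  right_inv _ := rfl

/-- An extension by `m + 1` levels amounts to an extension by one level followed by one by `m`. -/
def extensionSuccEquiv (r m : ℕ) (T : PlanarTree) :
    (Σ T' : Extension r 1 T, Extension (r + 1) m T'.1) ≃ Extension r (m + 1) T where
  toFun p := ⟨p.2.1, by rw [← Nat.add_assoc, Nat.add_right_comm, p.2.2.1],
    (ball_ball (Nat.le_succ r) _).symm.trans ((congrArg (ball r) p.2.2.2).trans p.1.2.2)⟩
  invFun U := ⟨⟨ball (r + 1) U.1, ball_ball le_rfl _, by rw [ball_ball (Nat.le_succ r), U.2.2]⟩,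
    ⟨U.1, by rw [Nat.add_right_comm, Nat.add_assoc, U.2.1], rfl⟩⟩
  left_inv := by
    rintro ⟨⟨T', hT'⟩, ⟨U, hU, hUT⟩⟩
    dsimp only at hUT
    subst hUT
    rfl
  right_inv _ := rfl

theorem eq_of_ball_one {T U : PlanarTree} (hT : ball 1 T = T) (hU : ball 1 U = U) : T = U := by
  refine eq_of_val (fun s => ?_) (fun s i h1 h2 => ?_)
  · rcases s with _ | _ | s
    · rw [T.width_zero, U.width_zero]
    · rw [T.width_one, U.width_one]
    · rw [width_eq_zero_of_ball_eq_self le_rfl hT (by omega),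
        width_eq_zero_of_ball_eq_self le_rfl hU (by omega)]
  · obtain rfl : s = 0 := by
      by_contra hs
      rw [width_eq_zero_of_ball_eq_self le_rfl hT (by omega)] at h1
      omega
    have := (T.parent 0 ⟨i, h1⟩).2.trans_eq T.width_zero
    have := (U.parent 0 ⟨i, h2⟩).2.trans_eq U.width_zero
    omega

instance countable_boundedTree (r : ℕ) : Countable (BoundedTree r) := by
  have hone : Countable (BoundedTree 1) := by
    have : Subsingleton (BoundedTree 1) := ⟨fun T U => Subtype.ext (eq_of_ball_one T.2 U.2)⟩
    infer_instance
  rcases Nat.eq_zero_or_pos r with rfl | hr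
  · exact hone
  · induction r, hr using Nat.le_induction with
    | base => exact hone
    | succ r hr ih =>
      have (T : BoundedTree r) : Countable (Extension r 1 T.1) := countable_extension_one hr T.2
      exact (boundedTreeSuccEquiv r).symm.injective.countable

/-- The tree with a single edge. -/
def edge : PlanarTree where
  width s := if s ≤ 1 then 1 else 0
  parent s i := ⟨0, by
    rw [if_pos (by have := le_of_lt_ite i.2; omega)]
    exact one_pos⟩
  parent_mono _ _ _ _ := le_rfl
  width_zero := rfl
  width_one := rfl

theorem width_edge : edge.width 1 = 1 := rfl

theorem volume_edge : edge.volume 1 = 1 := by simp [volume, edge]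

theorem ball_edge : ball 1 edge = edge := (ball_eq_self_iff le_rfl).2 rfl

theorem ball_one (T : PlanarTree) : ball 1 T = edge :=
  eq_of_ball_one (ball_ball le_rfl T) ball_edge

/-! ### Counting trees by height and size -/

/-- The number of ways to continue a level of `k` vertices by at most `m` further levels with `n`
vertices in total. -/
def continuations : ℕ → ℕ → ℕ → ℕ
  | 0, _, n => if n = 0 then 1 else 0
  | m + 1, k, n =>
    ∑ p ∈ Finset.HasAntidiagonal.antidiagonal n, Nat.multichoose k p.1 * continuations m p.1 p.2

theorem tsum_extension_volume (m : ℕ) {r : ℕ} (hr : 1 ≤ r) {T : PlanarTree} (hT : ball r T = T)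
    (F : ℕ → ℝ≥0∞) :
    ∑' U : Extension r m T, F (U.1.volume (r + m)) =
      ∑' n, (continuations m (T.width r) n : ℝ≥0∞) * F (T.volume r + n) := by
  induction m generalizing r T with
  | zero =>
    have hval (U : Extension r 0 T) : U.1 = T := U.2.1.symm.trans U.2.2
    rw [tsum_eq_single ⟨T, hT, hT⟩ fun U hU => absurd (Subtype.ext (hval U)) hU,
      tsum_eq_single 0 fun n hn => by simp [continuations, hn]]
    simp [continuations]
  | succ m ih =>
    have hfiber (T' : Extension r 1 T) :
        ∑' U : Extension (r + 1) m T'.1, F (U.1.volume (r + (m + 1))) =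
          ∑' n, (continuations m (T'.1.width (r + 1)) n : ℝ≥0∞) *
            F (T.volume r + T'.1.width (r + 1) + n) := by
      rw [← Nat.add_assoc, Nat.add_right_comm, ih (by omega) T'.2.1, volume_succ,
        ← volume_ball le_rfl T'.1, T'.2.2]
    rw [← (extensionSuccEquiv r m T).tsum_eq, ENNReal.tsum_sigma']
    refine (tsum_congr hfiber).trans ?_
    rw [tsum_extension_one hr hT fun b =>
      ∑' n, (continuations m b n : ℝ≥0∞) * F (T.volume r + b + n)]
    simp_rw [← ENNReal.tsum_mul_left]
    rw [tsum_tsum_eq_tsum_sum_antidiagonal]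
    refine tsum_congr fun n => ?_
    simp only [continuations, Nat.cast_sum, Nat.cast_mul, Finset.sum_mul]
    refine Finset.sum_congr rfl fun p hp => ?_
    rw [← Finset.HasAntidiagonal.mem_antidiagonal.1 hp, mul_assoc, Nat.add_assoc]

theorem tsum_extension_volume_eq (m : ℕ) {r : ℕ} (hr : 1 ≤ r) {T : PlanarTree}
    (hT : ball r T = T) {N : ℕ} (hN : T.volume r ≤ N) :
    ∑' U : Extension r m T, (if U.1.volume (r + m) = N then 1 else 0 : ℝ≥0∞) =
      continuations m (T.width r) (N - T.volume r) := by
  rw [tsum_extension_volume m hr hT fun v => if v = N then 1 else 0,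
    tsum_eq_single (N - T.volume r) fun n hn => by rw [if_neg (by omega), mul_zero],
    if_pos (by omega), mul_one]

/-! ### The finite size measures on cylinder sets -/

/-- The weight `exp (-μ)` per unit of height. -/
noncomputable def heightFugacity (μ : ℝ) : ℝ≥0∞ := ENNReal.ofReal (Real.exp (-μ))

theorem heightFugacity_lt_one {μ : ℝ} (hμ : 0 < μ) : heightFugacity μ < 1 := by
  rw [heightFugacity, ENNReal.ofReal_lt_one, Real.exp_lt_one_iff]
  linarith

theorem heightFugacity_pos (μ : ℝ) : 0 < heightFugacity μ :=
  ENNReal.ofReal_pos.2 (Real.exp_pos _)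

theorem heightFugacity_pow (μ : ℝ) (m : ℕ) :
    heightFugacity μ ^ m = ENNReal.ofReal (Real.exp (-μ * m)) := by
  rw [heightFugacity, ← ENNReal.ofReal_pow (Real.exp_pos _).le, ← Real.exp_nat_mul, mul_comm]

theorem one_sub_heightFugacity_ne_zero {μ : ℝ} (hμ : 0 < μ) : 1 - heightFugacity μ ≠ 0 :=
  (tsub_pos_of_lt (heightFugacity_lt_one hμ)).ne'

/-- The generating function, in the number `m` of levels, of the numbers `continuations m k n`. -/
noncomputable def continuationSeries (x : ℝ≥0∞) (k n : ℕ) : ℝ≥0∞ :=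
  ∑' m : ℕ, x ^ m * (continuations m k n : ℝ≥0∞)

theorem weight_eq_tsum {μ : ℝ} (hμ : 0 < μ) {r : ℕ} (hr : 1 ≤ r) {U : PlanarTree}
    (hU : U.size ≠ ⊤) (hw : U.width r ≠ 0) :
    weight μ U = (1 - heightFugacity μ) * ∑' m : ℕ,
      {U | ball (r + m) U = U}.indicator (fun _ => heightFugacity μ ^ (r + m)) U := by
  have hheight := height_ne_top hU
  have hle : r ≤ U.height.toNat := by simpa using ENat.toNat_le_toNat (le_height hw) hheight
  rw [weight, ← heightFugacity_pow, pow_eq_one_sub_mul_tsum_ite (heightFugacity_lt_one hμ) hle]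
  congr 1
  refine tsum_congr fun m => ?_
  have hiff : U.height.toNat ≤ r + m ↔ ball (r + m) U = U := by
    rw [← height_le_iff (by omega), ← ENat.natCast_toNat hheight]
    norm_cast
  by_cases hball : ball (r + m) U = U <;> simp [hiff, hball]

theorem tsum_weight_cylinder {μ : ℝ} (hμ : 0 < μ) {r : ℕ} (hr : 1 ≤ r) {T : PlanarTree}
    (hT : ball r T = T) (hw : T.width r ≠ 0) {N : ℕ} (hN : T.volume r ≤ N) :
    ∑' U : PlanarTree, {U : PlanarTree | U.size = (N : ℕ∞) ∧ ball r U = T}.indicator (weight μ) U =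
      (1 - heightFugacity μ) * (heightFugacity μ ^ r *
        continuationSeries (heightFugacity μ) (T.width r) (N - T.volume r)) := by
  set x := heightFugacity μ
  have hlevels (U : PlanarTree) :
      {U : PlanarTree | U.size = (N : ℕ∞) ∧ ball r U = T}.indicator (weight μ) U =
      (1 - x) * ∑' m : ℕ, {U | ball (r + m) U = U ∧ ball r U = T}.indicator
        (fun U => x ^ (r + m) * if U.volume (r + m) = N then 1 else 0) U := by
    by_cases hU : U.size = (N : ℕ∞) ∧ ball r U = T
    · rw [Set.indicator_of_mem (by exact hU), weight_eq_tsum hμ hr (by simp [hU.1])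
        (by rwa [← width_ball_of_le U le_rfl, hU.2])]
      congr 1
      refine tsum_congr fun m => ?_
      by_cases hball : ball (r + m) U = U
      · have hvol := size_of_ball_eq_self (by omega) hball
        rw [hU.1, Nat.cast_inj] at hvol
        simp [hball, hU.2, hvol, x]
      · simp [hball]
    · rw [Set.indicator_of_notMem (by exact hU), ENNReal.tsum_eq_zero.2, mul_zero]
      intro m
      refine Set.indicator_apply_eq_zero.2 fun ⟨hball, hUT⟩ => ?_
      rw [if_neg, mul_zero]
      exact fun hvol => hU ⟨by rw [size_of_ball_eq_self (by omega) hball, hvol], hUT⟩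
  rw [tsum_congr hlevels, ENNReal.tsum_mul_left, ENNReal.tsum_comm, continuationSeries,
    ← ENNReal.tsum_mul_left (a := x ^ r)]
  congr 1
  refine tsum_congr fun m => ?_
  rw [← tsum_subtype {U | ball (r + m) U = U ∧ ball r U = T}
    (fun U => x ^ (r + m) * if U.volume (r + m) = N then 1 else 0), ENNReal.tsum_mul_left,
    pow_add, mul_assoc]
  congr 2
  exact tsum_extension_volume_eq m hr hT hN

theorem partitionFunction_eq {μ : ℝ} (hμ : 0 < μ) {N : ℕ} (hN : 1 ≤ N) :
    partitionFunction μ N = (1 - heightFugacity μ) * (heightFugacity μ *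
        continuationSeries (heightFugacity μ) 1 (N - 1)) := by
  have h := tsum_weight_cylinder hμ le_rfl ball_edge one_ne_zero (N := N) (volume_edge.trans_le hN)
  rw [volume_edge, pow_one, width_edge] at h
  rw [← h, partitionFunction]
  simp only [ball_one, and_true]
  exact tsum_subtype {T : PlanarTree | T.size = (N : ℕ∞)} (weight μ)

theorem finiteSizeMeasure_apply (μ : ℝ) (N : ℕ) {s : Set PlanarTree} (hs : MeasurableSet s) :
    finiteSizeMeasure μ N s = (∑' U : PlanarTree,
      {U : PlanarTree | U.size = (N : ℕ∞) ∧ U ∈ s}.indicator (weight μ) U) /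
        partitionFunction μ N := by
  rw [finiteSizeMeasure, Measure.sum_apply _ hs, div_eq_mul_inv, ← ENNReal.tsum_mul_right]
  simp only [Measure.smul_apply, Measure.dirac_apply' _ hs, smul_eq_mul]
  refine (tsum_subtype {T : PlanarTree | T.size = (N : ℕ∞)}
    (fun T => weight μ T / partitionFunction μ N * s.indicator 1 T)).trans
    (tsum_congr fun U => ?_)
  by_cases hsize : U.size = (N : ℕ∞) <;> by_cases hU : U ∈ s <;>
    simp [Set.indicator, hsize, hU, div_eq_mul_inv]

theorem finiteSizeMeasure_cylinder {μ : ℝ} (hμ : 0 < μ) {r : ℕ} (hr : 1 ≤ r) {T : PlanarTree}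
    (hT : ball r T = T) (hw : T.width r ≠ 0) {N : ℕ} (hN : T.volume r ≤ N) :
    finiteSizeMeasure μ N {U | ball r U = T} =
      heightFugacity μ ^ (r - 1) *
        (continuationSeries (heightFugacity μ) (T.width r) (N - T.volume r) /
        continuationSeries (heightFugacity μ) 1 (N - 1)) := by
  rw [finiteSizeMeasure_apply μ N (measurableSet_cylinder r T),
    partitionFunction_eq hμ ((one_le_volume hr T).trans hN)]
  simp only [Set.mem_ofPred_eq]
  rw [tsum_weight_cylinder hμ hr hT hw hN,
    ENNReal.mul_div_mul_left _ _ (one_sub_heightFugacity_ne_zero hμ)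
      (ENNReal.sub_ne_top ENNReal.one_ne_top)]
  obtain ⟨r, rfl⟩ := Nat.exists_eq_add_of_le' hr
  rw [pow_succ', mul_assoc, ENNReal.mul_div_mul_left _ _ (heightFugacity_pos μ).ne'
    (heightFugacity_lt_one hμ).ne_top, Nat.add_sub_cancel, mul_div_assoc]

end PlanarTree

/-! ### The generating function of continuations -/

section CoeffInvOneSubXMul

open PowerSeries

theorem one_sub_mul_sum_multichoose {R : Type*} [CommRing R] (Y : R) (B k : ℕ) :
    (1 - Y) * ∑ b ∈ Finset.range (B + 1), (Nat.multichoose (k + 1) b : R) * Y ^ b =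
      ∑ b ∈ Finset.range (B + 1), (Nat.multichoose k b : R) * Y ^ b -
        (Nat.multichoose (k + 1) B : R) * Y ^ (B + 1) := by
  induction B with
  | zero => simp
  | succ B ih =>
    rw [Finset.sum_range_succ, mul_add, ih, Finset.sum_range_succ _ (B + 1),
      Nat.multichoose_succ_succ]
    push_cast
    ring

theorem exists_one_sub_pow_mul_sum_multichoose {R : Type*} [CommRing R] (Y : R) (B k : ℕ) :
    ∃ Z : R, (1 - Y) ^ k * ∑ b ∈ Finset.range (B + 1), (Nat.multichoose k b : R) * Y ^ b =
      1 + Y ^ (B + 1) * Z := by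
  induction k with
  | zero =>
    refine ⟨0, ?_⟩
    rw [Finset.sum_range_succ', Finset.sum_eq_zero] <;> simp
  | succ k ih =>
    obtain ⟨Z, hZ⟩ := ih
    refine ⟨Z - (1 - Y) ^ k * (Nat.multichoose (k + 1) B : R), ?_⟩
    rw [pow_succ, mul_assoc, one_sub_mul_sum_multichoose, mul_sub, hZ]
    ring

theorem coeff_inv_one_sub_X_mul_pow {K : Type*} [Field K] (f : K⟦X⟧) (k n : ℕ) :
    coeff n ((1 - X * f)⁻¹ ^ k) = ∑ p ∈ Finset.HasAntidiagonal.antidiagonal n,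
      (Nat.multichoose k p.1 : K) * coeff p.2 (f ^ p.1) := by
  obtain ⟨Z, hZ⟩ := exists_one_sub_pow_mul_sum_multichoose (X * f) n k
  have hinv : (1 - X * f)⁻¹ ^ k * (1 - X * f) ^ k = 1 := by
    rw [← mul_pow, PowerSeries.inv_mul_cancel _ (by simp), one_pow]
  have htrunc : ∑ b ∈ Finset.range (n + 1), (Nat.multichoose k b : K⟦X⟧) * (X * f) ^ b =
      (1 - X * f)⁻¹ ^ k + X ^ (n + 1) * (f ^ (n + 1) * Z * (1 - X * f)⁻¹ ^ k) := by
    linear_combination (1 - X * f)⁻¹ ^ k * hZ -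
      (∑ b ∈ Finset.range (n + 1), (Nat.multichoose k b : K⟦X⟧) * (X * f) ^ b) * hinv
  have hcoeff := congrArg (coeff n) htrunc
  rw [map_add, coeff_X_pow_mul', if_neg (by omega), add_zero] at hcoeff
  rw [← hcoeff, map_sum, Finset.Nat.sum_antidiagonal_eq_sum_range_succ_mk]
  refine Finset.sum_congr rfl fun b hb => ?_
  rw [mul_pow, ← map_natCast (C (R := K)), coeff_C_mul, coeff_X_pow_mul',
    if_pos (Nat.le_of_lt_succ (Finset.mem_range.1 hb))]

end CoeffInvOneSubXMul

namespace PlanarTree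

open PowerSeries

/-- The generating function of the continuations of a single vertex by at most `m` levels. -/
noncomputable def levelSeries : ℕ → ℝ⟦X⟧
  | 0 => 1
  | m + 1 => (1 - X * levelSeries m)⁻¹

theorem levelSeries_succ_mul (m : ℕ) : levelSeries (m + 1) * (1 - X * levelSeries m) = 1 :=
  PowerSeries.inv_mul_cancel _ (by simp)

theorem continuations_eq_coeff (m k n : ℕ) :
    (continuations m k n : ℝ) = coeff n (levelSeries m ^ k) := by
  induction m generalizing k n with
  | zero => simp [continuations, levelSeries, coeff_one]
  | succ m ih =>
    rw [levelSeries, coeff_inv_one_sub_X_mul_pow, continuations]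
    push_cast
    simp_rw [ih]

theorem continuations_le_succ (m k n : ℕ) : continuations m k n ≤ continuations (m + 1) k n := by
  induction m generalizing k n with
  | zero => by_cases h : n = 0 <;> simp [continuations, h]
  | succ m ih =>
    rw [continuations, continuations]
    exact Finset.sum_le_sum fun p _ => Nat.mul_le_mul_left _ (ih _ _)

theorem continuations_mono (k n : ℕ) : Monotone fun m => continuations m k n :=
  monotone_nat_of_le_succ fun m => continuations_le_succ m k n

end PlanarTree

/-! ### Walks on a path -/

theorem two_sin_mul_sum_cos (x : ℝ) (n : ℕ) :
    2 * Real.sin (x / 2) * ∑ k ∈ Finset.range n, Real.cos (k * x) =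
      Real.sin ((n - 1 / 2) * x) + Real.sin (x / 2) := by
  induction n with
  | zero =>
    have : ((0 : ℕ) - 1 / 2 : ℝ) * x = -(x / 2) := by push_cast; ring
    rw [this]
    simp
  | succ n ih =>
    rw [Finset.sum_range_succ, mul_add, ih]
    have h1 : ((n + 1 : ℕ) - 1 / 2 : ℝ) * x = n * x + x / 2 := by push_cast; ring
    have h2 : ((n : ℝ) - 1 / 2) * x = n * x - x / 2 := by ring
    rw [h1, h2, Real.sin_add, Real.sin_sub]
    ring

theorem sum_cos_mul_pi_div {M l : ℕ} (hl0 : 0 < l) (hl : l < 2 * (M + 1)) :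
    ∑ k ∈ Finset.range (M + 1), Real.cos (k * (l * (Real.pi / (M + 1)))) =
      (1 - (-1) ^ l) / 2 := by
  set x : ℝ := l * (Real.pi / (M + 1)) with hx
  have hsin : 0 < Real.sin (x / 2) := by
    have hl' : (l : ℝ) < 2 * (M + 1) := by exact_mod_cast hl
    refine Real.sin_pos_of_pos_of_lt_pi (by positivity) ?_
    rw [hx, ← mul_div_assoc, div_div, div_lt_iff₀ (by positivity)]
    nlinarith [Real.pi_pos]
  have hlast : (((M + 1 : ℕ) : ℝ) - 1 / 2) * x = l * Real.pi - x / 2 := by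
    rw [hx]
    push_cast
    field_simp
  have h := two_sin_mul_sum_cos x (M + 1)
  rw [hlast, Real.sin_sub, Real.sin_nat_mul_pi, Real.cos_nat_mul_pi] at h
  refine mul_left_cancel₀ (mul_pos two_pos hsin).ne' ?_
  linear_combination h

/-- The number of walks of length `n` from `1` to `j` in the path `1, …, M`, by spectral
decomposition of the adjacency matrix of the path. -/
noncomputable def sineSum (M n j : ℕ) : ℝ :=
  2 / (M + 1) * ∑ k ∈ Finset.range (M + 1), Real.sin (k * (Real.pi / (M + 1))) *
    Real.sin (j * (k * (Real.pi / (M + 1)))) * (2 * Real.cos (k * (Real.pi / (M + 1)))) ^ n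

theorem sineSum_zero (M n : ℕ) : sineSum M n 0 = 0 := by simp [sineSum]

theorem sineSum_end (M n : ℕ) : sineSum M n (M + 1) = 0 := by
  rw [sineSum, Finset.sum_eq_zero, mul_zero]
  intro k _
  have : ((M + 1 : ℕ) : ℝ) * (k * (Real.pi / (M + 1))) = k * Real.pi := by
    push_cast
    field_simp
  rw [this, Real.sin_nat_mul_pi, mul_zero, zero_mul]

theorem sineSum_succ (M n j : ℕ) :
    sineSum M (n + 1) (j + 1) = sineSum M n j + sineSum M n (j + 2) := by
  rw [sineSum, sineSum, sineSum, ← mul_add, ← Finset.sum_add_distrib]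
  congr 1
  refine Finset.sum_congr rfl fun k _ => ?_
  set x : ℝ := k * (Real.pi / (M + 1))
  have h1 : ((j + 1 : ℕ) : ℝ) * x = j * x + x := by push_cast; ring
  have h2 : ((j + 2 : ℕ) : ℝ) * x = (j * x + x) + x := by push_cast; ring
  have h3 : Real.sin ((j : ℝ) * x) = Real.sin ((j * x + x) - x) := by congr 1; ring
  rw [h1, h2, h3, Real.sin_sub, Real.sin_add (j * x + x) x]
  ring

theorem sineSum_zero_left {M j : ℕ} (hj : j + 1 ≤ M) :
    sineSum M 0 (j + 1) = if j = 0 then 1 else 0 := by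
  have hproduct (k : ℕ) : Real.sin (k * (Real.pi / (M + 1))) *
      Real.sin ((j + 1 : ℕ) * (k * (Real.pi / (M + 1)))) *
        (2 * Real.cos (k * (Real.pi / (M + 1)))) ^ 0 =
      (Real.cos (k * (j * (Real.pi / (M + 1)))) -
        Real.cos (k * ((j + 2 : ℕ) * (Real.pi / (M + 1))))) / 2 := by
    set x : ℝ := k * (Real.pi / (M + 1)) with hx
    have h1 : (k : ℝ) * (j * (Real.pi / (M + 1))) = (j + 1 : ℕ) * x - x := by
      rw [hx]; push_cast; ring
    have h2 : (k : ℝ) * ((j + 2 : ℕ) * (Real.pi / (M + 1))) = (j + 1 : ℕ) * x + x := by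
      rw [hx]; push_cast; ring
    rw [h1, h2, Real.cos_sub, Real.cos_add]
    ring
  rw [sineSum, Finset.sum_congr rfl fun k _ => hproduct k, ← Finset.sum_div,
    Finset.sum_sub_distrib, sum_cos_mul_pi_div (l := j + 2) (by omega) (by omega)]
  rcases Nat.eq_zero_or_pos j with rfl | hj0
  · have : (M : ℝ) + 1 ≠ 0 := by positivity
    simp [this]
  · rw [sum_cos_mul_pi_div (M := M) hj0 (by omega), if_neg hj0.ne', pow_add]
    simp

theorem sineSum_eq_zero {M n j : ℕ} (hnj : n + 1 < j) (hj : j ≤ M + 1) : sineSum M n j = 0 := by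
  induction n generalizing j with
  | zero =>
    rcases Nat.eq_or_lt_of_le hj with rfl | hlt
    · exact sineSum_end M 0
    · obtain ⟨j, rfl⟩ : ∃ i, j = i + 1 := ⟨j - 1, by omega⟩
      rw [sineSum_zero_left (by omega), if_neg (by omega)]
  | succ n ih =>
    rcases Nat.eq_or_lt_of_le hj with rfl | hlt
    · exact sineSum_end M _
    · obtain ⟨j, rfl⟩ : ∃ i, j = i + 1 := ⟨j - 1, by omega⟩
      rw [sineSum_succ, ih (by omega) (by omega), ih (by omega) (by omega), add_zero]

open PowerSeries in
/-- For `1 ≤ j ≤ M`, the generating function of the walks of length `2 n + j - 1` from `1` to `j` in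
the path `1, …, M`; the value at `j = 0` extends the recursion `walkSeries_succ`. -/
noncomputable def walkSeries (M : ℕ) : ℕ → ℝ⟦X⟧
  | 0 => 1
  | j + 1 => PowerSeries.mk fun n => sineSum M (2 * n + j) (j + 1)

theorem walkSeries_end (M : ℕ) : walkSeries M (M + 1) = 0 := by
  ext n
  simp [walkSeries, sineSum_end]

open PowerSeries in
theorem walkSeries_succ {M j : ℕ} (hj : j + 1 ≤ M) :
    walkSeries M (j + 1) = walkSeries M j + X * walkSeries M (j + 2) := by
  ext n
  rw [map_add]
  rcases n with _ | n
  · rw [coeff_zero_X_mul, add_zero]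
    rcases j with _ | j
    · simp [walkSeries, sineSum_zero_left hj]
    · simp only [walkSeries, coeff_mk, mul_zero, zero_add]
      rw [sineSum_succ, sineSum_eq_zero (j := j + 1 + 2) (by omega) (by omega), add_zero]
  · rw [coeff_succ_X_mul]
    rcases j with _ | j
    · simp only [walkSeries, coeff_mk, coeff_one, if_neg (Nat.succ_ne_zero n), zero_add, add_zero]
      rw [show 2 * (n + 1) = (2 * n + 1) + 1 by ring, sineSum_succ, sineSum_zero, zero_add]
    · simp only [walkSeries, coeff_mk]
      rw [show 2 * (n + 1) + (j + 1) = (2 * n + j + 2) + 1 by ring, sineSum_succ]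
      congr 2
      ring

namespace PlanarTree

/-- The ratio `walkSeries M j / walkSeries M (j - 1)` obeys the continued fraction recursion of
`levelSeries`, started from the absorbing end `j = M + 1`. -/
theorem walkSeries_eq_levelSeries_mul {M i : ℕ} (hi : i + 1 ≤ M) :
    walkSeries M (M - i) = levelSeries i * walkSeries M (M - i - 1) := by
  induction i with
  | zero =>
    obtain ⟨M, rfl⟩ : ∃ k, M = k + 1 := ⟨M - 1, by omega⟩
    have := walkSeries_succ (M := M + 1) (j := M) le_rfl
    rw [walkSeries_end, mul_zero, add_zero] at this
    simpa [levelSeries] using this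
  | succ i ih =>
    obtain ⟨j, hj⟩ : ∃ j, M = i + j + 2 := ⟨M - i - 2, by omega⟩
    have ih := ih (by omega)
    have h := walkSeries_succ (M := M) (j := j) (by omega)
    rw [show M - i = j + 2 by omega, show j + 2 - 1 = j + 1 by omega] at ih
    rw [show M - (i + 1) = j + 1 by omega, show j + 1 - 1 = j by omega]
    rw [ih] at h
    linear_combination levelSeries (i + 1) * h - walkSeries M (j + 1) * levelSeries_succ_mul i

open PowerSeries in
theorem coeff_levelSeries (m n : ℕ) :
    coeff n (levelSeries m) = 2 / (m + 2) * ∑ k ∈ Finset.range (m + 2),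
      Real.sin (k * (Real.pi / (m + 2))) ^ 2 *
        (4 * Real.cos (k * (Real.pi / (m + 2))) ^ 2) ^ n := by
  have h := walkSeries_eq_levelSeries_mul (M := m + 1) (i := m) le_rfl
  rw [show m + 1 - m = 1 by omega, show 1 - 1 = 0 by rfl] at h
  simp only [walkSeries, mul_one] at h
  rw [← h, coeff_mk, sineSum]
  push_cast
  rw [show (m : ℝ) + 1 + 1 = m + 2 by ring, show m + 1 + 1 = m + 2 by rfl]
  congr 1
  refine Finset.sum_congr rfl fun k _ => ?_
  rw [add_zero, pow_mul, mul_pow, one_mul, show (2 : ℝ) ^ 2 = 4 by norm_num]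
  ring

end PlanarTree

/-! ### Lower bounds for coefficients of powers of power series -/

section Coeff

open PowerSeries

section OrderedCoeff

variable {R : Type*} [Semiring R] [PartialOrder R] [IsOrderedRing R] {f g f' g' : R⟦X⟧}

theorem coeff_mul_le_coeff_mul (hf : ∀ n, 0 ≤ coeff n f) (hff' : ∀ n, coeff n f ≤ coeff n f')
    (hg : ∀ n, 0 ≤ coeff n g) (hgg' : ∀ n, coeff n g ≤ coeff n g') (n : ℕ) :
    coeff n (f * g) ≤ coeff n (f' * g') := by
  rw [coeff_mul, coeff_mul]
  exact Finset.sum_le_sum fun p _ =>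
    mul_le_mul (hff' _) (hgg' _) (hg _) ((hf _).trans (hff' _))

theorem coeff_mul_nonneg (hf : ∀ n, 0 ≤ coeff n f) (hg : ∀ n, 0 ≤ coeff n g) (n : ℕ) :
    0 ≤ coeff n (f * g) := by
  rw [coeff_mul]
  exact Finset.sum_nonneg fun p _ => mul_nonneg (hf _) (hg _)

theorem coeff_pow_nonneg (hf : ∀ n, 0 ≤ coeff n f) (k n : ℕ) : 0 ≤ coeff n (f ^ k) := by
  induction k generalizing n with
  | zero =>
    rw [pow_zero, coeff_one]
    split_ifs
    exacts [zero_le_one, le_rfl]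
  | succ k ih =>
    rw [pow_succ]
    exact coeff_mul_nonneg ih hf n

theorem coeff_pow_le_coeff_pow (hf : ∀ n, 0 ≤ coeff n f) (hfg : ∀ n, coeff n f ≤ coeff n g)
    (k n : ℕ) : coeff n (f ^ k) ≤ coeff n (g ^ k) := by
  induction k generalizing n with
  | zero => simp
  | succ k ih =>
    rw [pow_succ, pow_succ]
    exact coeff_mul_le_coeff_mul (coeff_pow_nonneg hf k) ih hf hfg n

theorem sum_mul_le_coeff_mul (hf : ∀ n, 0 ≤ coeff n f) (hg : ∀ n, 0 ≤ coeff n g) {L n : ℕ}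
    (hL : L ≤ n + 1) : ∑ l ∈ Finset.range L, coeff l f * coeff (n - l) g ≤ coeff n (f * g) := by
  rw [coeff_mul, Finset.Nat.sum_antidiagonal_eq_sum_range_succ fun k l => coeff k f * coeff l g]
  exact Finset.sum_le_sum_of_subset_of_nonneg (Finset.range_subset_range.2 hL)
    fun l _ _ => mul_nonneg (hf l) (hg _)

end OrderedCoeff

/-- The value at `y` of the polynomial `∑ j, (K.choose (j + 1)) β ^ (K - (j + 1)) y ^ j / j!`, which
governs the coefficients of the `K`-th power of a series `P + ∑ a xⁿ` with `P 1 = β`: the index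
`j + 1` is the number of factors that contribute a term of the geometric series. -/
noncomputable def binomialExpSum (β y : ℝ) (K : ℕ) : ℝ :=
  ∑ j ∈ Finset.range K, (K.choose (j + 1) : ℝ) * β ^ (K - (j + 1)) * y ^ j / j.factorial

theorem binomialExpSum_le_binomialExpSum {β β' y y' : ℝ} (hβ : 0 ≤ β) (hββ' : β ≤ β')
    (hy : 0 ≤ y) (hyy' : y ≤ y') (K : ℕ) : binomialExpSum β y K ≤ binomialExpSum β' y' K := by
  have hβ' : 0 ≤ β' := hβ.trans hββ'
  unfold binomialExpSum
  gcongr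

theorem binomialExpSum_mul (β y : ℝ) (K : ℕ) :
    binomialExpSum β (β * y) K = β ^ (K - 1) * binomialExpSum 1 y K := by
  rw [binomialExpSum, binomialExpSum, Finset.mul_sum]
  refine Finset.sum_congr rfl fun j hj => ?_
  have hj := Finset.mem_range.1 hj
  rw [mul_pow, one_pow, show K - 1 = (K - (j + 1)) + j by omega, pow_add]
  ring

/-- The geometric series `∑ a xⁿ` with the terms of degree less than `L` removed. -/
noncomputable def geometricTail {R : Type*} [Semiring R] (a x : R) (L : ℕ) : R⟦X⟧ :=
  PowerSeries.mk fun n => if L ≤ n then a * x ^ n else 0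

section GeometricTail

theorem geometricTail_eq_mul {R : Type*} [CommRing R] (a x : R) (L : ℕ) :
    geometricTail a x L = C (a * x ^ L) * X ^ L * rescale x (PowerSeries.mk 1) := by
  ext n
  rw [geometricTail, coeff_mk, mul_assoc, coeff_C_mul, coeff_X_pow_mul']
  split_ifs with h
  · rw [coeff_rescale, coeff_mk, Pi.one_apply, mul_one, mul_assoc, ← pow_add,
      Nat.add_sub_cancel' h]
  · rw [mul_zero]

theorem coeff_geometricTail_pow {R : Type*} [CommRing R] (a x : R) {L j n : ℕ}
    (hn : L * (j + 1) ≤ n) : coeff n (geometricTail a x L ^ (j + 1)) =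
      a ^ (j + 1) * x ^ n * (j + (n - L * (j + 1))).choose j := by
  obtain ⟨d, rfl⟩ : ∃ d, n = d + L * (j + 1) := ⟨n - L * (j + 1), by omega⟩
  rw [geometricTail_eq_mul, mul_pow, mul_pow, ← map_pow, ← map_pow, ← pow_mul, mul_assoc,
    coeff_C_mul, coeff_X_pow_mul, mk_one_pow_eq_mk_choose_add, coeff_rescale, coeff_mk,
    Nat.add_sub_cancel, mul_pow, ← pow_mul, pow_add]
  ring

variable {a x : ℝ} (ha : 0 ≤ a) (hx : 0 ≤ x)

include ha hx in
theorem coeff_geometricTail_nonneg (L n : ℕ) : 0 ≤ coeff n (geometricTail a x L) := by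
  rw [geometricTail, coeff_mk]
  split_ifs <;> positivity

theorem pow_div_factorial_le_choose_add (j d : ℕ) :
    (d : ℝ) ^ j / j.factorial ≤ ((j + d).choose j : ℝ) := by
  refine le_trans ?_ (Nat.pow_le_choose j (j + d))
  gcongr
  omega

variable (hx1 : x ≤ 1) {P : ℝ⟦X⟧} (hP : ∀ n, 0 ≤ coeff n P)

include ha hx hx1 hP

theorem le_coeff_pow_mul_geometricTail_pow {L : ℕ} (i j n : ℕ) (hn : L * (i + (j + 1)) ≤ n) :
    (∑ l ∈ Finset.range L, coeff l P) ^ i *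
        (a ^ (j + 1) * x ^ n * ((n - L * (i + (j + 1)) : ℕ) : ℝ) ^ j / j.factorial) ≤
      coeff n (P ^ i * geometricTail a x L ^ (j + 1)) := by
  induction i generalizing n with
  | zero =>
    rw [pow_zero, pow_zero, one_mul, one_mul, coeff_geometricTail_pow _ _ (by simpa using hn),
      zero_add, mul_div_assoc]
    gcongr
    exact pow_div_factorial_le_choose_add _ _
  | succ i ih =>
    have hL : L ≤ n + 1 := by nlinarith
    rw [pow_succ' P, mul_assoc P]
    refine le_trans ?_ (sum_mul_le_coeff_mul hP (coeff_mul_nonneg (coeff_pow_nonneg hP i)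
      (coeff_pow_nonneg (coeff_geometricTail_nonneg ha hx L) _)) hL)
    rw [pow_succ', mul_assoc, Finset.sum_mul]
    refine Finset.sum_le_sum fun l hl => mul_le_mul_of_nonneg_left ?_ (hP l)
    have hl := Finset.mem_range.1 hl
    have hsplit : L * (i + 1 + (j + 1)) = L * (i + (j + 1)) + L := by ring
    refine le_trans ?_ (ih (n - l) (by omega))
    have hdegree : n - L * (i + 1 + (j + 1)) ≤ n - l - L * (i + (j + 1)) := by omega
    have hpow : x ^ n ≤ x ^ (n - l) := pow_le_pow_of_le_one hx hx1 (by omega)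
    have : 0 ≤ ∑ l ∈ Finset.range L, coeff l P := Finset.sum_nonneg fun l _ => hP l
    gcongr

theorem le_coeff_add_geometricTail_pow {L : ℕ} (K n : ℕ) (hn : L * K ≤ n) :
    a * x ^ n * binomialExpSum (∑ l ∈ Finset.range L, coeff l P) (a * ((n - L * K : ℕ) : ℝ)) K ≤
      coeff n ((geometricTail a x L + P) ^ K) := by
  have hQ := coeff_geometricTail_nonneg ha hx L
  rw [binomialExpSum, add_pow, map_sum, Finset.sum_range_succ', Finset.mul_sum]
  refine le_add_of_le_of_nonneg (Finset.sum_le_sum fun j hj => ?_) ?_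
  · have hj : K - (j + 1) + (j + 1) = K := Nat.sub_add_cancel (Finset.mem_range.1 hj)
    have h := le_coeff_pow_mul_geometricTail_pow ha hx hx1 hP (K - (j + 1)) j n (by rwa [hj])
    rw [hj] at h
    rw [mul_comm (geometricTail a x L ^ (j + 1)), ← map_natCast (C (R := ℝ)), coeff_mul_C]
    refine le_trans (le_of_eq ?_) (mul_le_mul_of_nonneg_right h (Nat.cast_nonneg _))
    ring
  · rw [← map_natCast (C (R := ℝ)), coeff_mul_C]
    exact mul_nonneg (coeff_mul_nonneg (coeff_pow_nonneg hQ _) (coeff_pow_nonneg hP _) _)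
      (Nat.cast_nonneg _)

end GeometricTail

end Coeff

/-! ### The spectral decomposition of the level series -/

theorem hasSum_sin_sq_mul_cos_sq_pow {x : ℝ} (hx : Real.sin x ≠ 0) :
    HasSum (fun n : ℕ => Real.sin x ^ 2 * (Real.cos x ^ 2) ^ n) 1 := by
  have hsin : 0 < Real.sin x ^ 2 := by positivity
  have hsub : 1 - Real.cos x ^ 2 = Real.sin x ^ 2 := by linarith [Real.sin_sq_add_cos_sq x]
  have h := (hasSum_geometric_of_lt_one (sq_nonneg (Real.cos x)) (by linarith)).mul_left
    (Real.sin x ^ 2)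
  rwa [hsub, mul_inv_cancel₀ hsin.ne'] at h

namespace PlanarTree

open PowerSeries

/-- The generating function of the continuations of a single vertex by at most `m` levels,
rescaled so that its radius of convergence tends to `1` as `m → ∞`. -/
noncomputable def normSeries (m : ℕ) : ℝ⟦X⟧ := rescale (1 / 4 : ℝ) (levelSeries m)

theorem coeff_normSeries_pow (m k n : ℕ) :
    coeff n (normSeries m ^ k) = (1 / 4) ^ n * (continuations m k n : ℝ) := by
  rw [normSeries, ← map_pow, coeff_rescale, continuations_eq_coeff]

theorem coeff_normSeries_eq_continuations (m n : ℕ) :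
    coeff n (normSeries m) = (1 / 4) ^ n * (continuations m 1 n : ℝ) := by
  rw [← coeff_normSeries_pow, pow_one]

theorem coeff_normSeries_nonneg (m n : ℕ) : 0 ≤ coeff n (normSeries m) := by
  rw [coeff_normSeries_eq_continuations]
  positivity

theorem coeff_normSeries_mono (n : ℕ) : Monotone fun m => coeff n (normSeries m) := by
  intro m m' h
  have : (continuations m 1 n : ℝ) ≤ continuations m' 1 n := by
    exact_mod_cast continuations_mono 1 n h
  simp only [coeff_normSeries_eq_continuations]
  gcongr

theorem coeff_normSeries (m n : ℕ) :
    coeff n (normSeries m) = 2 / (m + 2) * ∑ k ∈ Finset.range (m + 2),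
      Real.sin (k * (Real.pi / (m + 2))) ^ 2 * (Real.cos (k * (Real.pi / (m + 2))) ^ 2) ^ n := by
  rw [normSeries, coeff_rescale, coeff_levelSeries, mul_left_comm, Finset.mul_sum]
  congr 1
  refine Finset.sum_congr rfl fun k _ => ?_
  rw [mul_left_comm, ← mul_pow]
  congr 2
  ring

theorem hasSum_coeff_normSeries (m : ℕ) :
    HasSum (fun n => coeff n (normSeries m)) (2 * (m + 1) / (m + 2)) := by
  simp_rw [coeff_normSeries]
  have hm : (0 : ℝ) < m + 2 := by positivity
  have hterm : ∀ k ∈ Finset.range (m + 2), HasSum (fun n : ℕ =>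
      Real.sin (k * (Real.pi / (m + 2))) ^ 2 * (Real.cos (k * (Real.pi / (m + 2))) ^ 2) ^ n)
      (if k = 0 then 0 else 1) := by
    intro k hk
    split_ifs with h
    · simp [h]
    · refine hasSum_sin_sq_mul_cos_sq_pow (Real.sin_pos_of_pos_of_lt_pi ?_ ?_).ne'
      · have := Real.pi_pos
        have : (0 : ℝ) < k := by exact_mod_cast Nat.pos_of_ne_zero h
        positivity
      · have : (k : ℝ) < m + 2 := by exact_mod_cast Finset.mem_range.1 hk
        rw [← mul_div_assoc, div_lt_iff₀ hm]
        nlinarith [Real.pi_pos]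
  have hsum : ∑ k ∈ Finset.range (m + 2), (if k = 0 then (0 : ℝ) else 1) = m + 1 := by
    rw [Finset.sum_range_succ']
    simp
  have h := (hasSum_sum hterm).mul_left (2 / ((m : ℝ) + 2))
  rwa [hsum, div_mul_eq_mul_div] at h

/-- The total weight of the two terms `k = 1` and `k = m + 1` of `coeff_normSeries`, which carry
the largest ratio. -/
noncomputable def leadingWeight (m : ℕ) : ℝ := 4 * Real.sin (Real.pi / (m + 2)) ^ 2 / (m + 2)

/-- The largest ratio in `coeff_normSeries`. -/
noncomputable def leadingRatio (m : ℕ) : ℝ := Real.cos (Real.pi / (m + 2)) ^ 2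

/-- The sum of the terms of `coeff_normSeries` other than the leading ones. -/
noncomputable def remainder (m n : ℕ) : ℝ :=
  2 / (m + 2) * ∑ k ∈ Finset.Ico 2 (m + 1),
      Real.sin (k * (Real.pi / (m + 2))) ^ 2 * (Real.cos (k * (Real.pi / (m + 2))) ^ 2) ^ n

theorem leadingWeight_nonneg (m : ℕ) : 0 ≤ leadingWeight m := by
  unfold leadingWeight
  positivity

theorem leadingRatio_nonneg (m : ℕ) : 0 ≤ leadingRatio m := sq_nonneg _

theorem leadingRatio_le_one (m : ℕ) : leadingRatio m ≤ 1 := Real.cos_sq_le_one _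

theorem remainder_nonneg (m n : ℕ) : 0 ≤ remainder m n := by
  unfold remainder
  positivity

theorem coeff_normSeries_eq {m : ℕ} (hm : 1 ≤ m) (n : ℕ) :
    coeff n (normSeries m) = leadingWeight m * leadingRatio m ^ n + remainder m n := by
  have hrange :
      Finset.range (m + 2) = insert 0 (insert 1 (insert (m + 1) (Finset.Ico 2 (m + 1)))) := by
    ext k
    simp only [Finset.mem_range, Finset.mem_insert, Finset.mem_Ico]
    omega
  have hlast : ((m + 1 : ℕ) : ℝ) * (Real.pi / (m + 2)) = Real.pi - Real.pi / (m + 2) := by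
    push_cast
    field_simp
    ring
  rw [coeff_normSeries, hrange, Finset.sum_insert, Finset.sum_insert, Finset.sum_insert, hlast,
    Real.sin_pi_sub, Real.cos_pi_sub, leadingWeight, leadingRatio, remainder]
  · simp only [CharP.cast_eq_zero, zero_mul, Real.sin_zero, Nat.cast_one, one_mul, neg_sq]
    ring
  all_goals
    simp only [Finset.mem_insert, Finset.mem_Ico]
    omega

/-- The vertices of a level of `K` vertices either have a large progeny, counted by the leading
term, or one of less than `L` edges within the next `m₀` levels. -/
theorem le_coeff_normSeries_pow {m₀ m : ℕ} (hm : 1 ≤ m) (hm₀ : m₀ ≤ m) {L : ℕ} (K n : ℕ)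
    (hn : L * K ≤ n) :
    leadingWeight m * leadingRatio m ^ n * binomialExpSum (∑ l ∈ Finset.range L,
        coeff l (normSeries m₀)) (leadingWeight m * ((n - L * K : ℕ) : ℝ)) K ≤
      coeff n (normSeries m ^ K) := by
  set P : ℝ⟦X⟧ := PowerSeries.mk fun l => if l < L then coeff l (normSeries m₀) else 0
  have hP : ∀ l, 0 ≤ coeff l P := by
    intro l
    rw [coeff_mk]
    split_ifs
    exacts [coeff_normSeries_nonneg _ _, le_rfl]
  have hsum : ∑ l ∈ Finset.range L, coeff l (normSeries m₀) = ∑ l ∈ Finset.range L, coeff l P :=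
    Finset.sum_congr rfl fun l hl => by rw [coeff_mk, if_pos (Finset.mem_range.1 hl)]
  have hα := leadingWeight_nonneg m
  have hρ := leadingRatio_nonneg m
  rw [hsum]
  refine (le_coeff_add_geometricTail_pow hα hρ (leadingRatio_le_one m) hP K n hn).trans
    (coeff_pow_le_coeff_pow (fun l => ?_) (fun l => ?_) K n)
  · rw [map_add]
    exact add_nonneg (coeff_geometricTail_nonneg hα hρ L l) (hP l)
  · rw [map_add, geometricTail, coeff_mk, coeff_mk]
    by_cases h : l < L
    · rw [if_neg (by omega), if_pos h, zero_add]
      exact coeff_normSeries_mono l hm₀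
    · rw [if_pos (by omega), if_neg h, add_zero, coeff_normSeries_eq hm]
      linarith [remainder_nonneg m l]

end PlanarTree

/-! ### Estimates of the eigenvalues -/

theorem cos_le_exp_neg_sq_div_two {y : ℝ} (h0 : 0 ≤ y) (h1 : y ≤ Real.pi / 2) :
    Real.cos y ≤ Real.exp (-(y ^ 2 / 2)) := by
  have hderiv : ∀ x : ℝ, HasDerivAt (fun x => Real.exp (x ^ 2 / 2) * Real.cos x)
      (Real.exp (x ^ 2 / 2) * (x * Real.cos x - Real.sin x)) x := by
    intro x
    have h : HasDerivAt (fun x : ℝ => Real.exp (x ^ 2 / 2))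
        (Real.exp (x ^ 2 / 2) * ((2 : ℕ) * x ^ (2 - 1) / 2)) x :=
      ((hasDerivAt_pow 2 x).div_const 2).exp
    convert! h.mul (Real.hasDerivAt_cos x) using 1
    norm_num
    ring
  have hanti : AntitoneOn (fun x => Real.exp (x ^ 2 / 2) * Real.cos x)
      (Set.Icc 0 (Real.pi / 2)) := by
    refine antitoneOn_of_deriv_nonpos (convex_Icc _ _) (fun x _ =>
      (hderiv x).continuousAt.continuousWithinAt) (fun x _ =>
      (hderiv x).differentiableAt.differentiableWithinAt) (fun x hx => ?_)
    rw [interior_Icc] at hx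
    rw [(hderiv x).deriv]
    have hcos : 0 < Real.cos x := Real.cos_pos_of_mem_Ioo ⟨by linarith [hx.1, Real.pi_pos], hx.2⟩
    have htan := Real.lt_tan hx.1 hx.2
    rw [Real.tan_eq_sin_div_cos, lt_div_iff₀ hcos] at htan
    exact mul_nonpos_of_nonneg_of_nonpos (Real.exp_pos _).le (by linarith)
  have h := hanti (Set.left_mem_Icc.2 (h0.trans h1)) ⟨h0, h1⟩ h0
  simp only [ne_eq, OfNat.ofNat_ne_zero, not_false_eq_true, zero_pow, zero_div, Real.exp_zero,
    Real.cos_zero, mul_one] at h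
  rwa [Real.exp_neg, ← one_div, le_div_iff₀ (Real.exp_pos _), mul_comm]

theorem cos_sq_le_exp_neg_sq {d y : ℝ} (hd : 0 ≤ d) (h0 : d ≤ y) (h1 : y ≤ Real.pi - d) :
    Real.cos y ^ 2 ≤ Real.exp (-d ^ 2) := by
  wlog hy : y ≤ Real.pi / 2 generalizing y
  · have := this (y := Real.pi - y) (by linarith) (by linarith) (by linarith)
    rwa [Real.cos_pi_sub, neg_sq] at this
  have hcos : 0 ≤ Real.cos y := Real.cos_nonneg_of_mem_Icc ⟨by linarith, hy⟩
  calc Real.cos y ^ 2 ≤ Real.exp (-(y ^ 2 / 2)) ^ 2 := by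
        gcongr
        exact cos_le_exp_neg_sq_div_two (by linarith) hy
    _ = Real.exp (-y ^ 2) := by
        rw [← Real.exp_nat_mul]
        congr 1
        push_cast
        ring
    _ ≤ Real.exp (-d ^ 2) := by gcongr

theorem exp_neg_le_cos_sq {u : ℝ} (hu : u ^ 2 ≤ 1 / 2) :
    Real.exp (-(u ^ 2 + 2 * u ^ 4)) ≤ Real.cos u ^ 2 := by
  have hsin : Real.sin u ^ 2 ≤ u ^ 2 := sq_le_sq.2 Real.abs_sin_le_abs
  have hcos := Real.sin_sq_add_cos_sq u
  have hexp : (1 : ℝ) + (u ^ 2 + 2 * u ^ 4) ≤ Real.exp (u ^ 2 + 2 * u ^ 4) := by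
    linarith [Real.add_one_le_exp (u ^ 2 + 2 * u ^ 4)]
  have hu0 : 0 ≤ u ^ 2 := sq_nonneg u
  rw [Real.exp_neg, inv_le_iff_one_le_mul₀ (Real.exp_pos _)]
  calc (1 : ℝ) ≤ (1 - u ^ 2) * (1 + (u ^ 2 + 2 * u ^ 4)) := by
        nlinarith [mul_nonneg (mul_nonneg hu0 hu0) (sub_nonneg.2 hu)]
    _ ≤ Real.cos u ^ 2 * Real.exp (u ^ 2 + 2 * u ^ 4) := by
        apply mul_le_mul (by linarith) hexp (by positivity) (by positivity)

namespace PlanarTree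

theorem leadingRatio_pow_le (m n : ℕ) :
    leadingRatio m ^ n ≤ Real.exp (-(Real.pi ^ 2 * n / ((m : ℝ) + 2) ^ 2)) := by
  have hangle : Real.pi / (m + 2) ≤ Real.pi / 2 := by
    gcongr
    linarith
  have hcos := cos_sq_le_exp_neg_sq (d := Real.pi / (m + 2)) (y := Real.pi / (m + 2))
    (by positivity) le_rfl (by linarith)
  calc leadingRatio m ^ n ≤ Real.exp (-(Real.pi / (m + 2)) ^ 2) ^ n := by
        unfold leadingRatio
        gcongr
    _ = _ := by
        rw [← Real.exp_nat_mul]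
        congr 1
        field_simp

theorem cos_sq_pow_le_exp {m k : ℕ} (hk2 : 2 ≤ k) (hkm : k ≤ m) (n : ℕ) :
    (Real.cos (k * (Real.pi / (m + 2))) ^ 2) ^ n ≤
      Real.exp (-(4 * Real.pi ^ 2 * n / ((m : ℝ) + 2) ^ 2)) := by
  have hk2 : (2 : ℝ) ≤ k := by exact_mod_cast hk2
  have hkm : (k : ℝ) ≤ m := by exact_mod_cast hkm
  have hpi := Real.pi_pos
  have hcos : Real.cos (k * (Real.pi / (m + 2))) ^ 2 ≤
      Real.exp (-(2 * (Real.pi / (m + 2))) ^ 2) := by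
    refine cos_sq_le_exp_neg_sq (by positivity) (by gcongr) ?_
    have : Real.pi = (m + 2) * (Real.pi / (m + 2)) := by field_simp
    nlinarith
  calc _ ≤ Real.exp (-(2 * (Real.pi / (m + 2))) ^ 2) ^ n := by gcongr
    _ = _ := by
        rw [← Real.exp_nat_mul]
        congr 1
        field_simp
        ring

theorem remainder_le (m n : ℕ) :
    remainder m n ≤ 2 * Real.exp (-(4 * Real.pi ^ 2 * n / ((m : ℝ) + 2) ^ 2)) := by
  set E := Real.exp (-(4 * Real.pi ^ 2 * n / ((m : ℝ) + 2) ^ 2))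
  have hE : 0 < E := Real.exp_pos _
  have hsum := Finset.sum_le_card_nsmul (Finset.Ico 2 (m + 1)) _ E fun k hk =>
    (mul_le_of_le_one_left (by positivity) (Real.sin_sq_le_one (k * (Real.pi / (m + 2))))).trans
      (cos_sq_pow_le_exp (Finset.mem_Ico.1 hk).1 (Nat.lt_succ_iff.1 (Finset.mem_Ico.1 hk).2) n)
  rw [Nat.card_Ico, nsmul_eq_mul] at hsum
  have hcard : ((m + 1 - 2 : ℕ) : ℝ) ≤ m + 2 := by
    exact_mod_cast (show m + 1 - 2 ≤ m + 2 by omega)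
  calc remainder m n ≤ 2 / ((m : ℝ) + 2) * ((m + 2) * E) := by
        unfold remainder
        gcongr
        exact hsum.trans (by gcongr)
    _ = 2 * E := by field_simp

theorem leadingWeight_le (m : ℕ) : leadingWeight m ≤ 2 := by
  unfold leadingWeight
  rw [div_le_iff₀ (by positivity)]
  linarith [Real.sin_sq_le_one (Real.pi / (m + 2)), (Nat.cast_nonneg m : (0 : ℝ) ≤ m)]

theorem le_leadingWeight (m : ℕ) : 16 / ((m : ℝ) + 2) ^ 3 ≤ leadingWeight m := by
  have hangle : Real.pi / (m + 2) ≤ Real.pi / 2 := by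
    gcongr
    linarith [(Nat.cast_nonneg m : (0 : ℝ) ≤ m)]
  have hsin : 2 / ((m : ℝ) + 2) ≤ Real.sin (Real.pi / (m + 2)) :=
    le_of_eq_of_le (by field_simp) (Real.mul_le_sin (by positivity) hangle)
  calc (16 : ℝ) / ((m : ℝ) + 2) ^ 3 = 4 * (2 / (m + 2)) ^ 2 / (m + 2) := by
        field_simp
        ring
    _ ≤ leadingWeight m := by
        unfold leadingWeight
        gcongr

end PlanarTree

/-! ### The Laplace method at `m ≈ θ₀ n ^ (1/3)` -/

section ExponentGap

variable {μ θ₀ : ℝ} (hθ₀ : 0 < θ₀) (h : μ * θ₀ ^ 3 = 2 * Real.pi ^ 2)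

include h in
theorem exponent_sub_eq {θ : ℝ} (hθ : θ ≠ 0) :
    μ * θ + Real.pi ^ 2 / θ ^ 2 - 3 / 2 * μ * θ₀ =
      μ * (θ - θ₀) ^ 2 * (2 * θ + θ₀) / (2 * θ ^ 2) := by
  rw [show Real.pi ^ 2 = μ * θ₀ ^ 3 / 2 by linarith]
  field_simp
  ring

theorem le_exponent_sub_of_lt (hμ : 0 < μ) {θ : ℝ} (hθ : 2 * θ₀ < θ) :
    μ * θ₀ / 2 ≤ μ * θ + Real.pi ^ 2 / θ ^ 2 - 3 / 2 * μ * θ₀ := by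
  have : 0 ≤ Real.pi ^ 2 / θ ^ 2 := by positivity
  nlinarith

include hθ₀ h

theorem le_exponent_sub_of_le {δ θ : ℝ} (hμ : 0 < μ) (hδ : 0 ≤ δ) (hθ : 0 < θ) (hle : θ ≤ 2 * θ₀)
    (hd : δ ≤ |θ - θ₀|) :
    μ * δ ^ 2 / (8 * θ₀) ≤ μ * θ + Real.pi ^ 2 / θ ^ 2 - 3 / 2 * μ * θ₀ := by
  rw [exponent_sub_eq h hθ.ne']
  have hd2 : δ ^ 2 ≤ (θ - θ₀) ^ 2 := by
    rw [← sq_abs (θ - θ₀)]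
    gcongr
  have hfactor : 1 / (8 * θ₀) ≤ (2 * θ + θ₀) / (2 * θ ^ 2) := by
    rw [div_le_div_iff₀ (by positivity) (by positivity)]
    nlinarith
  calc μ * δ ^ 2 / (8 * θ₀) = μ * δ ^ 2 * (1 / (8 * θ₀)) := by ring
    _ ≤ μ * (θ - θ₀) ^ 2 * ((2 * θ + θ₀) / (2 * θ ^ 2)) := by gcongr
    _ = _ := by ring

theorem le_exponent_of_four_mul (hμ : 0 < μ) {θ : ℝ} (hθ : 0 < θ) :
    3 * μ * θ₀ / 8 ≤ μ * θ + 4 * Real.pi ^ 2 / θ ^ 2 - 3 / 2 * μ * θ₀ := by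
  have hpi : Real.pi ^ 2 = μ * θ₀ ^ 3 / 2 := by linarith
  have hsplit : 4 * Real.pi ^ 2 / θ ^ 2 = Real.pi ^ 2 / θ ^ 2 + 3 * (Real.pi ^ 2 / θ ^ 2) := by
    ring
  have hpos : 0 < μ * θ₀ := by positivity
  rcases le_or_gt θ (2 * θ₀) with hle | hgt
  · have hextra : μ * θ₀ / 8 ≤ Real.pi ^ 2 / θ ^ 2 := by
      rw [hpi, div_le_div_iff₀ (by positivity) (by positivity)]
      have : θ ^ 2 ≤ (2 * θ₀) ^ 2 := by gcongr
      nlinarith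
    have hnonneg : 0 ≤ μ * (θ - θ₀) ^ 2 * (2 * θ + θ₀) / (2 * θ ^ 2) := by positivity
    linarith [exponent_sub_eq h hθ.ne']
  · have : 0 ≤ Real.pi ^ 2 / θ ^ 2 := by positivity
    linarith [le_exponent_sub_of_lt hμ hgt]

/-- The exponent `μ θ + π² / θ²` has a strict minimum at `θ₀`, with value `3 μ θ₀ / 2`. -/
theorem exists_exponent_gap {δ : ℝ} (hμ : 0 < μ) (hδ : 0 < δ) :
    ∃ η, 0 < η ∧
      (∀ θ, 0 < θ → δ ≤ |θ - θ₀| → 3 / 2 * μ * θ₀ + η ≤ μ * θ + Real.pi ^ 2 / θ ^ 2) ∧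
      (∀ θ, 0 < θ → 3 / 2 * μ * θ₀ + η ≤ μ * θ + 4 * Real.pi ^ 2 / θ ^ 2) := by
  have hpos : 0 < μ * θ₀ := by positivity
  have hleft := min_le_left (μ * δ ^ 2 / (8 * θ₀)) (3 * μ * θ₀ / 8)
  have hright := min_le_right (μ * δ ^ 2 / (8 * θ₀)) (3 * μ * θ₀ / 8)
  refine ⟨min (μ * δ ^ 2 / (8 * θ₀)) (3 * μ * θ₀ / 8), by positivity, fun θ hθ hd => ?_,
    fun θ hθ => ?_⟩
  · rcases le_or_gt θ (2 * θ₀) with hle | hgt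
    · linarith [le_exponent_sub_of_le hθ₀ h hμ hδ.le hθ hle hd]
    · linarith [le_exponent_sub_of_lt hμ hgt]
  · linarith [le_exponent_of_four_mul hθ₀ h hμ hθ]

end ExponentGap

section TSum

theorem tsum_ofReal_mul_geometric {E q : ℝ} (hE : 0 ≤ E) (hq : 0 ≤ q) (hq1 : q < 1) :
    ∑' m : ℕ, ENNReal.ofReal (E * q ^ m) = ENNReal.ofReal (E * (1 - q)⁻¹) := by
  rw [← ENNReal.ofReal_tsum_of_nonneg (fun m => by positivity)
    ((summable_geometric_of_lt_one hq hq1).mul_left _), tsum_mul_left,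
    tsum_geometric_of_lt_one hq hq1]

theorem tsum_ofReal_ite_mem {ι : Type*} (s : Finset ι) [DecidablePred (· ∈ s)] {f : ι → ℝ}
    (hf : ∀ i, 0 ≤ f i) :
    ∑' i, ENNReal.ofReal (if i ∈ s then f i else 0) = ENNReal.ofReal (∑ i ∈ s, f i) := by
  rw [tsum_eq_sum (s := s) fun i hi => by rw [if_neg hi, ENNReal.ofReal_zero],
    ENNReal.ofReal_sum_of_nonneg fun i _ => hf i]
  exact Finset.sum_congr rfl fun i hi => by rw [if_pos hi]

end TSum

theorem rpow_one_div_three_pow_three {x : ℝ} (hx : 0 ≤ x) : (x ^ (1 / 3 : ℝ)) ^ 3 = x := by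
  rw [← Real.rpow_natCast, ← Real.rpow_mul hx]
  norm_num

theorem tendsto_natCast_rpow_one_div_three :
    Tendsto (fun n : ℕ => (n : ℝ) ^ (1 / 3 : ℝ)) atTop atTop :=
  (tendsto_rpow_atTop (by norm_num)).comp tendsto_natCast_atTop_atTop

/-- A fraction `τ` of the exponent is given up in exchange for summability in `m`. -/
theorem exp_neg_mul_mul_exp_neg_le {μ τ B s : ℝ} {m : ℕ} (hμ : 0 ≤ μ) (hτ0 : 0 ≤ τ) (hτ1 : τ ≤ 1)
    (hB : 0 ≤ B) (hs : s ≤ μ * (m + 2) + B) :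
    Real.exp (-μ * m) * Real.exp (-B) ≤
      Real.exp (2 * μ) * Real.exp (-((1 - τ) * s)) * Real.exp (-(τ * μ)) ^ m := by
  rw [← Real.exp_nat_mul, ← Real.exp_add, ← Real.exp_add, ← Real.exp_add, Real.exp_le_exp]
  have hs' : (1 - τ) * s ≤ (1 - τ) * (μ * (m + 2) + B) :=
    mul_le_mul_of_nonneg_left hs (by linarith)
  have hτB : 0 ≤ τ * B := by positivity
  have hτμ : 0 ≤ τ * μ := by positivity
  nlinarith

theorem eventually_mul_mul_exp_neg_le {A η c : ℝ} (hη : 0 < η) (hc : 0 < c) (k : ℕ) :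
    ∀ᶠ t : ℝ in atTop, A * (t ^ k * Real.exp (-(η * t))) ≤ c := by
  have hlim := ((Real.tendsto_pow_mul_exp_neg_atTop_nhds_zero k).comp
    (tendsto_id.const_mul_atTop hη)).const_mul (A / η ^ k)
  rw [mul_zero] at hlim
  filter_upwards [hlim.eventually (gt_mem_nhds hc)] with t ht
  refine le_of_eq_of_le ?_ ht.le
  simp only [Function.comp_apply, id, mul_pow]
  field_simp

theorem exists_pos_lt_of_continuousAt {f : ℝ → ℝ} {y b : ℝ} (hf : ContinuousAt f 0) (hy : y < f 0)
    (hb : 0 < b) : ∃ e, 0 < e ∧ e < b ∧ y < f e := by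
  have hfe : ∀ᶠ e in 𝓝[>] (0 : ℝ), y < f e := nhdsWithin_le_nhds (hf.eventually (lt_mem_nhds hy))
  have hlt : ∀ᶠ e in 𝓝[>] (0 : ℝ), e < b := nhdsWithin_le_nhds (gt_mem_nhds hb)
  obtain ⟨e, ⟨hfe, hlt⟩, hpos⟩ := ((hfe.and hlt).and self_mem_nhdsWithin).exists
  exact ⟨e, hpos, hlt, hfe⟩

namespace PlanarTree

open PowerSeries

/-- The contribution of the largest ratio to `exp (-μ m)` times the `n`-th coefficient of
`normSeries m`. -/
noncomputable def leadingTerm (μ : ℝ) (m n : ℕ) : ℝ :=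
  Real.exp (-μ * m) * (leadingWeight m * leadingRatio m ^ n)

theorem leadingTerm_nonneg (μ : ℝ) (m n : ℕ) : 0 ≤ leadingTerm μ m n :=
  mul_nonneg (Real.exp_pos _).le
    (mul_nonneg (leadingWeight_nonneg m) (pow_nonneg (leadingRatio_nonneg m) n))

/-- The numbers of levels that dominate at size `t ^ 3`. -/
noncomputable def window (θ₀ δ t : ℝ) : Finset ℕ :=
  (Finset.range (⌊(θ₀ + δ) * t⌋₊ + 1)).filter fun m => |((m : ℝ) + 2) - θ₀ * t| ≤ δ * t

theorem mem_window {θ₀ δ t : ℝ} {m : ℕ} :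
    m ∈ window θ₀ δ t ↔ |((m : ℝ) + 2) - θ₀ * t| ≤ δ * t := by
  rw [window, Finset.mem_filter, Finset.mem_range, and_iff_right_iff_imp]
  intro h
  have := (abs_le.1 h).2
  rw [Nat.lt_succ_iff]
  apply Nat.le_floor
  nlinarith

section UpperBound

variable {μ τ s : ℝ} {m n : ℕ} (hμ : 0 ≤ μ) (hτ0 : 0 ≤ τ) (hτ1 : τ ≤ 1)

include hμ hτ0 hτ1

theorem leadingTerm_le (hs : s ≤ μ * (m + 2) + Real.pi ^ 2 * n / ((m : ℝ) + 2) ^ 2) :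
    leadingTerm μ m n ≤
      2 * (Real.exp (2 * μ) * Real.exp (-((1 - τ) * s)) * Real.exp (-(τ * μ)) ^ m) := by
  calc leadingTerm μ m n
      ≤ Real.exp (-μ * m) * (2 * Real.exp (-(Real.pi ^ 2 * n / ((m : ℝ) + 2) ^ 2))) := by
        have hα := leadingWeight_le m
        have hρ := leadingRatio_pow_le m n
        have hρ0 := pow_nonneg (leadingRatio_nonneg m) n
        unfold leadingTerm
        gcongr
    _ = 2 * (Real.exp (-μ * m) * Real.exp (-(Real.pi ^ 2 * n / ((m : ℝ) + 2) ^ 2))) := by ring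
    _ ≤ _ := mul_le_mul_of_nonneg_left
        (exp_neg_mul_mul_exp_neg_le hμ hτ0 hτ1 (by positivity) hs) zero_le_two

theorem exp_mul_remainder_le (hs : s ≤ μ * (m + 2) + 4 * Real.pi ^ 2 * n / ((m : ℝ) + 2) ^ 2) :
    Real.exp (-μ * m) * remainder m n ≤
      2 * (Real.exp (2 * μ) * Real.exp (-((1 - τ) * s)) * Real.exp (-(τ * μ)) ^ m) := by
  calc Real.exp (-μ * m) * remainder m n
      ≤ Real.exp (-μ * m) * (2 * Real.exp (-(4 * Real.pi ^ 2 * n / ((m : ℝ) + 2) ^ 2))) := by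
        gcongr
        exact remainder_le m n
    _ = 2 * (Real.exp (-μ * m) * Real.exp (-(4 * Real.pi ^ 2 * n / ((m : ℝ) + 2) ^ 2))) := by ring
    _ ≤ _ := mul_le_mul_of_nonneg_left
        (exp_neg_mul_mul_exp_neg_le hμ hτ0 hτ1 (by positivity) hs) zero_le_two

end UpperBound

theorem coeff_normSeries_zero {n : ℕ} (hn : n ≠ 0) : coeff n (normSeries 0) = 0 := by
  rw [coeff_normSeries_eq_continuations]
  simp [continuations, hn]

theorem mul_le_of_le_exponent {μ φ c t : ℝ} {m n : ℕ} (ht : 0 < t) (htn : t ^ 3 = n)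
    (h : φ ≤ μ * ((m + 2) / t) + c / ((m + 2) / t) ^ 2) :
    φ * t ≤ μ * (m + 2) + c * n / ((m : ℝ) + 2) ^ 2 := by
  have hscale : (μ * ((m + 2) / t) + c / ((m + 2) / t) ^ 2) * t =
      μ * (m + 2) + c * n / ((m : ℝ) + 2) ^ 2 := by
    have : (0 : ℝ) < m + 2 := by positivity
    rw [← htn]
    field_simp
  rw [← hscale]
  gcongr

section Laplace

variable {μ θ₀ δ : ℝ} (hμ : 0 < μ) (hθ₀ : 0 < θ₀) (h : μ * θ₀ ^ 3 = 2 * Real.pi ^ 2)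

include hμ hθ₀ h

theorem exists_exp_mul_coeff_normSeries_le (hδ : 0 < δ) :
    ∃ η τ, 0 < η ∧ 0 < τ ∧ ∀ (n : ℕ) (t : ℝ), 1 ≤ n → 0 < t → t ^ 3 = n → ∀ m : ℕ,
      Real.exp (-μ * m) * coeff n (normSeries m) ≤
        (if m ∈ window θ₀ δ t then leadingTerm μ m n else 0) +
        4 * Real.exp (2 * μ) * Real.exp (-((3 / 2 * μ * θ₀ + η) * t)) * Real.exp (-τ) ^ m := by
  obtain ⟨η, hη, hfar, hrem⟩ := exists_exponent_gap hθ₀ h hμ hδ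
  set φ := 3 / 2 * μ * θ₀
  have hφ : 0 < φ := by positivity
  set τ := η / 2 / (φ + η) with hτ
  have hτ0 : 0 < τ := by positivity
  have hτ1 : τ ≤ 1 := by
    rw [hτ, div_le_one (by positivity)]
    linarith
  have hτφ : (1 - τ) * (φ + η) = φ + η / 2 := by
    rw [hτ]
    field_simp
    ring
  refine ⟨η / 2, τ * μ, by positivity, by positivity, fun n t hn ht htn m => ?_⟩
  rcases Nat.eq_zero_or_pos m with rfl | hm
  · have := leadingTerm_nonneg μ 0 n
    rw [coeff_normSeries_zero (by omega), mul_zero]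
    split_ifs <;> positivity
  have hθ : 0 < ((m : ℝ) + 2) / t := by positivity
  have hremainder := exp_mul_remainder_le hμ.le hτ0.le hτ1
    (mul_le_of_le_exponent ht htn (hrem _ hθ))
  rw [← mul_assoc (1 - τ), hτφ] at hremainder
  rw [coeff_normSeries_eq hm, mul_add]
  split_ifs with hw
  · have hpos : 0 ≤ Real.exp (2 * μ) * Real.exp (-((φ + η / 2) * t)) * Real.exp (-(τ * μ)) ^ m := by
      positivity
    unfold leadingTerm
    linarith
  · rw [mem_window, not_le] at hw
    have hd : δ ≤ |((m : ℝ) + 2) / t - θ₀| := by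
      rw [show ((m : ℝ) + 2) / t - θ₀ = ((m : ℝ) + 2 - θ₀ * t) / t by field_simp, abs_div,
        abs_of_pos ht, le_div_iff₀ ht]
      exact hw.le
    have hleading := leadingTerm_le hμ.le hτ0.le hτ1
      (mul_le_of_le_exponent ht htn (hfar _ hθ hd))
    rw [← mul_assoc (1 - τ), hτφ, leadingTerm] at hleading
    linarith

omit hμ hθ₀ h in
theorem exp_neg_le_leadingRatio_pow {s : ℝ} {m n : ℕ} (hs : 2 * Real.pi ≤ s) (hsm : s ≤ m + 2) :
    Real.exp (-(n * ((Real.pi / s) ^ 2 + 2 * (Real.pi / s) ^ 4))) ≤ leadingRatio m ^ n := by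
  have hpi := Real.pi_pos
  have hs0 : 0 < s := by linarith
  have hle : Real.pi / ((m : ℝ) + 2) ≤ Real.pi / s := by gcongr
  have hhalf : Real.pi / s ≤ 1 / 2 := by
    rw [div_le_div_iff₀ hs0 (by norm_num)]
    linarith
  have hpos : 0 < Real.pi / ((m : ℝ) + 2) := by positivity
  rw [← mul_neg, Real.exp_nat_mul]
  refine pow_le_pow_left₀ (Real.exp_pos _).le (le_trans ?_ (exp_neg_le_cos_sq (by nlinarith))) n
  gcongr

omit hμ h in
theorem exp_neg_le_leadingRatio_pow_of_cube {t : ℝ} {m n : ℕ} (ht : 1 ≤ t) (htn : t ^ 3 = n)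
    (htθ : 2 * Real.pi ≤ θ₀ * t) (hm : θ₀ * t ≤ m + 2) :
    Real.exp (-(Real.pi ^ 2 / θ₀ ^ 2 * t + 2 * Real.pi ^ 4 / θ₀ ^ 4)) ≤ leadingRatio m ^ n := by
  have ht0 : 0 < t := by linarith
  refine le_trans ?_ (exp_neg_le_leadingRatio_pow htθ hm)
  rw [Real.exp_le_exp, neg_le_neg_iff, ← htn]
  have hexpand : t ^ 3 * ((Real.pi / (θ₀ * t)) ^ 2 + 2 * (Real.pi / (θ₀ * t)) ^ 4) =
      Real.pi ^ 2 / θ₀ ^ 2 * t + 2 * Real.pi ^ 4 / θ₀ ^ 4 * (1 / t) := by field_simp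
  rw [hexpand]
  gcongr
  exact mul_le_of_le_one_right (by positivity) ((div_le_one ht0).2 ht)

theorem exists_le_leadingTerm (hδ : 0 < δ) :
    ∃ c t₀, 0 < c ∧ ∀ (n : ℕ) (t : ℝ), t₀ ≤ t → t ^ 3 = n → ∃ m ∈ window θ₀ δ t,
      c / t ^ 3 * Real.exp (-(3 / 2 * μ * θ₀ * t)) ≤ leadingTerm μ m n := by
  refine ⟨Real.exp (-μ) * (16 / (θ₀ + 3) ^ 3) * Real.exp (-(2 * Real.pi ^ 4 / θ₀ ^ 4)),
    max 1 (max (3 / δ) (2 * Real.pi / θ₀)), by positivity, fun n t ht htn => ?_⟩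
  rw [max_le_iff, max_le_iff, div_le_iff₀' hδ, div_le_iff₀' hθ₀] at ht
  obtain ⟨ht1, htδ, htθ⟩ := ht
  set m : ℕ := ⌈θ₀ * t⌉₊
  have hm1 : θ₀ * t ≤ m := Nat.le_ceil _
  have hm2 : (m : ℝ) < θ₀ * t + 1 := Nat.ceil_lt_add_one (by positivity)
  refine ⟨m, mem_window.2 (abs_le.2 ⟨by linarith, by linarith⟩), ?_⟩
  have hexp : Real.exp (-μ * (θ₀ * t + 1)) ≤ Real.exp (-μ * m) := by
    rw [Real.exp_le_exp]
    nlinarith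
  have hweight : 16 / (θ₀ + 3) ^ 3 / t ^ 3 ≤ leadingWeight m := by
    refine le_trans ?_ (le_leadingWeight m)
    rw [div_div, ← mul_pow]
    gcongr
    nlinarith
  have hratio := exp_neg_le_leadingRatio_pow_of_cube hθ₀ ht1 htn htθ (m := m) (by linarith)
  have hmin : Real.pi ^ 2 / θ₀ ^ 2 = μ * θ₀ / 2 := by
    rw [show Real.pi ^ 2 = μ * θ₀ ^ 3 / 2 by linarith]
    field_simp
  rw [hmin] at hratio
  have hsplit : Real.exp (-μ) * Real.exp (-(2 * Real.pi ^ 4 / θ₀ ^ 4)) *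
      Real.exp (-(3 / 2 * μ * θ₀ * t)) = Real.exp (-μ * (θ₀ * t + 1)) *
        Real.exp (-(μ * θ₀ / 2 * t + 2 * Real.pi ^ 4 / θ₀ ^ 4)) := by
    rw [← Real.exp_add, ← Real.exp_add, ← Real.exp_add]
    ring_nf
  have hα := leadingWeight_nonneg m
  calc _ = Real.exp (-μ * (θ₀ * t + 1)) * ((16 / (θ₀ + 3) ^ 3 / t ^ 3) *
        Real.exp (-(μ * θ₀ / 2 * t + 2 * Real.pi ^ 4 / θ₀ ^ 4))) := by
        linear_combination (16 / (θ₀ + 3) ^ 3 / t ^ 3) * hsplit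
    _ ≤ leadingTerm μ m n := by
        unfold leadingTerm
        gcongr

/-- The terms outside the window are exponentially smaller than a single term inside. -/
theorem eventually_tsum_le_sum_window {ε : ℝ} (hδ : 0 < δ) (hε : 0 < ε) :
    ∀ᶠ n : ℕ in atTop, ∑' m : ℕ, ENNReal.ofReal (Real.exp (-μ * m) * coeff n (normSeries m)) ≤
      ENNReal.ofReal ((1 + ε) * ∑ m ∈ window θ₀ δ ((n : ℝ) ^ (1 / 3 : ℝ)), leadingTerm μ m n) := by
  obtain ⟨η, τ, hη, hτ, hle⟩ := exists_exp_mul_coeff_normSeries_le hμ hθ₀ h hδ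
  obtain ⟨c, t₀, hc, hlow⟩ := exists_le_leadingTerm hμ hθ₀ h hδ
  have hq : Real.exp (-τ) < 1 := Real.exp_lt_one_iff.2 (by linarith)
  have hq' : 0 < 1 - Real.exp (-τ) := by linarith
  set A := 4 * Real.exp (2 * μ) * (1 - Real.exp (-τ))⁻¹ with hA
  have htend := tendsto_natCast_rpow_one_div_three
  filter_upwards [htend.eventually (eventually_mul_mul_exp_neg_le (A := A) hη (mul_pos hε hc) 3),
    htend.eventually (eventually_ge_atTop t₀), htend.eventually (eventually_gt_atTop 0),
    eventually_ge_atTop 1] with n hsmall ht₀ ht hn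
  set t := (n : ℝ) ^ (1 / 3 : ℝ)
  have htn : t ^ 3 = n := rpow_one_div_three_pow_three (Nat.cast_nonneg n)
  set S := ∑ m ∈ window θ₀ δ t, leadingTerm μ m n
  have hS0 : 0 ≤ S := Finset.sum_nonneg fun m _ => leadingTerm_nonneg μ m n
  have hSlow : c / t ^ 3 * Real.exp (-(3 / 2 * μ * θ₀ * t)) ≤ S := by
    obtain ⟨m, hm, hle⟩ := hlow n t ht₀ htn
    exact hle.trans (Finset.single_le_sum (fun m _ => leadingTerm_nonneg μ m n) hm)
  set E := 4 * Real.exp (2 * μ) * Real.exp (-((3 / 2 * μ * θ₀ + η) * t)) with hE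
  have herror : E * (1 - Real.exp (-τ))⁻¹ ≤ ε * S := by
    calc E * (1 - Real.exp (-τ))⁻¹ = A * (t ^ 3 * Real.exp (-(η * t))) *
          (1 / t ^ 3 * Real.exp (-(3 / 2 * μ * θ₀ * t))) := by
          rw [hE, hA, show -((3 / 2 * μ * θ₀ + η) * t) = -(η * t) + -(3 / 2 * μ * θ₀ * t) by ring,
            Real.exp_add]
          field_simp
      _ ≤ ε * c * (1 / t ^ 3 * Real.exp (-(3 / 2 * μ * θ₀ * t))) := by gcongr
      _ = ε * (c / t ^ 3 * Real.exp (-(3 / 2 * μ * θ₀ * t))) := by ring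
      _ ≤ ε * S := by gcongr
  calc ∑' m : ℕ, ENNReal.ofReal (Real.exp (-μ * m) * coeff n (normSeries m))
      ≤ ∑' m : ℕ, (ENNReal.ofReal (if m ∈ window θ₀ δ t then leadingTerm μ m n else 0) +
          ENNReal.ofReal (E * Real.exp (-τ) ^ m)) := ENNReal.tsum_le_tsum fun m =>
        (ENNReal.ofReal_le_ofReal (hle n t hn ht htn m)).trans ENNReal.ofReal_add_le
    _ = ENNReal.ofReal S + ENNReal.ofReal (E * (1 - Real.exp (-τ))⁻¹) := by
        rw [ENNReal.tsum_add, tsum_ofReal_ite_mem _ fun m => leadingTerm_nonneg μ m n,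
          tsum_ofReal_mul_geometric (by positivity) (Real.exp_pos _).le hq]
    _ ≤ ENNReal.ofReal ((1 + ε) * S) := by
        rw [← ENNReal.ofReal_add hS0 (by positivity)]
        exact ENNReal.ofReal_le_ofReal (by linarith)

end Laplace

section Window

theorem le_leadingWeight_mul {e M₁ : ℝ} {m : ℕ} (he : e ≤ 1) (hm : Real.pi ≤ e * (m + 2))
    (hM₁ : (m : ℝ) + 2 ≤ M₁) {N : ℝ} (hN : 0 ≤ N) :
    4 * Real.pi ^ 2 * (1 - e) ^ 2 / M₁ ^ 3 * N ≤ leadingWeight m * N := by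
  have hm0 : (0 : ℝ) < m + 2 := by positivity
  set u := Real.pi / ((m : ℝ) + 2) with hu
  have hu0 : 0 < u := by positivity
  have hue : u ≤ e := by rwa [hu, div_le_iff₀ hm0]
  have hsin : (1 - e) * u ≤ Real.sin u := by
    have := Real.sin_gt_sub_cube hu0
    nlinarith [mul_pos hu0 hu0]
  gcongr
  calc 4 * Real.pi ^ 2 * (1 - e) ^ 2 / M₁ ^ 3
      ≤ 4 * Real.pi ^ 2 * (1 - e) ^ 2 / ((m : ℝ) + 2) ^ 3 := by gcongr
    _ = 4 * ((1 - e) * u) ^ 2 / (m + 2) := by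
        rw [hu]
        field_simp
    _ ≤ leadingWeight m := by
        unfold leadingWeight
        gcongr

/-- `leadingWeight m * n` tends to `4 π² / θ₀³ = 2 μ` when `m ≈ θ₀ n ^ (1/3)`. -/
theorem exists_window_le_leadingWeight_mul {μ θ₀ y : ℝ} (hθ₀ : 0 < θ₀)
    (h : μ * θ₀ ^ 3 = 2 * Real.pi ^ 2) (hy : y < 2 * μ) :
    ∃ δ, 0 < δ ∧ ∀ (C m₁ : ℕ), ∀ᶠ n : ℕ in atTop,
      ∀ m ∈ window θ₀ δ ((n : ℝ) ^ (1 / 3 : ℝ)), m₁ ≤ m ∧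
        y ≤ leadingWeight m * ((n - C : ℕ) : ℝ) := by
  have hcont : ContinuousAt (fun e : ℝ => 4 * Real.pi ^ 2 * (1 - e) ^ 3 / (θ₀ + e) ^ 3) 0 := by
    refine ContinuousAt.div (by fun_prop) (by fun_prop) ?_
    simp [hθ₀.ne']
  have hval : 4 * Real.pi ^ 2 * (1 - (0 : ℝ)) ^ 3 / (θ₀ + 0) ^ 3 = 2 * μ := by
    rw [show Real.pi ^ 2 = μ * θ₀ ^ 3 / 2 by linarith]
    field_simp
    ring
  obtain ⟨e, he0, heb, hey⟩ := exists_pos_lt_of_continuousAt hcont (hy.trans_eq hval.symm)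
    (lt_min one_pos (half_pos hθ₀))
  obtain ⟨he1, heθ⟩ := lt_min_iff.1 heb
  refine ⟨e, he0, fun C m₁ => ?_⟩
  have htend := tendsto_natCast_rpow_one_div_three
  filter_upwards [htend.eventually (eventually_ge_atTop (2 * Real.pi / (θ₀ * e))),
    htend.eventually (eventually_ge_atTop (2 * (m₁ + 2) / θ₀)),
    tendsto_natCast_atTop_atTop.eventually (eventually_ge_atTop ((C : ℝ) / e))]
    with n htπ htm hC m hm
  set t := (n : ℝ) ^ (1 / 3 : ℝ)
  have ht : 0 < t := lt_of_lt_of_le (by positivity) htπ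
  rw [mem_window, abs_le] at hm
  rw [div_le_iff₀ (by positivity)] at htπ htm hC
  have hmlow : θ₀ / 2 * t ≤ (m : ℝ) + 2 := by nlinarith
  refine ⟨by exact_mod_cast (show (m₁ : ℝ) ≤ m by linarith), ?_⟩
  have hn : (1 - e) * t ^ 3 ≤ ((n - C : ℕ) : ℝ) := by
    have : (n : ℝ) - C ≤ ((n - C : ℕ) : ℝ) := by
      rw [sub_le_iff_le_add]
      exact_mod_cast (show n ≤ n - C + C by omega)
    rw [rpow_one_div_three_pow_three (Nat.cast_nonneg n)]
    linarith
  calc y ≤ 4 * Real.pi ^ 2 * (1 - e) ^ 3 / (θ₀ + e) ^ 3 := hey.le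
    _ = 4 * Real.pi ^ 2 * (1 - e) ^ 2 / ((θ₀ + e) * t) ^ 3 * ((1 - e) * t ^ 3) := by field_simp
    _ ≤ 4 * Real.pi ^ 2 * (1 - e) ^ 2 / ((θ₀ + e) * t) ^ 3 * ((n - C : ℕ) : ℝ) := by gcongr
    _ ≤ leadingWeight m * ((n - C : ℕ) : ℝ) :=
        le_leadingWeight_mul he1.le (by nlinarith) (by linarith) (Nat.cast_nonneg _)

end Window

/-- The harmonic function by which the critical geometric Galton–Watson process is transformed
into the process of level widths of the local limit. -/
noncomputable def harmonicWeight (μ : ℝ) (k : ℕ) : ℝ := binomialExpSum 1 μ k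

theorem harmonicWeight_eq_sum (μ : ℝ) (k : ℕ) : harmonicWeight μ k =
    ∑ j ∈ Finset.range k, (k.choose (j + 1) : ℝ) * (μ ^ j / j.factorial) := by
  simp only [harmonicWeight, binomialExpSum, one_pow, mul_one, mul_div_assoc]

theorem exists_lt_sum_coeff_normSeries {y : ℝ} (hy : y < 2) :
    ∃ m L, y < ∑ l ∈ Finset.range L, coeff l (normSeries m) := by
  obtain ⟨m, hm⟩ := exists_nat_gt (2 / (2 - y))
  have htotal : y < 2 * ((m : ℝ) + 1) / (m + 2) := by
    rw [div_lt_iff₀ (by linarith)] at hm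
    rw [lt_div_iff₀ (by positivity)]
    nlinarith
  exact ⟨m, ((hasSum_coeff_normSeries m).tendsto_sum_nat.eventually (lt_mem_nhds htotal)).exists⟩

theorem mul_leadingTerm_le {μ a β : ℝ} {m₀ m L K s n : ℕ} (hm : 1 ≤ m) (hm₀ : m₀ ≤ m)
    (hn : s + L * K ≤ n) (hβ : β = ∑ l ∈ Finset.range L, coeff l (normSeries m₀)) (ha : 0 ≤ a)
    (hab : a ≤ binomialExpSum β (leadingWeight m * ((n - (s + L * K) : ℕ) : ℝ)) K) :
    a * leadingTerm μ m n ≤ Real.exp (-μ * m) * coeff (n - s) (normSeries m ^ K) := by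
  have hpow : leadingRatio m ^ n ≤ leadingRatio m ^ (n - s) :=
    pow_le_pow_of_le_one (leadingRatio_nonneg m) (leadingRatio_le_one m) (by omega)
  have hbound := le_coeff_normSeries_pow hm hm₀ (L := L) K (n - s) (by omega)
  rw [Nat.sub_sub, ← hβ] at hbound
  have hα := leadingWeight_nonneg m
  have hρ := leadingRatio_nonneg m
  calc a * leadingTerm μ m n
      = Real.exp (-μ * m) * (leadingWeight m * leadingRatio m ^ n * a) := by
        unfold leadingTerm
        ring
    _ ≤ Real.exp (-μ * m) * (leadingWeight m * leadingRatio m ^ (n - s) *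
          binomialExpSum β (leadingWeight m * ((n - (s + L * K) : ℕ) : ℝ)) K) := by gcongr
    _ ≤ _ := by gcongr

theorem eventually_mul_tsum_le_tsum_coeff_pow {μ : ℝ} (hμ : 0 < μ) (K s : ℕ) {c : ℝ}
    (hc0 : 0 ≤ c) (hc : c < 2 ^ (K - 1) * harmonicWeight μ K) :
    ∀ᶠ n : ℕ in atTop,
      ENNReal.ofReal c *
        ∑' m : ℕ, ENNReal.ofReal (Real.exp (-μ * m) * coeff n (normSeries m)) ≤
      ∑' m : ℕ, ENNReal.ofReal (Real.exp (-μ * m) * coeff (n - s) (normSeries m ^ K)) := by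
  obtain ⟨θ₀, hθ₀, h⟩ : ∃ θ₀ : ℝ, 0 < θ₀ ∧ μ * θ₀ ^ 3 = 2 * Real.pi ^ 2 := by
    refine ⟨(2 * Real.pi ^ 2 / μ) ^ (1 / 3 : ℝ), by positivity, ?_⟩
    rw [rpow_one_div_three_pow_three (by positivity)]
    field_simp
  have hcont : ContinuousAt
      (fun e : ℝ => binomialExpSum (2 - e) (2 * μ - e) K - c * (1 + e)) 0 := by
    simp only [binomialExpSum]
    fun_prop
  have hval : 0 < binomialExpSum (2 - 0) (2 * μ - 0) K - c * (1 + 0) := by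
    rw [sub_zero, sub_zero, binomialExpSum_mul, ← harmonicWeight]
    linarith
  obtain ⟨e, he0, heb, hec⟩ := exists_pos_lt_of_continuousAt hcont hval (lt_min one_pos hμ)
  obtain ⟨he1, heμ⟩ := lt_min_iff.1 heb
  obtain ⟨m₀, L, hβ⟩ := exists_lt_sum_coeff_normSeries (show 2 - e < 2 by linarith)
  obtain ⟨δ, hδ, hwindow⟩ :=
    exists_window_le_leadingWeight_mul hθ₀ h (show 2 * μ - e < 2 * μ by linarith)
  filter_upwards [hwindow (s + L * K) (max m₀ 1), eventually_tsum_le_sum_window hμ hθ₀ h hδ he0,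
    eventually_ge_atTop (s + L * K)] with n hweight hsum hn
  set W := window θ₀ δ ((n : ℝ) ^ (1 / 3 : ℝ))
  calc _ ≤ ENNReal.ofReal c * _ := mul_le_mul_right hsum _
    _ = ENNReal.ofReal (∑ m ∈ W, c * (1 + e) * leadingTerm μ m n) := by
        rw [← ENNReal.ofReal_mul hc0, ← Finset.mul_sum, mul_assoc]
    _ ≤ ENNReal.ofReal (∑ m ∈ W, Real.exp (-μ * m) * coeff (n - s) (normSeries m ^ K)) := by
        refine ENNReal.ofReal_le_ofReal (Finset.sum_le_sum fun m hm => ?_)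
        obtain ⟨hm₀, hy⟩ := hweight m hm
        refine mul_leadingTerm_le (m₀ := m₀) (by omega) (by omega) hn rfl (by positivity) ?_
        exact (sub_pos.1 hec).le.trans
          (binomialExpSum_le_binomialExpSum (by linarith) hβ.le (by linarith) hy K)
    _ = ∑ m ∈ W, ENNReal.ofReal (Real.exp (-μ * m) * coeff (n - s) (normSeries m ^ K)) :=
        ENNReal.ofReal_sum_of_nonneg fun m _ => mul_nonneg (Real.exp_pos _).le
          (coeff_pow_nonneg (coeff_normSeries_nonneg m) _ _)
    _ ≤ _ := ENNReal.sum_le_tsum _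

end PlanarTree

/-! ### The critical geometric Galton–Watson tree and its harmonic transform -/

theorem choose_mul_choose_add (k j i : ℕ) :
    (k + j + i).choose (j + i) * (j + i).choose j = (k + j).choose j * (k + j + i).choose i := by
  have h := Nat.choose_mul (n := k + j + i) (k := j + i) (s := i) (by omega)
  rw [Nat.add_sub_cancel, Nat.add_sub_cancel] at h
  rw [Nat.choose_symm_add (a := j) (b := i), h, mul_comm]

theorem multichoose_succ_eq_sum_choose_mul_choose (k j : ℕ) :
    Nat.multichoose k (j + 1) =
      ∑ i ∈ Finset.range (j + 1), j.choose i * k.choose (i + 1) := by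
  rw [Nat.multichoose_eq, show k + (j + 1) - 1 = k + j by omega, Nat.add_choose_eq,
    Finset.Nat.sum_antidiagonal_eq_sum_range_succ (fun a b => k.choose a * j.choose b),
    Finset.sum_range_succ']
  rw [show j + 1 - 0 = j + 1 from rfl, Nat.choose_succ_self, mul_zero, add_zero]
  refine Finset.sum_congr rfl fun i hi => ?_
  have := Finset.mem_range.1 hi
  rw [show j + 1 - (i + 1) = j - i by omega, Nat.choose_symm (by omega), mul_comm]

theorem mul_choose_eq (k j : ℕ) :
    k * k.choose j = j * k.choose j + (j + 1) * k.choose (j + 1) := by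
  have h := Nat.choose_succ_right_eq k j
  rcases le_or_gt j k with hjk | hjk
  · obtain ⟨d, rfl⟩ : ∃ d, k = j + d := ⟨k - j, by omega⟩
    rw [Nat.add_sub_cancel_left] at h
    linarith
  · rw [Nat.choose_eq_zero_of_lt hjk, Nat.choose_eq_zero_of_lt (by omega)]
    simp

theorem sq_mul_choose_eq (k j : ℕ) :
    k ^ 2 * k.choose j = j ^ 2 * k.choose j + (j + 1) * (2 * j + 1) * k.choose (j + 1) +
      (j + 1) * (j + 2) * k.choose (j + 2) := by
  rw [sq, mul_assoc, mul_choose_eq, mul_add, mul_left_comm, mul_choose_eq, mul_left_comm k,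
    mul_choose_eq]
  ring

theorem tsum_choose_mul_choose (k j : ℕ) :
    ∑' i : ℕ, (j.choose i : ℝ≥0∞) * (k.choose (i + 1) : ℝ≥0∞) = k.multichoose (j + 1) := by
  rw [tsum_eq_sum (s := Finset.range (j + 1)), multichoose_succ_eq_sum_choose_mul_choose]
  · push_cast
    rfl
  · intro i hi
    rw [Nat.choose_eq_zero_of_lt (by simpa [Nat.lt_succ_iff] using hi), Nat.cast_zero, zero_mul]

theorem hasSum_multichoose_succ_mul_choose (k j : ℕ) :
    HasSum (fun b : ℕ => ((k + 1).multichoose b : ℝ) * (2⁻¹ ^ (k + 1 + b) * b.choose j))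
      ((k + 1).multichoose j) := by
  have negative_binomial := (hasSum_choose_mul_geometric_of_norm_lt_one (k + j)
    (r := (2⁻¹ : ℝ)) (by norm_num)).mul_left (((k + j).choose j : ℝ) * 2⁻¹ ^ (k + 1 + j))
  have value : ((k + j).choose j : ℝ) * 2⁻¹ ^ (k + 1 + j) * (1 / (1 - 2⁻¹) ^ (k + j + 1)) =
      (k + 1).multichoose j := by
    rw [show (1 : ℝ) - 2⁻¹ = 2⁻¹ by norm_num, show k + 1 + j = k + j + 1 by ring, mul_assoc,
      mul_one_div_cancel (by positivity), mul_one, Nat.multichoose_eq,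
      show k + 1 + j - 1 = k + j by omega]
  rw [value] at negative_binomial
  rw [← hasSum_nat_add_iff' j, Finset.sum_eq_zero, sub_zero]
  · refine negative_binomial.congr_fun fun i => ?_
    have h : ((k + j + i).choose (j + i) : ℝ) * (j + i).choose j =
      (k + j).choose j * (k + j + i).choose i := by exact_mod_cast choose_mul_choose_add k j i
    rw [Nat.multichoose_eq, show k + 1 + (i + j) - 1 = k + j + i by omega, add_comm i j,
      show i + (k + j) = k + j + i by ring, show k + 1 + (j + i) = k + 1 + j + i by ring,
      pow_add _ (k + 1 + j), Nat.choose_symm_add (a := k + j) (b := i)]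
    linear_combination (2⁻¹ ^ (k + 1 + j) * 2⁻¹ ^ i : ℝ) * h
  · intro b hb
    rw [Nat.choose_eq_zero_of_lt (Finset.mem_range.1 hb), Nat.cast_zero, mul_zero, mul_zero]

theorem tsum_multichoose_mul_choose (k j : ℕ) :
    ∑' b : ℕ, (k.multichoose b : ℝ≥0∞) * ((2⁻¹ : ℝ≥0∞) ^ (k + b) * (b.choose j : ℝ≥0∞)) =
      k.multichoose j := by
  rcases k with _ | k
  · rw [tsum_eq_single 0]
    · rcases j with _ | j <;> simp
    · intro b hb
      obtain ⟨b, rfl⟩ := Nat.exists_eq_succ_of_ne_zero hb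
      simp
  · have as_real (b : ℕ) : ((k + 1).multichoose b : ℝ≥0∞) *
        ((2⁻¹ : ℝ≥0∞) ^ (k + 1 + b) * (b.choose j : ℝ≥0∞)) =
        ENNReal.ofReal ((k + 1).multichoose b * (2⁻¹ ^ (k + 1 + b) * b.choose j)) := by
      rw [ENNReal.ofReal_mul (by positivity), ENNReal.ofReal_mul (by positivity),
        ENNReal.ofReal_natCast, ENNReal.ofReal_natCast, ENNReal.ofReal_pow (by positivity),
        ENNReal.ofReal_inv_of_pos (by norm_num), ENNReal.ofReal_ofNat]
    have hs := hasSum_multichoose_succ_mul_choose k j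
    simp_rw [as_real]
    rw [← ENNReal.ofReal_tsum_of_nonneg (fun b => by positivity) hs.summable, hs.tsum_eq,
      ENNReal.ofReal_natCast]

theorem hasSum_pow_div_factorial_mul_descFactorial (x : ℝ) (i : ℕ) :
    HasSum (fun j : ℕ => x ^ j / j.factorial * (j.descFactorial i : ℝ)) (x ^ i * Real.exp x) := by
  rw [← hasSum_nat_add_iff' i, Finset.sum_eq_zero, sub_zero]
  · have h := (NormedSpace.expSeries_div_hasSum_exp x).mul_left (x ^ i)
    rw [← Real.exp_eq_exp_ℝ] at h
    refine h.congr_fun fun j => ?_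
    have h1 := Nat.factorial_mul_descFactorial (show i ≤ j + i by omega)
    rw [Nat.add_sub_cancel] at h1
    have h2 : (j.factorial : ℝ) * ((j + i).descFactorial i : ℝ) = (j + i).factorial := by
      exact_mod_cast h1
    rw [← h2, pow_add]
    have h3 : (j.factorial : ℝ) ≠ 0 := by positivity
    have h4 : ((j + i).descFactorial i : ℝ) ≠ 0 := by
      intro h0
      rw [h0, mul_zero] at h2
      exact (Nat.factorial_ne_zero (j + i)) (by exact_mod_cast h2.symm)
    field_simp
  · intro j hj
    rw [Nat.descFactorial_eq_zero_iff_lt.2 (Finset.mem_range.1 hj)]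
    simp

theorem hasSum_pow_div_factorial_mul_choose (x : ℝ) (i : ℕ) :
    HasSum (fun j : ℕ => x ^ j / j.factorial * (j.choose i : ℝ))
      (Real.exp x * (x ^ i / i.factorial)) := by
  convert! (hasSum_pow_div_factorial_mul_descFactorial x i).mul_left (1 / (i.factorial : ℝ))
    using 1
  · funext j
    rw [Nat.descFactorial_eq_factorial_mul_choose]
    push_cast
    field_simp
  · ring

theorem ofReal_pow_div_factorial_mul {x : ℝ} (hx : 0 ≤ x) (n j : ℕ) :
    ENNReal.ofReal (x ^ j / j.factorial) * (n : ℝ≥0∞) ^ j =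
      ENNReal.ofReal ((x * n) ^ j / j.factorial) := by
  rw [← ENNReal.ofReal_natCast n, ← ENNReal.ofReal_pow (by positivity),
    ← ENNReal.ofReal_mul (by positivity), mul_pow]
  congr 1
  ring

namespace PlanarTree

/-- The probability that the critical geometric Galton–Watson tree has `T` as its ball of
radius `r`. -/
noncomputable def gwWeight (r : ℕ) (T : PlanarTree) : ℝ≥0∞ :=
  2 * 2 ^ T.width r * 4⁻¹ ^ T.volume r

theorem gwWeight_ne_zero (r : ℕ) (T : PlanarTree) : gwWeight r T ≠ 0 := by
  simp [gwWeight]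

theorem gwWeight_ne_top (r : ℕ) (T : PlanarTree) : gwWeight r T ≠ ⊤ :=
  ENNReal.mul_ne_top (ENNReal.mul_ne_top (by simp) (by simp)) (by simp)

theorem gwWeight_edge : gwWeight 1 edge = 1 := by
  rw [gwWeight, volume_edge, width_edge, pow_one, pow_one, show (2 : ℝ≥0∞) * 2 = 4 by norm_num]
  exact ENNReal.mul_inv_cancel (by norm_num) (by norm_num)

theorem gwWeight_extension {r : ℕ} {T : PlanarTree} (U : Extension r 1 T) :
    gwWeight (r + 1) U.1 = gwWeight r T * 2⁻¹ ^ (T.width r + U.1.width (r + 1)) := by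
  have hv : U.1.volume (r + 1) = T.volume r + U.1.width (r + 1) := by
    rw [volume_succ, ← volume_ball le_rfl U.1, U.2.2]
  set b := U.1.width (r + 1) with hb
  have h2 : (2 : ℝ≥0∞) * 2⁻¹ = 1 := ENNReal.mul_inv_cancel (by norm_num) (by norm_num)
  have h4 : (4⁻¹ : ℝ≥0∞) = 2⁻¹ * 2⁻¹ := by
    rw [← ENNReal.mul_inv (by norm_num) (by norm_num)]
    norm_num
  have h5 : (2 : ℝ≥0∞) * 4⁻¹ = 2⁻¹ := by rw [h4, ← mul_assoc, h2, one_mul]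
  rw [gwWeight, gwWeight, hv, ← hb, pow_add, pow_add]
  calc (2 : ℝ≥0∞) * 2 ^ b * (4⁻¹ ^ T.volume r * 4⁻¹ ^ b)
      = 2 * 4⁻¹ ^ T.volume r * (2 * 4⁻¹) ^ b := by rw [mul_pow]; ring
    _ = 2 * 4⁻¹ ^ T.volume r * (2⁻¹) ^ b * (2 * 2⁻¹) ^ T.width r := by
        rw [h5, h2, one_pow, mul_one]
    _ = _ := by rw [mul_pow]; ring

theorem tsum_gwWeight_extension {r : ℕ} (hr : 1 ≤ r) {T : PlanarTree} (hT : ball r T = T)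
    (F : ℕ → ℝ≥0∞) :
    ∑' U : Extension r 1 T, gwWeight (r + 1) U.1 * F (U.1.width (r + 1)) =
      gwWeight r T * ∑' b, (Nat.multichoose (T.width r) b : ℝ≥0∞) *
        (2⁻¹ ^ (T.width r + b) * F b) := by
  rw [← tsum_extension_one hr hT (fun b => 2⁻¹ ^ (T.width r + b) * F b), ← ENNReal.tsum_mul_left]
  refine tsum_congr fun U => ?_
  rw [gwWeight_extension, mul_assoc]

/-- The expectation of a function of the width at height `r` of the critical geometric
Galton–Watson tree. -/
noncomputable def gwExpectation (r : ℕ) (F : ℕ → ℝ≥0∞) : ℝ≥0∞ :=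
  ∑' T : BoundedTree r, gwWeight r T.1 * F (T.1.width r)

theorem gwExpectation_one (F : ℕ → ℝ≥0∞) : gwExpectation 1 F = F 1 := by
  rw [gwExpectation, tsum_eq_single ⟨edge, ball_edge⟩]
  · rw [gwWeight_edge, width_edge, one_mul]
  · rintro ⟨T, hT⟩ hne
    exact absurd (Subtype.ext (eq_of_ball_one hT ball_edge)) hne

theorem gwExpectation_succ {r : ℕ} (hr : 1 ≤ r) (F : ℕ → ℝ≥0∞) :
    gwExpectation (r + 1) F = gwExpectation r fun k => ∑' b, (Nat.multichoose k b : ℝ≥0∞) *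
      (2⁻¹ ^ (k + b) * F b) := by
  rw [gwExpectation, ← (boundedTreeSuccEquiv r).tsum_eq, ENNReal.tsum_sigma', gwExpectation]
  refine tsum_congr fun T => ?_
  exact tsum_gwWeight_extension hr T.2 F

theorem gwExpectation_tsum (r : ℕ) (F : ℕ → ℕ → ℝ≥0∞) :
    gwExpectation r (fun k => ∑' j, F j k) = ∑' j, gwExpectation r (F j) := by
  simp_rw [gwExpectation, ← ENNReal.tsum_mul_left]
  exact ENNReal.tsum_comm

theorem gwExpectation_const_mul (r : ℕ) (c : ℝ≥0∞) (F : ℕ → ℝ≥0∞) :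
    gwExpectation r (fun k => c * F k) = c * gwExpectation r F := by
  simp_rw [gwExpectation, ← ENNReal.tsum_mul_left]
  exact tsum_congr fun T => by ring

theorem gwExpectation_sum (r : ℕ) {ι : Type*} (s : Finset ι) (F : ι → ℕ → ℝ≥0∞) :
    gwExpectation r (fun k => ∑ i ∈ s, F i k) = ∑ i ∈ s, gwExpectation r (F i) := by
  simp_rw [gwExpectation, Finset.mul_sum]
  exact Summable.tsum_finsetSum fun _ _ => ENNReal.summable

theorem gwExpectation_choose (n j : ℕ) :
    gwExpectation (n + 1) (fun k => (k.choose (j + 1) : ℝ≥0∞)) = (n : ℝ≥0∞) ^ j := by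
  induction n generalizing j with
  | zero =>
    rw [zero_add, gwExpectation_one]
    rcases j with _ | j
    · simp
    · simp [Nat.choose_eq_zero_of_lt]
  | succ n ih =>
    rw [gwExpectation_succ (by omega)]
    simp_rw [tsum_multichoose_mul_choose, multichoose_succ_eq_sum_choose_mul_choose]
    push_cast
    rw [gwExpectation_sum]
    simp_rw [gwExpectation_const_mul, ih]
    rw [add_pow]
    refine Finset.sum_congr rfl fun i _ => ?_
    ring

theorem harmonicWeight_zero (μ : ℝ) : harmonicWeight μ 0 = 0 := by simp [harmonicWeight_eq_sum]

theorem harmonicWeight_pos {μ : ℝ} (hμ : 0 < μ) {k : ℕ} (hk : k ≠ 0) : 0 < harmonicWeight μ k := by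
  rw [harmonicWeight_eq_sum]
  refine Finset.sum_pos (fun j hj => ?_) (by simpa using hk)
  have : 0 < k.choose (j + 1) := Nat.choose_pos (Finset.mem_range.1 hj)
  positivity

theorem ofReal_harmonicWeight {μ : ℝ} (hμ : 0 ≤ μ) (k : ℕ) :
    ENNReal.ofReal (harmonicWeight μ k) =
      ∑' j : ℕ, ENNReal.ofReal (μ ^ j / j.factorial) * (k.choose (j + 1) : ℝ≥0∞) := by
  rw [tsum_eq_sum (s := Finset.range k), harmonicWeight_eq_sum,
    ENNReal.ofReal_sum_of_nonneg fun j _ => by positivity]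
  · refine Finset.sum_congr rfl fun j _ => ?_
    rw [ENNReal.ofReal_mul (by positivity), ENNReal.ofReal_natCast, mul_comm]
  · intro j hj
    rw [Nat.choose_eq_zero_of_lt (by simpa [Nat.lt_succ_iff] using hj), Nat.cast_zero, mul_zero]

/-- Since the `j + 1` subsets of the next generation have mean `multichoose k (j + 1)`, and this is
a binomial convolution, the exponential generating function in `j` picks up a factor `exp μ`. -/
theorem tsum_multichoose_mul_harmonicWeight {μ : ℝ} (hμ : 0 ≤ μ) (k : ℕ) :
    ∑' b : ℕ, (k.multichoose b : ℝ≥0∞) *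
      (2⁻¹ ^ (k + b) * ENNReal.ofReal (harmonicWeight μ b)) =
      ENNReal.ofReal (Real.exp μ) * ENNReal.ofReal (harmonicWeight μ k) := by
  calc ∑' b : ℕ, (k.multichoose b : ℝ≥0∞) * (2⁻¹ ^ (k + b) * ENNReal.ofReal (harmonicWeight μ b))
      = ∑' j : ℕ, ENNReal.ofReal (μ ^ j / j.factorial) * ∑' b : ℕ, (k.multichoose b : ℝ≥0∞) *
          (2⁻¹ ^ (k + b) * (b.choose (j + 1) : ℝ≥0∞)) := by
        simp_rw [ofReal_harmonicWeight hμ, ← ENNReal.tsum_mul_left]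
        rw [ENNReal.tsum_comm]
        exact tsum_congr fun j => tsum_congr fun b => by ring
    _ = ∑' i : ℕ, (∑' j : ℕ, ENNReal.ofReal (μ ^ j / j.factorial) * (j.choose i : ℝ≥0∞)) *
          (k.choose (i + 1) : ℝ≥0∞) := by
        simp_rw [tsum_multichoose_mul_choose, ← tsum_choose_mul_choose, ← ENNReal.tsum_mul_left,
          ← ENNReal.tsum_mul_right]
        rw [ENNReal.tsum_comm]
        simp_rw [mul_assoc]
    _ = ∑' i : ℕ, ENNReal.ofReal (Real.exp μ) * (ENNReal.ofReal (μ ^ i / i.factorial) *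
          (k.choose (i + 1) : ℝ≥0∞)) := by
        refine tsum_congr fun i => ?_
        have hs := hasSum_pow_div_factorial_mul_choose μ i
        rw [← mul_assoc, ← ENNReal.ofReal_mul (Real.exp_pos _).le, ← hs.tsum_eq,
          ENNReal.ofReal_tsum_of_nonneg (fun j => by positivity) hs.summable]
        congr 1
        refine tsum_congr fun j => ?_
        rw [ENNReal.ofReal_mul (by positivity), ENNReal.ofReal_natCast]
    _ = _ := by rw [ENNReal.tsum_mul_left, ← ofReal_harmonicWeight hμ]

theorem gwExpectation_harmonicWeight_mul {μ : ℝ} (hμ : 0 ≤ μ) (n : ℕ) {f : ℕ → ℕ} {d : ℕ}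
    {a : ℕ → Fin d → ℕ}
    (hf : ∀ k j, f k * k.choose (j + 1) = ∑ i, a j i * k.choose (j + i + 1)) {S : ℝ}
    (hS : HasSum (fun j : ℕ => (μ * n) ^ j / j.factorial * ∑ i, (a j i : ℝ) * n ^ (i : ℕ)) S) :
    gwExpectation (n + 1) (fun k => ENNReal.ofReal (harmonicWeight μ k) * (f k : ℝ≥0∞)) =
      ENNReal.ofReal S := by
  have expand (k : ℕ) : ENNReal.ofReal (harmonicWeight μ k) * (f k : ℝ≥0∞) =
      ∑' j : ℕ, ENNReal.ofReal (μ ^ j / j.factorial) *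
        ∑ i, (a j i : ℝ≥0∞) * (k.choose (j + i + 1) : ℝ≥0∞) := by
    rw [ofReal_harmonicWeight hμ, ← ENNReal.tsum_mul_right]
    refine tsum_congr fun j => ?_
    rw [mul_assoc, mul_comm (k.choose (j + 1) : ℝ≥0∞)]
    congr 1
    exact_mod_cast hf k j
  have evaluate (j : ℕ) : ENNReal.ofReal (μ ^ j / j.factorial) *
      ∑ i, (a j i : ℝ≥0∞) * (n : ℝ≥0∞) ^ (j + i) =
      ENNReal.ofReal ((μ * n) ^ j / j.factorial * ∑ i, (a j i : ℝ) * n ^ (i : ℕ)) := by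
    have pull_out : ∑ i, (a j i : ℝ≥0∞) * (n : ℝ≥0∞) ^ (j + i) =
        (n : ℝ≥0∞) ^ j * ((∑ i, a j i * n ^ (i : ℕ) : ℕ) : ℝ≥0∞) := by
      push_cast
      rw [Finset.mul_sum]
      exact Finset.sum_congr rfl fun i _ => by ring
    rw [pull_out, ← mul_assoc, ofReal_pow_div_factorial_mul hμ, ← ENNReal.ofReal_natCast,
      ← ENNReal.ofReal_mul (by positivity)]
    push_cast
    rfl
  simp_rw [expand]
  rw [gwExpectation_tsum]
  simp_rw [gwExpectation_const_mul, gwExpectation_sum, gwExpectation_const_mul,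
    gwExpectation_choose, evaluate]
  rw [← ENNReal.ofReal_tsum_of_nonneg (fun j => by positivity) hS.summable, hS.tsum_eq]

theorem gwExpectation_harmonicWeight_mul_self {μ : ℝ} (hμ : 0 ≤ μ) (n : ℕ) :
    gwExpectation (n + 1) (fun k => ENNReal.ofReal (harmonicWeight μ k) * (k : ℝ≥0∞)) =
      ENNReal.ofReal (Real.exp (μ * n) * (μ * n ^ 2 + (μ + 2) * n + 1)) := by
  refine gwExpectation_harmonicWeight_mul hμ n (f := id) (a := fun j => ![j + 1, j + 2])
    (fun k j => ?_) ?_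
  · simpa [Fin.sum_univ_two] using mul_choose_eq k (j + 1)
  · convert! ((hasSum_pow_div_factorial_mul_descFactorial (μ * n) 0).mul_left
      (1 + 2 * (n : ℝ))).add ((hasSum_pow_div_factorial_mul_descFactorial (μ * n) 1).mul_left
      (1 + (n : ℝ))) using 1
    · funext j
      simp [Fin.sum_univ_two]
      ring
    · ring

theorem gwExpectation_harmonicWeight_mul_sq {μ : ℝ} (hμ : 0 ≤ μ) (n : ℕ) :
    gwExpectation (n + 1) (fun k => ENNReal.ofReal (harmonicWeight μ k) * (k : ℝ≥0∞) ^ 2) =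
      ENNReal.ofReal (Real.exp (μ * n) * (((μ * n) ^ 2 + 3 * (μ * n) + 1) +
        n * (2 * (μ * n) ^ 2 + 9 * (μ * n) + 6) + n ^ 2 * ((μ * n) ^ 2 + 6 * (μ * n) + 6))) := by
  let a (j : ℕ) : Fin 3 → ℕ := ![(j + 1) ^ 2, (j + 2) * (2 * j + 3), (j + 2) * (j + 3)]
  have expansion (k j : ℕ) :
      k ^ 2 * k.choose (j + 1) = ∑ i, a j i * k.choose (j + i + 1) := by
    rw [sq_mul_choose_eq, Fin.sum_univ_three]
    simp only [a, Matrix.cons_val, Fin.val_zero, Fin.val_one, Fin.val_two]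
    ring
  have moments : HasSum (fun j : ℕ => (μ * n) ^ j / j.factorial * ∑ i, (a j i : ℝ) * n ^ (i : ℕ))
      (Real.exp (μ * n) * (((μ * n) ^ 2 + 3 * (μ * n) + 1) +
        n * (2 * (μ * n) ^ 2 + 9 * (μ * n) + 6) + n ^ 2 * ((μ * n) ^ 2 + 6 * (μ * n) + 6))) := by
    convert! (((hasSum_pow_div_factorial_mul_descFactorial (μ * n) 0).mul_left
      (1 + 6 * (n : ℝ) + 6 * (n : ℝ) ^ 2)).add
      ((hasSum_pow_div_factorial_mul_descFactorial (μ * n) 1).mul_left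
      (3 + 9 * (n : ℝ) + 6 * (n : ℝ) ^ 2))).add
      ((hasSum_pow_div_factorial_mul_descFactorial (μ * n) 2).mul_left
      (1 + 2 * (n : ℝ) + (n : ℝ) ^ 2)) using 1
    · funext j
      rw [Nat.cast_descFactorial_two]
      simp [a, Fin.sum_univ_three]
      ring
    · ring
  simpa only [Nat.cast_pow] using gwExpectation_harmonicWeight_mul hμ n expansion moments

/-- The probability that the ball of radius `r` of the local limit is `T`. -/
noncomputable def limitProb (μ : ℝ) (r : ℕ) (T : PlanarTree) : ℝ≥0∞ :=
  heightFugacity μ ^ (r - 1) * (gwWeight r T * ENNReal.ofReal (harmonicWeight μ (T.width r)))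

theorem limitProb_ne_top {μ : ℝ} (hμ : 0 < μ) (r : ℕ) (T : PlanarTree) : limitProb μ r T ≠ ⊤ :=
  ENNReal.mul_ne_top (ENNReal.pow_ne_top (heightFugacity_lt_one hμ).ne_top)
    (ENNReal.mul_ne_top (gwWeight_ne_top r T) ENNReal.ofReal_ne_top)

theorem limitProb_eq_zero_iff {μ : ℝ} (hμ : 0 < μ) (r : ℕ) (T : PlanarTree) :
    limitProb μ r T = 0 ↔ T.width r = 0 := by
  constructor
  · intro h
    by_contra hne
    have h1 : ENNReal.ofReal (harmonicWeight μ (T.width r)) ≠ 0 :=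
      (ENNReal.ofReal_pos.2 (harmonicWeight_pos hμ hne)).ne'
    exact mul_ne_zero (pow_ne_zero _ (heightFugacity_pos μ).ne')
      (mul_ne_zero (gwWeight_ne_zero r T) h1) h
  · intro h
    simp [limitProb, h, harmonicWeight_zero]

theorem heightFugacity_mul_exp (μ : ℝ) :
    heightFugacity μ * ENNReal.ofReal (Real.exp μ) = 1 := by
  rw [heightFugacity, ← ENNReal.ofReal_mul (Real.exp_pos _).le, ← Real.exp_add]
  simp

theorem tsum_limitProb_extension {μ : ℝ} (hμ : 0 ≤ μ) {r : ℕ} (hr : 1 ≤ r) {T : PlanarTree}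
    (hT : ball r T = T) : ∑' U : Extension r 1 T, limitProb μ (r + 1) U.1 = limitProb μ r T := by
  simp only [limitProb]
  rw [ENNReal.tsum_mul_left,
    tsum_gwWeight_extension hr hT fun b => ENNReal.ofReal (harmonicWeight μ b),
    tsum_multichoose_mul_harmonicWeight hμ]
  obtain ⟨r, rfl⟩ : ∃ k, r = k + 1 := ⟨r - 1, by omega⟩
  simp only [Nat.add_sub_cancel]
  calc heightFugacity μ ^ (r + 1) * (gwWeight (r + 1) T * (ENNReal.ofReal (Real.exp μ) *
        ENNReal.ofReal (harmonicWeight μ (T.width (r + 1)))))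
      = (heightFugacity μ * ENNReal.ofReal (Real.exp μ)) * (heightFugacity μ ^ r *
        (gwWeight (r + 1) T * ENNReal.ofReal (harmonicWeight μ (T.width (r + 1))))) := by ring
    _ = _ := by rw [heightFugacity_mul_exp, one_mul]

theorem limitProb_edge (μ : ℝ) : limitProb μ 1 edge = 1 := by
  rw [limitProb, gwWeight_edge, width_edge]
  simp [harmonicWeight_eq_sum]

end PlanarTree

namespace PlanarTree

/-! ### Open sets as disjoint unions of cylinders -/

/-- The largest union of cylinders of radius `r` contained in `G`. -/
def cylinderPart (r : ℕ) (G : Set PlanarTree) : Set PlanarTree :=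
  {T | ∀ U, ball r U = ball r T → U ∈ G}

theorem cylinderPart_subset (r : ℕ) (G : Set PlanarTree) : cylinderPart r G ⊆ G :=
  fun T h => h T rfl

theorem cylinderPart_mono (G : Set PlanarTree) : Monotone fun r => cylinderPart r G :=
  fun _ _ hrs _ h U hU => h U (ball_eq_mono hrs hU)

theorem iUnion_cylinderPart {G : Set PlanarTree} (hG : IsOpen G) :
    ⋃ n : ℕ, cylinderPart (n + 1) G = G := by
  refine Set.Subset.antisymm (Set.iUnion_subset fun n => cylinderPart_subset _ _) fun T hT => ?_
  obtain ⟨ε, hε, hball⟩ := Metric.isOpen_iff.1 hG T hT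
  obtain ⟨n, hn⟩ := exists_nat_one_div_lt hε
  refine Set.mem_iUnion.2 ⟨n, fun U hU => hball (Metric.mem_ball.2 (dist_lt_iff.2 ?_))⟩
  exact ⟨n + 1, by omega, hU, by exact_mod_cast hn⟩

theorem cylinderPart_eq_iUnion (r : ℕ) (G : Set PlanarTree) :
    cylinderPart r G = ⋃ T : {T : BoundedTree r // ∀ U, ball r U = T.1 → U ∈ G},
      {U | ball r U = T.1.1} := by
  ext T
  simp only [Set.mem_iUnion, Set.mem_ofPred_eq]
  constructor
  · intro h
    exact ⟨⟨⟨ball r T, ball_ball le_rfl T⟩, h⟩, rfl⟩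
  · rintro ⟨⟨V, hV⟩, hT⟩ U hU
    exact hV U (hU.trans hT)

theorem pairwise_disjoint_cylinder (r : ℕ) :
    Pairwise (Function.onFun Disjoint fun T : BoundedTree r => {U : PlanarTree | ball r U = T.1}) :=
  fun _ _ hne => Set.disjoint_left.2 fun _ hS hT => hne (Subtype.ext (hS.symm.trans hT))

theorem measure_cylinderPart (ν : Measure PlanarTree) (r : ℕ) (G : Set PlanarTree) :
    ν (cylinderPart r G) = ∑' T : {T : BoundedTree r // ∀ U, ball r U = T.1 → U ∈ G},
      ν {U | ball r U = T.1.1} := by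
  rw [cylinderPart_eq_iUnion, measure_iUnion
    ((pairwise_disjoint_cylinder r).comp_of_injective Subtype.val_injective)
    fun T => measurableSet_cylinder r _]

theorem measurable_of_measurableSet_preimage_cylinder {Ω : Type*} [MeasurableSpace Ω]
    {f : Ω → PlanarTree}
    (hf : ∀ n T, ball (n + 1) T = T → MeasurableSet (f ⁻¹' {U | ball (n + 1) U = T})) :
    Measurable f := by
  refine measurable_of_isOpen fun G hG => ?_
  rw [← iUnion_cylinderPart hG, Set.preimage_iUnion]
  refine MeasurableSet.iUnion fun n => ?_
  rw [cylinderPart_eq_iUnion, Set.preimage_iUnion]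
  exact MeasurableSet.iUnion fun T => hf n T.1.1 T.1.2

end PlanarTree

theorem tsum_liminf_le {ι : Type*} [Countable ι] (f : ℕ → ι → ℝ≥0∞) :
    ∑' i, liminf (fun n => f n i) atTop ≤ liminf (fun n => ∑' i, f n i) atTop := by
  let _ : MeasurableSpace ι := ⊤
  have : MeasurableSingletonClass ι := ⟨fun _ => trivial⟩
  simpa only [lintegral_count] using lintegral_liminf_le (u := atTop) (μ := Measure.count) (f := f)
    fun _ => measurable_from_top

namespace PlanarTree

theorem measure_le_liminf_of_isOpen {ν : Measure PlanarTree} {νs : ℕ → Measure PlanarTree}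
    (h : ∀ r ≥ 1, ∀ T, ball r T = T →
      ν {U | ball r U = T} ≤ liminf (fun N => νs N {U | ball r U = T}) atTop)
    {G : Set PlanarTree} (hG : IsOpen G) : ν G ≤ liminf (fun N => νs N G) atTop := by
  conv_lhs => rw [← iUnion_cylinderPart hG]
  rw [Monotone.measure_iUnion fun m n h => cylinderPart_mono G (Nat.succ_le_succ h)]
  refine iSup_le fun n => ?_
  calc ν (cylinderPart (n + 1) G)
      = ∑' T : {T : BoundedTree (n + 1) // ∀ U, ball (n + 1) U = T.1 → U ∈ G},
          ν {U | ball (n + 1) U = T.1.1} := measure_cylinderPart _ _ _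
    _ ≤ ∑' T : {T : BoundedTree (n + 1) // ∀ U, ball (n + 1) U = T.1 → U ∈ G},
          liminf (fun N => νs N {U | ball (n + 1) U = T.1.1}) atTop :=
        ENNReal.tsum_le_tsum fun T => h (n + 1) (Nat.le_add_left 1 n) _ T.1.2
    _ ≤ liminf (fun N => ∑' T : {T : BoundedTree (n + 1) // ∀ U, ball (n + 1) U = T.1 → U ∈ G},
          νs N {U | ball (n + 1) U = T.1.1}) atTop := tsum_liminf_le _
    _ ≤ liminf (fun N => νs N G) atTop := by
        refine liminf_le_liminf (Eventually.of_forall fun N => ?_)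
        rw [← measure_cylinderPart]
        exact measure_mono (cylinderPart_subset _ _)

/-! ### Growing the limit tree -/

/-- A tree of height at most `n + 1`, regarded as the ball of radius `n + 1` of a growing tree.
The radius is part of the data, so that a tree can occur at several radii. -/
abbrev Stage : Type := Σ n : ℕ, BoundedTree (n + 1)

instance measurableSpaceExtension (r : ℕ) (T : PlanarTree) : MeasurableSpace (Extension r 1 T) := ⊤

instance discreteMeasurableSpaceExtension (r : ℕ) (T : PlanarTree) :
    DiscreteMeasurableSpace (Extension r 1 T) := ⟨fun _ => trivial⟩

theorem ball_succ_eq_self (i : Stage) : ball (i.1 + 1 + 1) i.2.1 = i.2.1 :=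
  (ball_eq_self_iff (by omega)).2 (width_eq_zero_of_ball_eq_self (by omega) i.2.2 (by omega))

theorem tsum_limitProb_extension_ne_top {μ : ℝ} (hμ : 0 < μ) (i : Stage) :
    ∑' U : Extension (i.1 + 1) 1 i.2.1, limitProb μ (i.1 + 1 + 1) U.1 ≠ ⊤ := by
  rw [tsum_limitProb_extension hμ.le (by omega) i.2.2]
  exact limitProb_ne_top hμ _ _

open Classical in
/-- The law of the next level of the limit tree, given the ball `i`. Balls of probability zero are,
arbitrarily, left unchanged. -/
noncomputable def stepPMF {μ : ℝ} (hμ : 0 < μ) (i : Stage) :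
    PMF (Extension (i.1 + 1) 1 i.2.1) :=
  if h : ∑' U : Extension (i.1 + 1) 1 i.2.1, limitProb μ (i.1 + 1 + 1) U.1 = 0 then
    PMF.pure ⟨i.2.1, ball_succ_eq_self i, i.2.2⟩
  else PMF.normalize (fun U => limitProb μ (i.1 + 1 + 1) U.1) h
    (tsum_limitProb_extension_ne_top hμ i)

theorem stepPMF_apply {μ : ℝ} (hμ : 0 < μ) {i : Stage} (h : limitProb μ (i.1 + 1) i.2.1 ≠ 0)
    (U : Extension (i.1 + 1) 1 i.2.1) :
    stepPMF hμ i U = limitProb μ (i.1 + 1 + 1) U.1 / limitProb μ (i.1 + 1) i.2.1 := by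
  have total := tsum_limitProb_extension hμ.le (by omega) i.2.2
  rw [stepPMF, dif_neg (by rwa [total]), PMF.normalize_apply, total, div_eq_mul_inv]

/-- A choice of a one-level extension of every ball. -/
abbrev Choices : Type := ∀ i : Stage, Extension (i.1 + 1) 1 i.2.1

/-- The law of independent choices. Only the choices along one branch are ever used, but choosing
for all balls at once makes the growth a deterministic function of a product measure. -/
noncomputable def choicesMeasure {μ : ℝ} (hμ : 0 < μ) : Measure Choices :=
  Measure.infinitePi fun i => (stepPMF hμ i).toMeasure

instance isProbabilityMeasure_choicesMeasure {μ : ℝ} (hμ : 0 < μ) :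
    IsProbabilityMeasure (choicesMeasure hμ) := by
  unfold choicesMeasure
  infer_instance

/-- The ball of radius `n + 1` grown from the choices `ω`. -/
def grow (ω : Choices) : ∀ n : ℕ, BoundedTree (n + 1)
  | 0 => ⟨edge, ball_edge⟩
  | n + 1 => ⟨(ω ⟨n, grow ω n⟩).1, (ω ⟨n, grow ω n⟩).2.1⟩

theorem ball_grow_succ (ω : Choices) (n : ℕ) :
    ball (n + 1) (grow ω (n + 1)).1 = (grow ω n).1 :=
  (ω ⟨n, grow ω n⟩).2.2

/-- The ball of radius `n + 1` of `T` as a stage. -/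
def stageOf (T : PlanarTree) : ℕ ↪ Stage :=
  ⟨fun n => ⟨n, ball (n + 1) T, ball_ball le_rfl T⟩, fun _ _ h => congrArg Sigma.fst h⟩

/-- The extensions of the ball `i` that agree with `T` up to the next level. -/
def chosen (T : PlanarTree) (i : Stage) : Set (Extension (i.1 + 1) 1 i.2.1) :=
  {U | U.1 = ball (i.1 + 1 + 1) T}

theorem grow_succ_eq_iff (ω : Choices) (T : PlanarTree) (n : ℕ) :
    (grow ω (n + 1)).1 = ball (n + 1 + 1) T ↔
      (grow ω n).1 = ball (n + 1) T ∧ ω (stageOf T n) ∈ chosen T (stageOf T n) := by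
  have choice_eq (h : (grow ω n).1 = ball (n + 1) T) :
      (grow ω (n + 1)).1 = (ω (stageOf T n)).1 := by
    have : grow ω n = ⟨ball (n + 1) T, ball_ball le_rfl T⟩ := Subtype.ext h
    change (ω ⟨n, grow ω n⟩).1 = _
    rw [this]
    rfl
  constructor
  · intro h
    have hball : (grow ω n).1 = ball (n + 1) T := by
      rw [← ball_grow_succ, h, ball_ball (Nat.le_succ _)]
    exact ⟨hball, (choice_eq hball).symm.trans h⟩
  · rintro ⟨hball, hchosen⟩
    exact (choice_eq hball).trans hchosen

theorem grow_eq_iff (ω : Choices) (T : PlanarTree) (n : ℕ) :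
    (grow ω n).1 = ball (n + 1) T ↔ ∀ k < n, ω (stageOf T k) ∈ chosen T (stageOf T k) := by
  induction n with
  | zero => simp [grow, ball_one]
  | succ n ih => rw [grow_succ_eq_iff, ih, Nat.forall_lt_succ_right]

theorem setOf_grow_eq (T : PlanarTree) (n : ℕ) :
    {ω : Choices | (grow ω n).1 = ball (n + 1) T} =
      Set.pi ((Finset.range n).map (stageOf T) : Finset Stage) (chosen T) := by
  ext ω
  simp only [Set.mem_ofPred_eq, grow_eq_iff, Set.mem_pi, Finset.coe_map, Set.mem_image,
    Finset.coe_range, Set.mem_Iio, forall_exists_index, and_imp, forall_apply_eq_imp_iff₂]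

theorem measurableSet_grow_eq (T : PlanarTree) (n : ℕ) :
    MeasurableSet {ω : Choices | (grow ω n).1 = ball (n + 1) T} := by
  rw [setOf_grow_eq]
  exact MeasurableSet.pi (Finset.countable_toSet _) fun i _ => MeasurableSet.of_discrete

theorem stepPMF_chosen {μ : ℝ} (hμ : 0 < μ) {T : PlanarTree} {n : ℕ}
    (h : limitProb μ (n + 1) (ball (n + 1) T) ≠ 0) :
    (stepPMF hμ (stageOf T n)).toMeasure (chosen T (stageOf T n)) =
      limitProb μ (n + 1 + 1) (ball (n + 1 + 1) T) / limitProb μ (n + 1) (ball (n + 1) T) := by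
  have chosen_eq : chosen T (stageOf T n) = {(⟨ball (n + 1 + 1) T, ball_ball le_rfl T,
      ball_ball (Nat.le_succ _) T⟩ : Extension ((stageOf T n).1 + 1) 1 (stageOf T n).2.1)} := by
    ext U
    rw [Set.mem_singleton_iff, Subtype.ext_iff]
    rfl
  rw [chosen_eq, PMF.toMeasure_apply_singleton _ _ MeasurableSet.of_discrete, stepPMF_apply hμ h]
  rfl

theorem choicesMeasure_grow_eq {μ : ℝ} (hμ : 0 < μ) (T : PlanarTree) (n : ℕ) :
    choicesMeasure hμ {ω : Choices | (grow ω n).1 = ball (n + 1) T} =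
      limitProb μ (n + 1) (ball (n + 1) T) := by
  rw [setOf_grow_eq, choicesMeasure, Measure.infinitePi_pi _ fun i _ => MeasurableSet.of_discrete,
    Finset.prod_map]
  induction n with
  | zero => rw [Finset.prod_range_zero, zero_add, ball_one, limitProb_edge]
  | succ n ih =>
    rw [Finset.prod_range_succ, ih]
    by_cases h : limitProb μ (n + 1) (ball (n + 1) T) = 0
    · rw [h, zero_mul, eq_comm, limitProb_eq_zero_iff hμ, width_ball_of_le T le_rfl]
      rw [limitProb_eq_zero_iff hμ, width_ball_of_le T le_rfl] at h
      exact width_succ_eq_zero h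
    · rw [stepPMF_chosen hμ h]
      exact ENNReal.mul_div_cancel h (limitProb_ne_top hμ _ _)

theorem ball_eq_of_forall_ball_succ {Y : ℕ → PlanarTree} (h0 : ∀ n, ball (n + 1) (Y n) = Y n)
    (h : ∀ n, ball (n + 1) (Y (n + 1)) = Y n) {m n : ℕ} (hmn : m ≤ n) :
    ball (m + 1) (Y n) = Y m := by
  induction n, hmn using Nat.le_induction with
  | base => exact h0 m
  | succ n hmn ih => rw [← ih, ← h n, ball_ball (by omega)]

theorem exists_forall_ball_eq {Y : ℕ → PlanarTree} (h0 : ∀ n, ball (n + 1) (Y n) = Y n)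
    (h : ∀ n, ball (n + 1) (Y (n + 1)) = Y n) : ∃ T : PlanarTree, ∀ n, ball (n + 1) T = Y n := by
  have width_eq {m n s : ℕ} (hs : s ≤ m + 1) (hmn : m ≤ n) : (Y n).width s = (Y m).width s := by
    rw [← ball_eq_of_forall_ball_succ h0 h hmn, width_ball_of_le _ hs]
  let T : PlanarTree :=
    { width := fun s => (Y s).width s
      parent := fun s i => ((Y (s + 1)).parent s i).cast (width_eq (by omega) (by omega))
      parent_mono := fun s i j hij => (Y (s + 1)).parent_mono s hij
      width_zero := (Y 0).width_zero
      width_one := (Y 1).width_one }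
  refine ⟨T, fun n => eq_of_val (fun s => ?_) (fun s i hi hi' => ?_)⟩
  · rw [width_ball]
    split_ifs with hs
    · change (Y s).width s = _
      rcases le_total s n with hsn | hsn
      · exact (width_eq (by omega) hsn).symm
      · exact width_eq (by omega) hsn
    · exact (width_eq_zero_of_ball_eq_self (by omega) (h0 n) (by omega)).symm
  · have := le_of_lt_ite hi
    change ((Y (s + 1)).parent s ⟨i, _⟩ : ℕ) = _
    rcases le_total (s + 1) n with hsn | hsn
    · have hball := ball_eq_of_forall_ball_succ h0 h hsn
      exact val_congr hball.symm s i _ (by rwa [width_ball_of_le _ (by omega)])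
    · have hball := ball_eq_of_forall_ball_succ h0 h hsn
      exact val_congr hball s i (by rwa [hball]) hi'

/-- The infinite tree grown from the choices `ω`. -/
noncomputable def grownTree (ω : Choices) : PlanarTree :=
  (exists_forall_ball_eq (fun n => (grow ω n).2) (ball_grow_succ ω)).choose

theorem ball_grownTree (ω : Choices) (n : ℕ) : ball (n + 1) (grownTree ω) = (grow ω n).1 :=
  (exists_forall_ball_eq (fun n => (grow ω n).2) (ball_grow_succ ω)).choose_spec n

theorem preimage_grownTree {T : PlanarTree} {n : ℕ} (hT : ball (n + 1) T = T) :
    grownTree ⁻¹' {U | ball (n + 1) U = T} = {ω | (grow ω n).1 = ball (n + 1) T} := by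
  ext ω
  simp only [Set.mem_preimage, Set.mem_ofPred_eq, ball_grownTree, hT]

theorem measurable_grownTree : Measurable grownTree := by
  refine measurable_of_measurableSet_preimage_cylinder fun n T hT => ?_
  rw [preimage_grownTree hT]
  exact measurableSet_grow_eq T n

/-- The law `ν^{(μ)}` of the grown tree. -/
noncomputable def limitMeasure {μ : ℝ} (hμ : 0 < μ) : Measure PlanarTree :=
  (choicesMeasure hμ).map grownTree

instance isProbabilityMeasure_limitMeasure {μ : ℝ} (hμ : 0 < μ) :
    IsProbabilityMeasure (limitMeasure hμ) :=
  Measure.isProbabilityMeasure_map measurable_grownTree.aemeasurable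

theorem limitMeasure_cylinder {μ : ℝ} (hμ : 0 < μ) {r : ℕ} (hr : 1 ≤ r) {T : PlanarTree}
    (hT : ball r T = T) : limitMeasure hμ {U | ball r U = T} = limitProb μ r T := by
  obtain ⟨n, rfl⟩ := Nat.exists_eq_add_of_le' hr
  rw [limitMeasure, Measure.map_apply measurable_grownTree (measurableSet_cylinder _ _),
    preimage_grownTree hT, choicesMeasure_grow_eq, hT]

end PlanarTree

/-! ### Convergence to the limit measure -/

theorem ofReal_mul_le_of_forall_lt {w b : ℝ} {a L : ℝ≥0∞} (hw : 0 < w) (ha : a ≠ ⊤)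
    (h : ∀ c, 0 ≤ c → c < w → a * ENNReal.ofReal (b * c) ≤ L) :
    a * ENNReal.ofReal (b * w) ≤ L := by
  have hlim : Tendsto (fun c : ℝ => a * ENNReal.ofReal (b * c)) (𝓝[<] w)
      (𝓝 (a * ENNReal.ofReal (b * w))) := by
    refine ENNReal.Tendsto.const_mul (ENNReal.tendsto_ofReal ?_) (Or.inr ha)
    exact ((continuous_const.mul continuous_id).tendsto w).mono_left nhdsWithin_le_nhds
  refine le_of_tendsto hlim ?_
  filter_upwards [self_mem_nhdsWithin, nhdsWithin_le_nhds (lt_mem_nhds hw)] with c hcw hc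
  exact h c hc.le hcw

namespace PlanarTree

open PowerSeries

theorem continuationSeries_eq (μ : ℝ) (k n : ℕ) :
    continuationSeries (heightFugacity μ) k n = ENNReal.ofReal (4 ^ n) *
      ∑' m : ℕ, ENNReal.ofReal (Real.exp (-μ * m) * coeff n (normSeries m ^ k)) := by
  rw [continuationSeries, ← ENNReal.tsum_mul_left]
  refine tsum_congr fun m => ?_
  rw [heightFugacity_pow, ← ENNReal.ofReal_natCast, ← ENNReal.ofReal_mul (Real.exp_pos _).le,
    ← ENNReal.ofReal_mul (by positivity), coeff_normSeries_pow]
  congr 1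
  have cancel : (4 : ℝ) ^ n * (1 / 4) ^ n = 1 := by
    rw [← mul_pow]
    norm_num
  linear_combination (-(Real.exp (-μ * m) * continuations m k n)) * cancel

theorem coeff_normSeries_le_two (m n : ℕ) : coeff n (normSeries m) ≤ 2 := by
  refine (le_hasSum (hasSum_coeff_normSeries m) n fun j _ => coeff_normSeries_nonneg m j).trans ?_
  rw [div_le_iff₀ (by positivity)]
  linarith

theorem coeff_normSeries_pos {m : ℕ} (hm : 1 ≤ m) (n : ℕ) : 0 < coeff n (normSeries m) := by
  have weight_pos : 0 < leadingWeight m := lt_of_lt_of_le (by positivity) (le_leadingWeight m)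
  have ratio_pos : 0 < leadingRatio m := by
    have hm' : (1 : ℝ) ≤ m := by exact_mod_cast hm
    refine pow_pos (Real.cos_pos_of_mem_Ioo ⟨?_, ?_⟩) 2
    · linarith [Real.pi_pos, show 0 < Real.pi / (m + 2) by positivity]
    · exact div_lt_div_of_pos_left Real.pi_pos two_pos (by linarith)
  rw [coeff_normSeries_eq hm]
  have := remainder_nonneg m n
  positivity

theorem continuationSeries_one_ne_top {μ : ℝ} (hμ : 0 < μ) (n : ℕ) :
    continuationSeries (heightFugacity μ) 1 n ≠ ⊤ := by
  rw [continuationSeries_eq]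
  refine ENNReal.mul_ne_top ENNReal.ofReal_ne_top ?_
  refine ne_top_of_le_ne_top (b := ∑' m : ℕ, heightFugacity μ ^ m * 2) ?_
    (ENNReal.tsum_le_tsum fun m => ?_)
  · rw [ENNReal.tsum_mul_right, ENNReal.tsum_geometric]
    exact ENNReal.mul_ne_top (ENNReal.inv_ne_top.2 (one_sub_heightFugacity_ne_zero hμ)) (by simp)
  · rw [heightFugacity_pow, ENNReal.ofReal_mul (Real.exp_pos _).le, pow_one]
    gcongr
    rw [← ENNReal.ofReal_ofNat]
    exact ENNReal.ofReal_le_ofReal (coeff_normSeries_le_two m n)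

theorem continuationSeries_one_ne_zero (μ : ℝ) (n : ℕ) :
    continuationSeries (heightFugacity μ) 1 n ≠ 0 := by
  rw [continuationSeries_eq]
  refine mul_ne_zero (ENNReal.ofReal_pos.2 (by positivity)).ne' fun h => ?_
  refine (ENNReal.tsum_eq_zero.1 h 1).not_gt (ENNReal.ofReal_pos.2 ?_)
  rw [pow_one]
  exact mul_pos (Real.exp_pos _) (coeff_normSeries_pos le_rfl n)

theorem isProbabilityMeasure_finiteSizeMeasure {μ : ℝ} (hμ : 0 < μ) {N : ℕ} (hN : 1 ≤ N) :
    IsProbabilityMeasure (finiteSizeMeasure μ N) := by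
  have partition_ne_zero : partitionFunction μ N ≠ 0 := by
    rw [partitionFunction_eq hμ hN]
    exact mul_ne_zero (one_sub_heightFugacity_ne_zero hμ) (mul_ne_zero (heightFugacity_pos μ).ne'
      (continuationSeries_one_ne_zero μ _))
  have partition_ne_top : partitionFunction μ N ≠ ⊤ := by
    rw [partitionFunction_eq hμ hN]
    exact ENNReal.mul_ne_top (ENNReal.sub_ne_top ENNReal.one_ne_top) (ENNReal.mul_ne_top
      (heightFugacity_lt_one hμ).ne_top (continuationSeries_one_ne_top hμ _))
  refine ⟨?_⟩
  rw [finiteSizeMeasure_apply μ N MeasurableSet.univ]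
  simp only [Set.mem_univ, and_true]
  rw [← tsum_subtype {T : PlanarTree | T.size = (N : ℕ∞)} (weight μ)]
  exact ENNReal.div_self partition_ne_zero partition_ne_top

theorem gwWeight_eq_ofReal {r : ℕ} (hr : 1 ≤ r) {T : PlanarTree} (hw : T.width r ≠ 0) :
    gwWeight r T = ENNReal.ofReal (2 ^ (T.width r - 1) * 4⁻¹ ^ (T.volume r - 1)) := by
  obtain ⟨a, ha⟩ := Nat.exists_eq_succ_of_ne_zero hw
  obtain ⟨b, hb⟩ := Nat.exists_eq_add_of_le' (one_le_volume hr T)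
  rw [gwWeight, ha, hb, ENNReal.ofReal_mul (by positivity), ENNReal.ofReal_pow (by positivity),
    ENNReal.ofReal_pow (by positivity), ENNReal.ofReal_inv_of_pos (by norm_num),
    ENNReal.ofReal_ofNat, ENNReal.ofReal_ofNat, Nat.succ_sub_one, Nat.add_sub_cancel]
  have cancel : (2 : ℝ≥0∞) * 2 * 4⁻¹ = 1 := by
    rw [show (2 : ℝ≥0∞) * 2 = 4 by norm_num]
    exact ENNReal.mul_inv_cancel (by norm_num) (by norm_num)
  calc (2 : ℝ≥0∞) * 2 ^ (a + 1) * 4⁻¹ ^ (b + 1) = 2 ^ a * 4⁻¹ ^ b * (2 * 2 * 4⁻¹) := by ring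
    _ = 2 ^ a * 4⁻¹ ^ b := by rw [cancel, mul_one]

theorem limitProb_eq_ofReal {μ : ℝ} {r : ℕ} (hr : 1 ≤ r) {T : PlanarTree}
    (hw : T.width r ≠ 0) : limitProb μ r T = heightFugacity μ ^ (r - 1) *
      ENNReal.ofReal (4⁻¹ ^ (T.volume r - 1) *
        (2 ^ (T.width r - 1) * harmonicWeight μ (T.width r))) := by
  rw [limitProb, gwWeight_eq_ofReal hr hw, ← ENNReal.ofReal_mul (by positivity)]
  congr 2
  ring

theorem eventually_mul_continuationSeries_le {μ : ℝ} (hμ : 0 < μ) (K s : ℕ) {c : ℝ} (hc0 : 0 ≤ c)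
    (hc : c < 2 ^ (K - 1) * harmonicWeight μ K) :
    ∀ᶠ n : ℕ in atTop, ENNReal.ofReal (4⁻¹ ^ s * c) * continuationSeries (heightFugacity μ) 1 n ≤
      continuationSeries (heightFugacity μ) K (n - s) := by
  filter_upwards [eventually_mul_tsum_le_tsum_coeff_pow hμ K s hc0 hc, eventually_ge_atTop s]
    with n hn hsn
  have hpow : (4 : ℝ) ^ n * 4⁻¹ ^ s = 4 ^ (n - s) := by
    rw [inv_pow, ← div_eq_mul_inv, pow_sub₀ _ (by norm_num) hsn, div_eq_mul_inv]
  simp only [continuationSeries_eq, pow_one]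
  calc _ = ENNReal.ofReal (4 ^ n * 4⁻¹ ^ s) * (ENNReal.ofReal c *
        ∑' m : ℕ, ENNReal.ofReal (Real.exp (-μ * m) * coeff n (normSeries m))) := by
        rw [ENNReal.ofReal_mul (by positivity), ENNReal.ofReal_mul (by positivity)]
        ring
    _ ≤ _ := by
        rw [hpow]
        gcongr

theorem limitProb_le_liminf {μ : ℝ} (hμ : 0 < μ) {r : ℕ} (hr : 1 ≤ r) {T : PlanarTree}
    (hT : ball r T = T) :
    limitProb μ r T ≤ liminf (fun N : ℕ => finiteSizeMeasure μ (N + 1) {U | ball r U = T})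
      atTop := by
  by_cases hw : T.width r = 0
  · rw [(limitProb_eq_zero_iff hμ r T).2 hw]
    exact zero_le
  rw [limitProb_eq_ofReal hr hw]
  refine ofReal_mul_le_of_forall_lt (mul_pos (by positivity) (harmonicWeight_pos hμ hw))
    (ENNReal.pow_ne_top (heightFugacity_lt_one hμ).ne_top) fun c hc0 hc => ?_
  refine le_liminf_of_le (by isBoundedDefault) ?_
  filter_upwards [eventually_mul_continuationSeries_le hμ (T.width r) (T.volume r - 1) hc0 hc,
    eventually_ge_atTop (T.volume r - 1)] with n hn hvol
  rw [finiteSizeMeasure_cylinder hμ hr hT hw (by omega), Nat.add_sub_cancel,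
    show n + 1 - T.volume r = n - (T.volume r - 1) by have := one_le_volume hr T; omega]
  gcongr
  rwa [ENNReal.le_div_iff_mul_le (Or.inl (continuationSeries_one_ne_zero μ _))
    (Or.inl (continuationSeries_one_ne_top hμ _))]

theorem limitMeasure_le_liminf {μ : ℝ} (hμ : 0 < μ) {G : Set PlanarTree} (hG : IsOpen G) :
    limitMeasure hμ G ≤ liminf (fun N : ℕ => finiteSizeMeasure μ (N + 1) G) atTop :=
  measure_le_liminf_of_isOpen (fun _ hr _ hT =>
    (limitMeasure_cylinder hμ hr hT).trans_le (limitProb_le_liminf hμ hr hT)) hG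

/-- Both sides being probability measures, an inequality on open sets suffices: the asymptotics of
the partition functions are needed from one side only. -/
theorem isLocalLimit_limitMeasure {μ : ℝ} (hμ : 0 < μ) : IsLocalLimit μ (limitMeasure hμ) := by
  refine ⟨inferInstance, fun F => ?_⟩
  let ν : ProbabilityMeasure PlanarTree := ⟨limitMeasure hμ, inferInstance⟩
  let νs (N : ℕ) : ProbabilityMeasure PlanarTree :=
    ⟨finiteSizeMeasure μ (N + 1), isProbabilityMeasure_finiteSizeMeasure hμ (Nat.le_add_left 1 N)⟩
  have hlim : Tendsto νs atTop (𝓝 ν) :=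
    tendsto_of_forall_isOpen_le_liminf' fun G hG => limitMeasure_le_liminf hμ hG
  rw [ProbabilityMeasure.tendsto_iff_forall_integral_tendsto] at hlim
  exact (tendsto_add_atTop_iff_nat (f := fun N => ∫ T, F T ∂(finiteSizeMeasure μ N)) 1).1 (hlim F)

end PlanarTree

/-! ### Moments of the volume -/

theorem lintegral_natCast_sub_sq {Ω : Type*} [MeasurableSpace Ω] {P : Measure Ω}
    [IsProbabilityMeasure P] {X : Ω → ℕ} (hX : Measurable X) {m v a : ℝ} (hm : 0 ≤ m) (hv : 0 ≤ v)
    (ha : 0 ≤ a) (hmean : ∫⁻ ω, (X ω : ℝ≥0∞) ∂P = ENNReal.ofReal m)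
    (hsq : ∫⁻ ω, (X ω : ℝ≥0∞) ^ 2 ∂P = ENNReal.ofReal (m ^ 2 + v)) :
    ∫⁻ ω, ENNReal.ofReal (((X ω : ℝ) - a) ^ 2) ∂P = ENNReal.ofReal (v + (m - a) ^ 2) := by
  have hcast : Measurable fun ω => (X ω : ℝ≥0∞) := measurable_from_top.comp hX
  have hpointwise (ω : Ω) : ENNReal.ofReal (((X ω : ℝ) - a) ^ 2) +
      ENNReal.ofReal (2 * a) * (X ω : ℝ≥0∞) = (X ω : ℝ≥0∞) ^ 2 + ENNReal.ofReal (a ^ 2) := by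
    rw [← ENNReal.ofReal_natCast, ← ENNReal.ofReal_mul (by positivity),
      ← ENNReal.ofReal_add (by positivity) (by positivity), ← ENNReal.ofReal_pow (by positivity),
      ← ENNReal.ofReal_add (by positivity) (by positivity)]
    congr 1
    ring
  have hintegral : ∫⁻ ω, ENNReal.ofReal (((X ω : ℝ) - a) ^ 2) ∂P +
      ENNReal.ofReal (2 * a) * ENNReal.ofReal m =
        ENNReal.ofReal (m ^ 2 + v) + ENNReal.ofReal (a ^ 2) := by
    rw [← hmean, ← lintegral_const_mul _ hcast, ← lintegral_add_right _ (hcast.const_mul _)]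
    simp_rw [hpointwise]
    rw [lintegral_add_right _ measurable_const, lintegral_const, measure_univ, mul_one, hsq]
  rw [← ENNReal.ofReal_mul (by positivity),
    ← ENNReal.ofReal_add (by positivity) (by positivity)] at hintegral
  rw [ENNReal.eq_sub_of_add_eq ENNReal.ofReal_ne_top hintegral,
    ← ENNReal.ofReal_sub _ (by positivity)]
  congr 1
  ring

namespace PlanarTree

theorem lintegral_comp_width {μ : ℝ} (hμ : 0 < μ) (n : ℕ) (F : ℕ → ℝ≥0∞) :
    ∫⁻ T, F (T.width (n + 1)) ∂(limitMeasure hμ) = heightFugacity μ ^ n *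
      gwExpectation (n + 1) (fun k => ENNReal.ofReal (harmonicWeight μ k) * F k) := by
  let cylinder (T : BoundedTree (n + 1)) : Set PlanarTree := {U | ball (n + 1) U = T.1}
  have hcover : ⋃ T, cylinder T = Set.univ :=
    Set.eq_univ_of_forall fun U => Set.mem_iUnion.2 ⟨⟨ball (n + 1) U, ball_ball le_rfl U⟩, rfl⟩
  have hconst (T : BoundedTree (n + 1)) : Set.EqOn (fun U : PlanarTree => F (U.width (n + 1)))
      (fun _ => F (T.1.width (n + 1))) (cylinder T) := by
    intro U (hU : ball (n + 1) U = T.1)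
    simp only [← hU, width_ball_of_le U le_rfl]
  rw [← setLIntegral_univ, ← hcover,
    lintegral_iUnion (fun T => measurableSet_cylinder _ _) (pairwise_disjoint_cylinder _),
    gwExpectation, ← ENNReal.tsum_mul_left]
  refine tsum_congr fun T => ?_
  rw [setLIntegral_congr_fun (measurableSet_cylinder _ _) (hconst T), setLIntegral_const,
    limitMeasure_cylinder hμ (Nat.le_add_left 1 n) T.2, limitProb, Nat.add_sub_cancel]
  ring

theorem measurable_width (r : ℕ) : Measurable fun T : PlanarTree => T.width r := by
  refine measurable_to_countable' fun k => IsOpen.measurableSet ?_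
  refine isOpen_iff_forall_mem_open.2 fun T (hT : T.width r = k) =>
    ⟨{U | ball r U = ball r T}, fun U (hU : ball r U = ball r T) => ?_, isOpen_cylinder r _, rfl⟩
  change U.width r = k
  rw [← hT, ← width_ball_of_le U le_rfl, hU, width_ball_of_le T le_rfl]

theorem heightFugacity_pow_mul_ofReal (μ : ℝ) (n : ℕ) (a : ℝ) :
    heightFugacity μ ^ n * ENNReal.ofReal (Real.exp (μ * n) * a) = ENNReal.ofReal a := by
  rw [heightFugacity_pow, ← ENNReal.ofReal_mul (Real.exp_pos _).le, ← mul_assoc, ← Real.exp_add,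
    neg_mul, neg_add_cancel, Real.exp_zero, one_mul]

theorem lintegral_width {μ : ℝ} (hμ : 0 < μ) (n : ℕ) :
    ∫⁻ T, (T.width (n + 1) : ℝ≥0∞) ∂(limitMeasure hμ) =
      ENNReal.ofReal (μ * n ^ 2 + (μ + 2) * n + 1) := by
  rw [lintegral_comp_width hμ n fun k => (k : ℝ≥0∞), gwExpectation_harmonicWeight_mul_self hμ.le,
    heightFugacity_pow_mul_ofReal]
theorem lintegral_width_sq {μ : ℝ} (hμ : 0 < μ) (n : ℕ) :
    ∫⁻ T, (T.width (n + 1) : ℝ≥0∞) ^ 2 ∂(limitMeasure hμ) =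
      ENNReal.ofReal ((μ * n ^ 2 + (μ + 2) * n + 1) ^ 2 +
        n * (n + 1) * (2 * μ * n + μ + 2)) := by
  rw [lintegral_comp_width hμ n fun k => (k : ℝ≥0∞) ^ 2, gwExpectation_harmonicWeight_mul_sq hμ.le,
    heightFugacity_pow_mul_ofReal]
  congr 1
  ring

theorem exists_lintegral_width_sub_sq_le {μ : ℝ} (hμ : 0 < μ) :
    ∃ C : ℝ, 0 ≤ C ∧ ∀ n : ℕ, ∫⁻ T, ENNReal.ofReal (((T.width (n + 1) : ℝ) -
      μ * (n ^ 2 + n + 1 / 3)) ^ 2) ∂(limitMeasure hμ) ≤ ENNReal.ofReal (C * (n + 1) ^ 3) := by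
  refine ⟨2 * μ + 2 + (2 + μ) ^ 2, by positivity, fun n => ?_⟩
  rw [lintegral_natCast_sub_sq (measurable_width (n + 1)) (by positivity) (by positivity)
    (by positivity) (lintegral_width hμ n) (lintegral_width_sq hμ n)]
  refine ENNReal.ofReal_le_ofReal ?_
  have hvariance : (n : ℝ) * (n + 1) * (2 * μ * n + μ + 2) ≤ (2 * μ + 2) * (n + 1) ^ 3 := by
    calc (n : ℝ) * (n + 1) * (2 * μ * n + μ + 2)
        ≤ (n + 1) * (n + 1) * ((2 * μ + 2) * (n + 1)) := by
          gcongr <;> nlinarith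
      _ = _ := by ring
  have hbias : (μ * n ^ 2 + (μ + 2) * n + 1 - μ * (n ^ 2 + n + 1 / 3)) ^ 2 ≤
      (2 + μ) ^ 2 * (n + 1) ^ 3 := by
    calc (μ * n ^ 2 + (μ + 2) * n + 1 - μ * (n ^ 2 + n + 1 / 3)) ^ 2
        ≤ ((2 + μ) * (n + 1)) ^ 2 := sq_le_sq' (by nlinarith) (by nlinarith)
      _ = (2 + μ) ^ 2 * (n + 1) ^ 2 := by ring
      _ ≤ _ := by
          gcongr
          · linarith
          · norm_num
  linarith

theorem volume_sub_sq_le (μ : ℝ) (R : ℕ) (T : PlanarTree) :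
    ((T.volume R : ℝ) - μ / 3 * R ^ 3) ^ 2 ≤
      R * ∑ n ∈ Finset.range R, ((T.width (n + 1) : ℝ) - μ * (n ^ 2 + n + 1 / 3)) ^ 2 := by
  have htelescope : μ / 3 * (R : ℝ) ^ 3 = ∑ n ∈ Finset.range R, μ * ((n : ℝ) ^ 2 + n + 1 / 3) := by
    induction R with
    | zero => simp
    | succ R ih =>
      rw [Finset.sum_range_succ, ← ih]
      push_cast
      ring
  rw [htelescope, volume, Nat.cast_sum, ← Finset.sum_sub_distrib]
  exact sq_sum_le_card_mul_sum_sq.trans_eq (by rw [Finset.card_range])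

theorem exists_lintegral_volume_sub_sq_le {μ : ℝ} (hμ : 0 < μ) :
    ∃ C : ℝ, ∀ R : ℕ, ∫⁻ T, ENNReal.ofReal (((T.volume R : ℝ) - μ / 3 * R ^ 3) ^ 2)
      ∂(limitMeasure hμ) ≤ ENNReal.ofReal (C * R ^ 5) := by
  obtain ⟨C, hC0, hC⟩ := exists_lintegral_width_sub_sq_le hμ
  refine ⟨C, fun R => ?_⟩
  let deviation (n : ℕ) (T : PlanarTree) : ℝ≥0∞ :=
    ENNReal.ofReal (((T.width (n + 1) : ℝ) - μ * (n ^ 2 + n + 1 / 3)) ^ 2)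
  have hmeasurable (n : ℕ) : Measurable (deviation n) :=
    (measurable_from_top (f := fun k : ℕ =>
      ENNReal.ofReal (((k : ℝ) - μ * (n ^ 2 + n + 1 / 3)) ^ 2))).comp (measurable_width (n + 1))
  calc _ ≤ ∫⁻ T, (R : ℝ≥0∞) * ∑ n ∈ Finset.range R, deviation n T ∂(limitMeasure hμ) := by
        refine lintegral_mono fun T => ?_
        rw [← ENNReal.ofReal_sum_of_nonneg fun n _ => sq_nonneg _, ← ENNReal.ofReal_natCast R,
          ← ENNReal.ofReal_mul (by positivity)]
        exact ENNReal.ofReal_le_ofReal (volume_sub_sq_le μ R T)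
    _ = (R : ℝ≥0∞) * ∑ n ∈ Finset.range R, ∫⁻ T, deviation n T ∂(limitMeasure hμ) := by
        rw [lintegral_const_mul _ (Finset.measurable_sum _ fun n _ => hmeasurable n),
          lintegral_finsetSum _ fun n _ => hmeasurable n]
    _ ≤ (R : ℝ≥0∞) * ∑ n ∈ Finset.range R, ENNReal.ofReal (C * R ^ 3) := by
        gcongr with n hn
        refine (hC n).trans (ENNReal.ofReal_le_ofReal ?_)
        have hnR : (n : ℝ) + 1 ≤ R := by exact_mod_cast Finset.mem_range.1 hn
        gcongr
    _ = ENNReal.ofReal (C * R ^ 5) := by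
        rw [Finset.sum_const, Finset.card_range, nsmul_eq_mul, ← ENNReal.ofReal_natCast R,
          ← ENNReal.ofReal_mul (by positivity), ← ENNReal.ofReal_mul (by positivity)]
        congr 1
        ring

end PlanarTree

/-! ### Almost sure volume growth -/

theorem ae_tendsto_of_tsum_lintegral_sub_sq_ne_top {Ω : Type*} [MeasurableSpace Ω] {P : Measure Ω}
    {X : ℕ → Ω → ℝ} (hX : ∀ k, AEMeasurable (X k) P) {l : ℝ}
    (h : ∑' k, ∫⁻ ω, ENNReal.ofReal ((X k ω - l) ^ 2) ∂P ≠ ⊤) :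
    ∀ᵐ ω ∂P, Tendsto (fun k => X k ω) atTop (𝓝 l) := by
  have hmeasurable (k : ℕ) : AEMeasurable (fun ω => ENNReal.ofReal ((X k ω - l) ^ 2)) P :=
    (((hX k).sub_const l).pow_const 2).ennreal_ofReal
  rw [← lintegral_tsum hmeasurable] at h
  filter_upwards [ae_lt_top' (AEMeasurable.tsum hmeasurable) h] with ω hω
  have hsq : Tendsto (fun k => (X k ω - l) ^ 2) atTop (𝓝 0) := by
    have := (ENNReal.tendsto_toReal ENNReal.zero_ne_top).comp
      (ENNReal.tendsto_atTop_zero_of_tsum_ne_top hω.ne)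
    simpa only [Function.comp_def, ENNReal.toReal_ofReal (sq_nonneg _), ENNReal.toReal_zero]
      using this
  rw [tendsto_iff_norm_sub_tendsto_zero]
  simpa only [Real.sqrt_sq_eq_abs, Real.sqrt_zero, Real.norm_eq_abs] using hsq.sqrt

theorem tendsto_div_pow_of_tendsto_sq {v : ℕ → ℝ} (hmono : Monotone v) (hnonneg : 0 ≤ v 0) {d : ℕ}
    {l : ℝ} (h : Tendsto (fun k : ℕ => v (k ^ 2) / ((k : ℝ) ^ 2) ^ d) atTop (𝓝 l)) :
    Tendsto (fun r : ℕ => v r / (r : ℝ) ^ d) atTop (𝓝 l) := by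
  have hratio : Tendsto (fun k : ℕ => (((k : ℝ) / (k + 1)) ^ 2) ^ d) atTop (𝓝 1) := by
    simpa only [one_pow] using ((tendsto_natCast_div_add_atTop (1 : ℝ)).pow 2).pow d
  have hsqrt : Tendsto Nat.sqrt atTop atTop :=
    tendsto_atTop_atTop.2 fun k => ⟨k * k, fun r hr => Nat.le_sqrt.2 hr⟩
  have hlower : Tendsto (fun k : ℕ => v (k ^ 2) / (((k : ℝ) + 1) ^ 2) ^ d) atTop (𝓝 l) := by
    refine ((mul_one l) ▸ h.mul hratio).congr' ?_
    filter_upwards [eventually_gt_atTop 0] with k hk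
    rw [div_pow, div_pow]
    field_simp
  have hupper : Tendsto (fun k : ℕ => v ((k + 1) ^ 2) / ((k : ℝ) ^ 2) ^ d) atTop (𝓝 l) := by
    refine ((div_one l) ▸ ((tendsto_add_atTop_iff_nat 1).2 h).div hratio one_ne_zero).congr' ?_
    filter_upwards [eventually_gt_atTop 0] with k hk
    rw [Pi.div_apply, div_pow, div_pow, Nat.cast_succ]
    field_simp
  refine tendsto_of_tendsto_of_tendsto_of_le_of_le' (hlower.comp hsqrt) (hupper.comp hsqrt) ?_ ?_
  · filter_upwards [eventually_gt_atTop 0] with r hr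
    have hle : (r : ℝ) ≤ ((r.sqrt : ℝ) + 1) ^ 2 := by exact_mod_cast (Nat.lt_succ_sqrt' r).le
    have : 0 ≤ v r := hnonneg.trans (hmono r.zero_le)
    have : v (r.sqrt ^ 2) ≤ v r := hmono (Nat.sqrt_le' r)
    dsimp only [Function.comp_apply]
    gcongr
  · filter_upwards [eventually_gt_atTop 0] with r hr
    have hle : (r.sqrt : ℝ) ^ 2 ≤ r := by exact_mod_cast Nat.sqrt_le' r
    have : 0 < r.sqrt := Nat.sqrt_pos.2 hr
    have : 0 ≤ v ((r.sqrt + 1) ^ 2) := hnonneg.trans (hmono (Nat.zero_le _))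
    have : v r ≤ v ((r.sqrt + 1) ^ 2) := hmono (Nat.lt_succ_sqrt' r).le
    dsimp only [Function.comp_apply]
    gcongr

theorem tendsto_log_div_log_of_tendsto_div_pow {v : ℕ → ℝ} {d : ℕ} {l : ℝ} (hl : l ≠ 0)
    (h : Tendsto (fun r : ℕ => v r / (r : ℝ) ^ d) atTop (𝓝 l)) :
    Tendsto (fun r : ℕ => Real.log (v r) / Real.log r) atTop (𝓝 d) := by
  have hlog : Tendsto (fun r : ℕ => Real.log (r : ℝ)) atTop atTop :=
    Real.tendsto_log_atTop.comp tendsto_natCast_atTop_atTop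
  have hquotient := ((h.log hl).div_atTop hlog).add_const (d : ℝ)
  rw [zero_add] at hquotient
  refine hquotient.congr' ?_
  filter_upwards [h.eventually_ne hl, eventually_gt_atTop 1] with r hr hr1
  have hv : v r ≠ 0 := fun hv => hr (by rw [hv, zero_div])
  have hlogr : Real.log r ≠ 0 := (Real.log_pos (by exact_mod_cast hr1)).ne'
  rw [Real.log_div hv (by positivity), Real.log_pow]
  field_simp
  ring

namespace PlanarTree

theorem exists_lintegral_volume_div_cube_sub_sq_le {μ : ℝ} (hμ : 0 < μ) :
    ∃ C : ℝ, ∀ R : ℕ, 1 ≤ R →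
      ∫⁻ T, ENNReal.ofReal (((T.volume R : ℝ) / R ^ 3 - μ / 3) ^ 2) ∂(limitMeasure hμ) ≤
        ENNReal.ofReal (C * (1 / R)) := by
  obtain ⟨C, hC⟩ := exists_lintegral_volume_sub_sq_le hμ
  refine ⟨C, fun R hR => ?_⟩
  calc _ = ENNReal.ofReal ((1 / R ^ 3) ^ 2) * ∫⁻ T, ENNReal.ofReal
        (((T.volume R : ℝ) - μ / 3 * R ^ 3) ^ 2) ∂(limitMeasure hμ) := by
        rw [← lintegral_const_mul' _ _ ENNReal.ofReal_ne_top]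
        refine lintegral_congr fun T => ?_
        rw [← ENNReal.ofReal_mul (by positivity), ← mul_pow]
        congr 2
        field_simp
    _ ≤ ENNReal.ofReal ((1 / R ^ 3) ^ 2) * ENNReal.ofReal (C * R ^ 5) := by
        gcongr
        exact hC R
    _ = _ := by
        rw [← ENNReal.ofReal_mul (by positivity)]
        congr 1
        field_simp

/-- The second moments are summable along the squares; monotonicity of the volume fills the gaps
between consecutive squares. -/
theorem ae_tendsto_ballVolume_div_cube {μ : ℝ} (hμ : 0 < μ) :
    ∀ᵐ T ∂(limitMeasure hμ),
      Tendsto (fun r : ℕ => (ballVolume r T : ℝ) / (r : ℝ) ^ 3) atTop (𝓝 (μ / 3)) := by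
  obtain ⟨C, hC⟩ := exists_lintegral_volume_div_cube_sub_sq_le hμ
  let ratio (R : ℕ) (T : PlanarTree) : ℝ := T.volume R / R ^ 3
  have hmeasurable (R : ℕ) : Measurable (ratio R) :=
    (measurable_from_top (f := fun v : ℕ => (v : ℝ) / (R : ℝ) ^ 3)).comp
      (Finset.measurable_sum _ fun s _ => measurable_width (s + 1))
  have hsummable : Summable fun k : ℕ => C * (1 / (((k + 1) ^ 2 : ℕ) : ℝ)) := by
    simp only [Nat.cast_pow]
    exact ((summable_nat_add_iff 1).2 (Real.summable_one_div_nat_pow.2 one_lt_two)).mul_left C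
  have hmoments : ∑' k : ℕ, ∫⁻ T, ENNReal.ofReal ((ratio ((k + 1) ^ 2) T - μ / 3) ^ 2)
      ∂(limitMeasure hμ) ≠ ⊤ :=
    ne_top_of_le_ne_top hsummable.tsum_ofReal_ne_top
      (ENNReal.tsum_le_tsum fun k => hC _ (Nat.one_le_pow _ _ k.succ_pos))
  filter_upwards [ae_tendsto_of_tsum_lintegral_sub_sq_ne_top
    (fun k => (hmeasurable ((k + 1) ^ 2)).aemeasurable) hmoments] with T hT
  have hsquares : Tendsto (fun k : ℕ => (T.volume (k ^ 2) : ℝ) / ((k : ℝ) ^ 2) ^ 3) atTop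
      (𝓝 (μ / 3)) := by
    simpa only [ratio, Nat.cast_pow] using
      (tendsto_add_atTop_iff_nat (f := fun k => ratio (k ^ 2) T) 1).1 hT
  refine (tendsto_div_pow_of_tendsto_sq (v := fun r => T.volume r)
    (fun r s hrs => Nat.cast_le.2 (T.volume_mono hrs)) (Nat.cast_nonneg _) hsquares).congr' ?_
  filter_upwards [eventually_ge_atTop 1] with r hr
  rw [ballVolume_eq hr]

theorem eventually_ballVolume_bounds {T : PlanarTree} {l : ℝ} (hl : 0 < l)
    (h : Tendsto (fun r : ℕ => (ballVolume r T : ℝ) / (r : ℝ) ^ 3) atTop (𝓝 l)) :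
    ∀ᶠ r : ℕ in atTop, l / 2 * (r : ℝ) ^ 3 ≤ ballVolume r T ∧
      (ballVolume r T : ℝ) ≤ 2 * l * ((r : ℝ) ^ 3 * Real.log r) := by
  filter_upwards [h.eventually_const_le (half_lt_self hl),
    h.eventually_le_const (show l < 2 * l by linarith), eventually_ge_atTop 3] with r hlow hup hr
  have hr3 : (3 : ℝ) ≤ r := by exact_mod_cast hr
  have hcube : (0 : ℝ) < (r : ℝ) ^ 3 := by positivity
  have hlog : 1 ≤ Real.log r := (Real.le_log_iff_exp_le (by linarith)).2
    ((Real.exp_one_lt_three.le).trans hr3)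
  exact ⟨(le_div_iff₀ hcube).1 hlow, ((div_le_iff₀ hcube).1 hup).trans
    (mul_le_mul_of_nonneg_left (le_mul_of_one_le_right hcube.le hlog) (by positivity))⟩

end PlanarTree

/-- For `μ > 0` the local limit `ν = ν^{(μ)}` exists, and it has cubic volume growth. -/
theorem mainTheorem8 (μ : ℝ) (hμ : 0 < μ) :
    ∃ ν : Measure PlanarTree, PlanarTree.IsLocalLimit μ ν ∧
      (∃ C₁ C₂ : ℝ, 0 < C₁ ∧ 0 < C₂ ∧
        ∀ᵐ T ∂ν, ∃ r₀ : ℕ, ∀ r : ℕ, r₀ ≤ r →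
          C₁ * (r : ℝ) ^ 3 ≤ (PlanarTree.ballVolume r T : ℝ) ∧
          (PlanarTree.ballVolume r T : ℝ) ≤ C₂ * ((r : ℝ) ^ 3 * Real.log (r : ℝ))) ∧
      ∀ᵐ T ∂ν, PlanarTree.HasHausdorffDim T 3 := by
  have hμ3 : 0 < μ / 3 := by positivity
  refine ⟨PlanarTree.limitMeasure hμ, PlanarTree.isLocalLimit_limitMeasure hμ,
    ⟨μ / 3 / 2, 2 * (μ / 3), by positivity, by positivity, ?_⟩, ?_⟩
  · filter_upwards [PlanarTree.ae_tendsto_ballVolume_div_cube hμ] with T hT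
    exact eventually_atTop.1 (PlanarTree.eventually_ballVolume_bounds hμ3 hT)
  · filter_upwards [PlanarTree.ae_tendsto_ballVolume_div_cube hμ] with T hT
    exact tendsto_log_div_log_of_tendsto_div_pow hμ3.ne' hT
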